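/- Let $\sigma\in\{0,1\}$. Then there are numbers $Q^-_\sigma(m,n)\in\mathbb C$, depending only on $\sigma,m,n$, such that the following holds for every $\rho_0>0$. Conventions. On $\mathbb S^2$ let $\partial_\pm=\partial_\theta\pm\frac{i}{\sin\theta}\partial_\phi$ and $\varpi=\cot\theta$. For a quantity $\eta$ of spin weight $s$ let $\eth\eta=-(\partial_+\eta-s\bar\varpi\eta)$ and $\bar\eth\eta=-(\partial_-\eta+s\varpi\eta)$. Let $Y_{s;j,m}$ be the orthonormal spin-weighted spherical harmonics, with $\eth Y_{s;j,m}=\sqrt{(j-s)(j+s+1)}\,Y_{s+1;j,m}$, $\bar\eth Y_{s;j,m}=-\sqrt{(j+s)(j-s+1)}\,Y_{s-1;j,m}$, and $Y_{s;j,m}=0$ if $j<|s|$ or $|m|>j$. Field. Let $\phi_0,\phi_1,\phi_2$, of spin weights $1,0,-1$, be smooth on $\{-1<\tau<1,\ 0\le\rho<\rho_0\}\times\mathbb S^2$ and let them satisfy the Maxwell equations on Minkowski spacetime in the representation of spatial infinity as the cylinder $\{\rho=0\}$ (null infinity $\mathscr I^\pm$ being $\{\tau=\pm1\}$), that is, for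 $\rho>0$, $$(1+\tau)\partial_\tau\phi_0-\rho\partial_\rho\phi_0+\eth\phi_1=-\phi_0,\qquad \partial_\tau\phi_1+\tfrac12(\eth\phi_2+\bar\eth\phi_0)=0,$$ $$(1-\tau)\partial_\tau\phi_2+\rho\partial_\rho\phi_2+\bar\eth\phi_1=\phi_2,\qquad \tau\partial_\tau\phi_1-\rho\partial_\rho\phi_1+\tfrac12(\eth\phi_2-\bar\eth\phi_0)=0.$$ Assume that for $k=0,1,2$ the Taylor expansion of $\phi_k$ at $\rho=0$ has the form $$\phi_k\sim\sum_{p\ge|1-k|}\ \sum_{\ell=|1-k|}^{p}\ \sum_{m=-\ell}^{\ell}\frac1{p!}\,a_{k,p;\ell,m}(\tau)\,Y_{1-k;\ell-\sigma,m}\,\rho^p ,$$ i.e. $\partial_\rho^p\phi_k|_{\rho=0}$ is the coefficient of $\rho^p/p!$ on the right for every $p\ge0$. NP constants at $\mathscr I^-$. Let $\phi_2'=\phi_2/(\rho(1+\tau)^2)$ and $e'=\frac{\sqrt2}{2}\frac1{\rho(1+\tau)^2}\big(-(1+\tau)\partial_\tau+\rho\partial_\rho\big)$. For integers $n\ge0$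 and $|m|\le n+2-\sigma$ put $$F^{n\,-}_m=\lim_{\tau\to-1^+}\ \lim_{\rho\to0^+}\ \frac{(-1)^{n+1}}{(n+1)!\,2^{(n+1)/2}}\int_{\mathbb S^2}\bar Y_{-1;n+2-\sigma,m}\;(e')^{n+1}(\phi_2')\,dS .$$ For $\sigma=1$ these are the electromagnetic Newman--Penrose constants, formed with the harmonics of degree $n+1$. Claim. If $F^{n\,-}_m$ is finite (the limits exist in $\mathbb C$), then it depends only on the initial datum $a_{2,n+2;n+2,m}(0)$. Explicitly, $$F^{n\,-}_m=Q^-_\sigma(m,n)\,D_{n+2,m},\qquad D_{p,m}:=a_{2,p;p,m}(0).$$ -/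

import Mathlib

open Filter Topology Set
open scoped ContDiff

noncomputable section

namespace NPFlat

/-! Angular coordinates on the unit sphere are `0 < θ < π` and `ϕ` (period `2π`).  The complex null
frame is `∂_± = ∂_θ ± (i / sin θ) ∂_ϕ`, for which `[∂_+, ∂_-] = ϖ ∂_+ - conj ϖ ∂_-`, `ϖ = cot θ`. -/

/-- The frame derivative `∂_+`. -/
def dPlus (f : ℝ → ℝ → ℂ) : ℝ → ℝ → ℂ := fun θ ϕ =>
  deriv (fun x => f x ϕ) θ + Complex.I / (Real.sin θ : ℂ) * deriv (fun y => f θ y) ϕ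

/-- The frame derivative `∂_-`. -/
def dMinus (f : ℝ → ℝ → ℂ) : ℝ → ℝ → ℂ := fun θ ϕ =>
  deriv (fun x => f x ϕ) θ - Complex.I / (Real.sin θ : ℂ) * deriv (fun y => f θ y) ϕ

/-- The connection scalar `ϖ` of the frame `∂_±`. -/
def varpi (θ : ℝ) : ℂ := ((Real.cos θ / Real.sin θ : ℝ) : ℂ)

/-- The operator `ð` on quantities of spin weight `s`: `ð η = -(∂_+ η - s (conj ϖ) η)`
(`ϖ` is real here). -/
def eth (s : ℤ) (f : ℝ → ℝ → ℂ) : ℝ → ℝ → ℂ := fun θ ϕ =>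
  -(dPlus f θ ϕ - (s : ℂ) * varpi θ * f θ ϕ)

/-- The operator `ð̄` on quantities of spin weight `s`: `ð̄ η = -(∂_- η + s ϖ η)`. -/
def ethBar (s : ℤ) (f : ℝ → ℝ → ℂ) : ℝ → ℝ → ℂ := fun θ ϕ =>
  -(dMinus f θ ϕ + (s : ℂ) * varpi θ * f θ ϕ)

/-- The factor `(sin θ)^k (d/dx)^(j+k) (x² - 1)^j / (2^j j!)` at `x = cos θ`: the associated Legendre
function of degree `j` and order `k` without the Condon-Shortley sign.  It is `0` for `k > j`. -/
def legendreFactor (j k : ℕ) (θ : ℝ) : ℝ :=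
  Real.sin θ ^ k *
    ((Polynomial.derivative^[j + k]) ((Polynomial.X ^ 2 - 1 : Polynomial ℝ) ^ j)).eval (Real.cos θ)
      / (2 ^ j * (j.factorial : ℝ))

/-- The orthonormal spherical harmonic `Y_{j,m}` (Condon-Shortley phase); `0` for `|m| > j`. -/
def sphHarm (j : ℕ) (m : ℤ) : ℝ → ℝ → ℂ := fun θ ϕ =>
  (if 0 ≤ m then (-1 : ℂ) ^ m.natAbs else 1) *
    ((Real.sqrt ((2 * (j : ℝ) + 1) / (4 * Real.pi) *
        (((j - m.natAbs).factorial : ℝ) / ((j + m.natAbs).factorial : ℝ))) *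
      legendreFactor j m.natAbs θ : ℝ) : ℂ) *
    Complex.exp (Complex.I * (m : ℂ) * (ϕ : ℂ))

/-- The spin-weighted spherical harmonic `Y_{s;j,m}` for `s = -1, 0, 1` (only these weights are
used), normalised so that
`ð Y_{s;j,m} = √((j-s)(j+s+1)) Y_{s+1;j,m}` and `ð̄ Y_{s;j,m} = -√((j+s)(j-s+1)) Y_{s-1;j,m}`.
The degree `j` is an integer and `Y_{s;j,m} = 0` for `j < |s|`. -/
def swsh (s j m : ℤ) : ℝ → ℝ → ℂ := fun θ ϕ =>
  if j < |s| then 0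
  else if s = 0 then sphHarm j.toNat m θ ϕ
  else if s = 1 then
    eth 0 (sphHarm j.toNat m) θ ϕ / (Real.sqrt ((j : ℝ) * ((j : ℝ) + 1)) : ℂ)
  else if s = -1 then
    -ethBar 0 (sphHarm j.toNat m) θ ϕ / (Real.sqrt ((j : ℝ) * ((j : ℝ) + 1)) : ℂ)
  else 0

/-- The integral over the unit sphere with its standard area element. -/
def sphereIntegral (f : ℝ → ℝ → ℂ) : ℂ :=
  ∫ θ in (0 : ℝ)..Real.pi, ∫ ϕ in (0 : ℝ)..(2 * Real.pi), f θ ϕ * (Real.sin θ : ℂ)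

/-- The point of the unit sphere in `ℝ³` with angular coordinates `(θ, ϕ)`. -/
def spherePoint (θ ϕ : ℝ) : Fin 3 → ℝ :=
  ![Real.sin θ * Real.cos ϕ, Real.sin θ * Real.sin ϕ, Real.cos θ]

/-- The vector in `ℂ³` used to read off a quantity of spin weight `s`: the frame vectors
`∂_± = e_θ ± i e_ϕ` for `s = ±1` and the unit normal of the sphere for `s = 0`. -/
def spinVector (s : ℤ) (θ ϕ : ℝ) : Fin 3 → ℂ :=
  if s = 0 then
    ![(Real.sin θ * Real.cos ϕ : ℝ), (Real.sin θ * Real.sin ϕ : ℝ), (Real.cos θ : ℝ)]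
  else
    ![((Real.cos θ * Real.cos ϕ : ℝ) : ℂ) - (s : ℂ) * Complex.I * (Real.sin ϕ : ℂ),
      ((Real.cos θ * Real.sin ϕ : ℝ) : ℂ) + (s : ℂ) * Complex.I * (Real.cos ϕ : ℂ),
      -(Real.sin θ : ℂ)]

/-- `f (τ, ρ, θ, ϕ)` is a smooth quantity of spin weight `s ∈ {-1, 0, 1}` over
`{|τ| < 1, 0 ≤ ρ < ρ₀} × S²`: for `s = ±1` it is the component `α(∂_±)` of a smooth (up to `ρ = 0`)
complex covector field `α`, for `s = 0` it is a smooth function (the normal component of `α`).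
This includes smoothness across the poles of the coordinates. -/
def IsSmoothSpinWeighted (s : ℤ) (ρ₀ : ℝ) (f : ℝ → ℝ → ℝ → ℝ → ℂ) : Prop :=
  ∃ α : ℝ × ℝ × (Fin 3 → ℝ) → (Fin 3 → ℂ),
    ContDiffOn ℝ ∞ α (Ioo (-1) 1 ×ˢ (Ico 0 ρ₀ ×ˢ univ)) ∧
    ∀ τ ∈ Ioo (-1 : ℝ) 1, ∀ ρ ∈ Ico 0 ρ₀, ∀ θ ∈ Ioo 0 Real.pi, ∀ ϕ : ℝ,
      f τ ρ θ ϕ = ∑ i, α (τ, ρ, spherePoint θ ϕ) i * spinVector s θ ϕ i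

/-- The spin weight `1 - n` of the component `φ_n`. -/
def spinWeight (n : Fin 3) : ℤ := 1 - (n : ℤ)

/-- `φ 0, φ 1, φ 2`, as functions of `(τ, ρ, θ, ϕ)`, are the components in the F-gauge of a smooth
solution of the Maxwell (spin-1) equations on the region `|τ| < 1`, `0 < ρ < ρ₀` of the cylinder
representation of Minkowski spacetime, smooth up to the cylinder `ρ = 0`. -/
structure IsMaxwellField (ρ₀ : ℝ) (φ : Fin 3 → ℝ → ℝ → ℝ → ℝ → ℂ) : Prop where
  smooth : ∀ n, IsSmoothSpinWeighted (spinWeight n) ρ₀ (φ n)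
  evolution0 : ∀ τ ∈ Ioo (-1 : ℝ) 1, ∀ ρ ∈ Ioo 0 ρ₀, ∀ θ ∈ Ioo 0 Real.pi, ∀ ϕ : ℝ,
    (1 + τ : ℂ) * deriv (fun t => φ 0 t ρ θ ϕ) τ - ρ * deriv (fun r => φ 0 τ r θ ϕ) ρ
      + eth 0 (φ 1 τ ρ) θ ϕ = -φ 0 τ ρ θ ϕ
  evolution1 : ∀ τ ∈ Ioo (-1 : ℝ) 1, ∀ ρ ∈ Ioo 0 ρ₀, ∀ θ ∈ Ioo 0 Real.pi, ∀ ϕ : ℝ,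
    deriv (fun t => φ 1 t ρ θ ϕ) τ
      + (1 / 2) * (eth (-1) (φ 2 τ ρ) θ ϕ + ethBar 1 (φ 0 τ ρ) θ ϕ) = 0
  evolution2 : ∀ τ ∈ Ioo (-1 : ℝ) 1, ∀ ρ ∈ Ioo 0 ρ₀, ∀ θ ∈ Ioo 0 Real.pi, ∀ ϕ : ℝ,
    (1 - τ : ℂ) * deriv (fun t => φ 2 t ρ θ ϕ) τ + ρ * deriv (fun r => φ 2 τ r θ ϕ) ρ
      + ethBar 0 (φ 1 τ ρ) θ ϕ = φ 2 τ ρ θ ϕ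
  constraint : ∀ τ ∈ Ioo (-1 : ℝ) 1, ∀ ρ ∈ Ioo 0 ρ₀, ∀ θ ∈ Ioo 0 Real.pi, ∀ ϕ : ℝ,
    (τ : ℂ) * deriv (fun t => φ 1 t ρ θ ϕ) τ - ρ * deriv (fun r => φ 1 τ r θ ϕ) ρ
      + (1 / 2) * (eth (-1) (φ 2 τ ρ) θ ϕ - ethBar 1 (φ 0 τ ρ) θ ϕ) = 0

/-- The Taylor expansion of the field at the cylinder `ρ = 0`,
`φ_n = ∑_{p ≥ |1-n|} ∑_{ℓ=|1-n|}^{p} ∑_{m=-ℓ}^{ℓ} (1/p!) a_{n,p;ℓ,m}(τ) Y_{1-n;ℓ-σ,m} ρ^p`,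
stated through the Taylor coefficients `∂_ρ^p φ_n |_{ρ=0}`.  The number `σ` is the shift between the
label `ℓ` of a mode and the degree of its harmonic. -/
def HasExpansion (σ : ℕ) (ρ₀ : ℝ) (φ : Fin 3 → ℝ → ℝ → ℝ → ℝ → ℂ)
    (a : Fin 3 → ℕ → ℕ → ℤ → ℝ → ℂ) : Prop :=
  ∀ n : Fin 3, ∀ p : ℕ, ∀ τ ∈ Ioo (-1 : ℝ) 1, ∀ θ ∈ Ioo 0 Real.pi, ∀ ϕ : ℝ,
    iteratedDerivWithin p (fun ρ => φ n τ ρ θ ϕ) (Ico 0 ρ₀) 0 =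
      ∑ ℓ ∈ Finset.Icc (spinWeight n).natAbs p, ∑ m ∈ Finset.Icc (-(ℓ : ℤ)) ℓ,
        a n p ℓ m τ * swsh (spinWeight n) ((ℓ : ℤ) - σ) m θ ϕ

/-- The derivative along the NP-frame vector at past null infinity that corresponds to
`e'_{00'}` under `τ ↦ -τ`, `∂_τ ↦ -∂_τ`:
`(√2/2) (ρ (1+τ)²)⁻¹ (-(1+τ) ∂_τ + ρ ∂_ρ)`. -/
def npDeriv (f : ℝ → ℝ → ℂ) : ℝ → ℝ → ℂ := fun τ ρ =>
  ((Real.sqrt 2 / 2 * (ρ * (1 + τ) ^ 2)⁻¹ : ℝ) : ℂ) *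
    (-(1 + τ : ℂ) * deriv (fun t => f t ρ) τ + ρ * deriv (fun r => f τ r) ρ)

/-- The component `φ'_2 = φ_2 / (ρ (1+τ)²)` in the NP gauge at past null infinity. -/
def npPhi2 (φ : Fin 3 → ℝ → ℝ → ℝ → ℝ → ℂ) (τ ρ θ ϕ : ℝ) : ℂ :=
  φ 2 τ ρ θ ϕ / ((ρ * (1 + τ) ^ 2 : ℝ) : ℂ)

/-- The integral
`(-1)^(n+1) / ((n+1)! 2^((n+1)/2)) ∫_{S²} conj(Y_{-1;j,m}) e'^(n+1)(φ'_2) dS` over the sphere with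
coordinates `(τ, ρ)`. -/
def npIntegral (φ : Fin 3 → ℝ → ℝ → ℝ → ℝ → ℂ) (n : ℕ) (j m : ℤ) (τ ρ : ℝ) : ℂ :=
  (((-1) ^ (n + 1) / (((n + 1).factorial : ℝ) * Real.sqrt 2 ^ (n + 1)) : ℝ) : ℂ) *
    sphereIntegral (fun θ ϕ => (starRingEnd ℂ) (swsh (-1) j m θ ϕ) *
      (npDeriv^[n + 1]) (fun t r => npPhi2 φ t r θ ϕ) τ ρ)

/-- The quantity `F^n_m` at past null infinity, taken with the harmonic of degree `j`, is finite and
equal to `F`: the limit `ρ → 0`, `τ → -1` of the integrals over spheres (first in `ρ`, then in `τ`)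
exists and is `F`. -/
def IsPastNPConstant (φ : Fin 3 → ℝ → ℝ → ℝ → ℝ → ℂ) (n : ℕ) (j m : ℤ) (F : ℂ) : Prop :=
  ∃ g : ℝ → ℂ,
    (∀ᶠ τ in 𝓝[>] (-1 : ℝ), Tendsto (npIntegral φ n j m τ) (𝓝[>] 0) (𝓝 (g τ))) ∧
    Tendsto g (𝓝[>] (-1 : ℝ)) (𝓝 F)

end NPFlat

end

/-!
# The Newman-Penrose constants at past null infinity

Project the field on the harmonics of degree `j = n + 2 - σ` and order `m`.  With
`L = j (j + 1)` this turns the Maxwell equations into the system `ModeSystem` for three functions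
`b₀, b₁, b₂` of `(τ, ρ)` (`ExtendedField.modeSystem`), by integration by parts over the sphere and
the associated Legendre equation.  Put `p = n + 2`.  By orthogonality of the harmonics
(`modeProj_swsh_eq_zero`) the expansion says that `b₂` vanishes to order `p` at `ρ = 0` and that its
coefficient of order `p` is a multiple of `a_{2,p;p,m}`.  The equations then force `b₀` and `b₁` to
vanish to the same order, so that `b_k = ρ ^ p R_k` with `R_k` smooth up to `ρ = 0`
(`ModeSystem.exists_pow_div`), and `B_k = R_k(·, 0)` solves the ordinary differential equations
`TransportSystem`.

The function `ρ (1 + τ)` is constant along the frame vector `e'`, so that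
`b₂ / (ρ (1 + τ)²) = (ρ (1 + τ)) ^ (p - 1) M` with `M = (1 + τ) ^ (-(p + 1)) R₂`, and each
application of `e'` removes one factor `ρ (1 + τ)` and acts on `M` at `ρ = 0` as a multiple of
`-d/dτ`.  Hence the limit `ρ → 0` of the integrals is a nonzero multiple of the derivative of order
`p - 1` of `H = (1 + τ) ^ (-(p + 1)) B₂` (`ExtendedField.tendsto_npIntegral`).  If this has a
finite limit at `τ = -1`, then `H` is bounded there.

* For `σ = 0`, `j = p`, the quantity `p (1 + τ) B₁ - (1 - τ) B₂` is constant in `τ`.  It measures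
  the logarithmic solution, and boundedness of `H` makes it zero.  This leaves
  `H = B₂(0) (1 - τ) ^ (p - 1)`, whose derivative of order `p - 1` is the constant
  `(-1) ^ (p - 1) (p - 1)! B₂(0)` (`TransportSystem.limit_eq_of_degree_eq`).
* For `σ = 1`, `j = p - 1`, the equations give `(1 + τ) H' + (p + 1) H = C (1 - τ) ^ (p - 2)`.
  Differentiated `p - 1` times this becomes `(1 + τ) G' + 2 p G = 0` for the
  derivative `G` of order `p - 1` of `H`.  So `G` is a multiple of `(1 + τ) ^ (-2 p)`, and a finite
  limit can only be zero (`TransportSystem.limit_eq_zero_of_degree_eq_pred`): finite constants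
  vanish, and `Q = 0`.

The smoothness of the modes up to `ρ = 0` rests on differentiation under the integral sign relative
to a convex parameter set (`contDiffOn_integral`), which also gives Hadamard's lemma there
(`exists_eq_rho_mul`).
-/

noncomputable section

namespace NPFlat

/-! ### Parametric integrals -/

section ParametricIntegral

variable {X E : Type} [NormedAddCommGroup X] [NormedAddCommGroup E]

theorem continuousOn_slice {S : Set X} {a b : ℝ} {f : X × ℝ → E}
    (hf : ContinuousOn f (S ×ˢ Icc a b)) {x : X} (hx : x ∈ S) :
    ContinuousOn (fun t => f (x, t)) (Icc a b) :=
  hf.comp (by fun_prop) fun _ ht => ⟨hx, ht⟩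

theorem intervalIntegrable_slice [NormedSpace ℝ E] {S : Set X} {a b : ℝ} (hab : a ≤ b) {f : X × ℝ → E}
    (hf : ContinuousOn f (S ×ˢ Icc a b)) {x : X} (hx : x ∈ S) :
    IntervalIntegrable (fun t => f (x, t)) MeasureTheory.volume a b := by
  apply ContinuousOn.intervalIntegrable
  rw [uIcc_of_le hab]
  exact continuousOn_slice hf hx

variable [NormedSpace ℝ X] [NormedSpace ℝ E]

/-- Differentiation under the integral sign relative to a convex parameter set `S`, which need not
be open: the integrand has to be differentiable only within `S`. -/
theorem hasFDerivWithinAt_integral {S : Set X} (hS : Convex ℝ S) {a b : ℝ} (hab : a ≤ b)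
    {f : X × ℝ → E} {f' : X × ℝ → X →L[ℝ] E} (hf : ContinuousOn f (S ×ˢ Icc a b))
    (hf' : ContinuousOn f' (S ×ˢ Icc a b))
    (h : ∀ x ∈ S, ∀ t ∈ Icc a b, HasFDerivWithinAt (fun y => f (y, t)) (f' (x, t)) S x)
    [CompleteSpace E] {x : X} (hx : x ∈ S) :
    HasFDerivWithinAt (fun y => ∫ t in a..b, f (y, t)) (∫ t in a..b, f' (x, t)) S x := by
  rw [hasFDerivWithinAt_iff_isLittleO, Asymptotics.isLittleO_iff]
  intro c hc
  have hc' : 0 < c / (b - a + 1) := by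
    have : 0 ≤ b - a := by linarith
    positivity
  obtain ⟨v, hv, hvc⟩ := isCompact_Icc.mem_uniformity_of_prod
    (f := fun x t => f' (x, t)) (k := Icc a b) (s := S) (q := x) (by exact hf') hx
    (Metric.dist_mem_uniformity hc')
  obtain ⟨r, hr, hrv⟩ := Metric.mem_nhdsWithin_iff.1 hv
  filter_upwards [inter_mem (mem_nhdsWithin_of_mem_nhds (Metric.ball_mem_nhds x hr))
    self_mem_nhdsWithin] with y hy
  have hconv : Convex ℝ (Metric.ball x r ∩ S) := (convex_ball x r).inter hS
  have hxm : x ∈ Metric.ball x r ∩ S := ⟨Metric.mem_ball_self hr, hx⟩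
  have key : ∀ t ∈ Icc a b, ‖f (y, t) - f (x, t) - f' (x, t) (y - x)‖
      ≤ c / (b - a + 1) * ‖y - x‖ := by
    intro t ht
    refine hconv.norm_image_sub_le_of_norm_hasFDerivWithin_le'
      (f := fun y => f (y, t)) (f' := fun z => f' (z, t)) (φ := f' (x, t)) ?_ ?_ hxm hy
    · intro z hz
      exact (h z hz.2 t ht).mono inter_subset_right
    · intro z hz
      have := hvc z (hrv hz) t ht
      rw [← dist_eq_norm]
      exact le_of_lt (by simpa [dist_comm] using this)
  have i1 := intervalIntegrable_slice hab hf hy.2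
  have i2 := intervalIntegrable_slice hab hf hx
  have i3 := intervalIntegrable_slice hab hf' hx
  have e : (∫ t in a..b, f (y, t)) - (∫ t in a..b, f (x, t)) - (∫ t in a..b, f' (x, t)) (y - x)
      = ∫ t in a..b, (f (y, t) - f (x, t) - f' (x, t) (y - x)) := by
    rw [intervalIntegral.integral_sub (i1.sub i2), intervalIntegral.integral_sub i1 i2,
      ContinuousLinearMap.intervalIntegral_apply i3]
    exact intervalIntegrable_slice (f := fun z => f' z (y - x)) hab
      (hf'.clm_apply continuousOn_const) hx
  rw [e]
  refine (intervalIntegral.norm_integral_le_of_norm_le_const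
    (C := c / (b - a + 1) * ‖y - x‖) fun t ht => key t ?_).trans ?_
  · rw [uIoc_of_le hab] at ht
    exact ⟨ht.1.le, ht.2⟩
  · have h0 : 0 ≤ b - a := by linarith
    rw [abs_of_nonneg h0, mul_right_comm]
    refine mul_le_mul_of_nonneg_right ?_ (norm_nonneg _)
    rw [div_mul_eq_mul_div, div_le_iff₀ (by positivity)]
    nlinarith

theorem contDiffOn_partial {S : Set X} (hS : UniqueDiffOn ℝ S) {a b : ℝ}
    (hab : a < b) {f : X × ℝ → E} (hf : ContDiffOn ℝ ∞ f (S ×ˢ Icc a b)) :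
    ContDiffOn ℝ ∞ (fun z => (fderivWithin ℝ f (S ×ˢ Icc a b) z).comp
      (ContinuousLinearMap.inl ℝ X ℝ)) (S ×ˢ Icc a b) := by
  have := hf.fderivWithin (m := ∞) (hS.prod (uniqueDiffOn_Icc hab)) (by simp)
  exact this.clm_comp contDiffOn_const

theorem hasFDerivWithinAt_partial {S : Set X} {a b : ℝ} {f : X × ℝ → E}
    (hf : ContDiffOn ℝ ∞ f (S ×ˢ Icc a b)) {x : X} (hx : x ∈ S) {t : ℝ} (ht : t ∈ Icc a b) :
    HasFDerivWithinAt (fun y => f (y, t)) ((fderivWithin ℝ f (S ×ˢ Icc a b) (x, t)).comp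
      (ContinuousLinearMap.inl ℝ X ℝ)) S x := by
  have h1 := (hf.differentiableOn (by simp) (x, t) ⟨hx, ht⟩).hasFDerivWithinAt
  have h2 : HasFDerivWithinAt (fun y : X => (y, t)) (ContinuousLinearMap.inl ℝ X ℝ) S x := by
    simpa using! (hasFDerivWithinAt_id x S).prodMk (hasFDerivWithinAt_const t x S)
  exact h1.comp x h2 (show MapsTo (fun y : X => (y, t)) S (S ×ˢ Icc a b) from
    fun y hy => ⟨hy, ht⟩)

/-- A parametric integral of a smooth function over a compact interval is smooth, also up to the
boundary of the parameter set. -/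
theorem contDiffOn_integral [CompleteSpace E] {S : Set X} (hS : Convex ℝ S) (hu : UniqueDiffOn ℝ S) {a b : ℝ}
    (hab : a < b) {f : X × ℝ → E} (hf : ContDiffOn ℝ ∞ f (S ×ˢ Icc a b)) :
    ContDiffOn ℝ ∞ (fun x => ∫ t in a..b, f (x, t)) S := by
  rw [contDiffOn_infty]
  intro n
  induction n generalizing E with
  | zero =>
    refine contDiffOn_zero.2 fun x hx => ?_
    exact (hasFDerivWithinAt_integral hS hab.le hf.continuousOn
      (contDiffOn_partial hu hab hf).continuousOn
      (fun x hx t ht => hasFDerivWithinAt_partial hf hx ht) hx).continuousWithinAt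
  | succ n ih =>
    have hd : ∀ x ∈ S, HasFDerivWithinAt (fun y => ∫ t in a..b, f (y, t)) _ S x :=
      fun x hx => hasFDerivWithinAt_integral hS hab.le hf.continuousOn
      (contDiffOn_partial hu hab hf).continuousOn
      (fun x hx t ht => hasFDerivWithinAt_partial hf hx ht) hx
    have := contDiffOn_succ_of_fderivWithin (𝕜 := ℝ) (n := n) (s := S)
      (f := fun y => ∫ t in a..b, f (y, t)) (fun x hx => (hd x hx).differentiableWithinAt)
      (by simp) ((ih (contDiffOn_partial hu hab hf)).congr fun x hx => (hd x hx).fderivWithin (hu x hx))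
    exact_mod_cast this

/-- The derivative of a parametric integral along a direction of the parameter space. -/
theorem hasDerivWithinAt_integral [CompleteSpace E] {I : Set ℝ} (hI : Convex ℝ I) (hu : UniqueDiffOn ℝ I) {a b : ℝ}
    (hab : a < b) {f : ℝ × ℝ → E} (hf : ContDiffOn ℝ ∞ f (I ×ˢ Icc a b)) :
    ContDiffOn ℝ ∞ (fun z : ℝ × ℝ => derivWithin (fun r => f (r, z.2)) I z.1) (I ×ˢ Icc a b) ∧
    ∀ x ∈ I, HasDerivWithinAt (fun y => ∫ t in a..b, f (y, t))
      (∫ t in a..b, derivWithin (fun r => f (r, t)) I x) I x := by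
  have hp : ∀ x ∈ I, ∀ t ∈ Icc a b, (fderivWithin ℝ f (I ×ˢ Icc a b) (x, t)).comp
      (ContinuousLinearMap.inl ℝ ℝ ℝ) 1 = derivWithin (fun r => f (r, t)) I x := fun x hx t ht =>
    ((hasFDerivWithinAt_partial hf hx ht).hasDerivWithinAt.derivWithin (hu x hx)).symm
  have hc := contDiffOn_partial hu hab hf
  refine ⟨(hc.clm_apply (contDiffOn_const (c := (1 : ℝ)))).congr
    fun z hz => (hp z.1 hz.1 z.2 hz.2).symm, fun x hx => ?_⟩
  have := (hasFDerivWithinAt_integral hI hab.le hf.continuousOn hc.continuousOn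
      (fun x hx t ht => hasFDerivWithinAt_partial hf hx ht) hx).hasDerivWithinAt
  rw [ContinuousLinearMap.intervalIntegral_apply
    (intervalIntegrable_slice hab.le hc.continuousOn hx)] at this
  convert this using 1
  refine intervalIntegral.integral_congr fun t ht => ?_
  rw [uIcc_of_le hab.le] at ht
  exact (hp x hx t ht).symm

theorem iteratedDerivWithin_integral [CompleteSpace E] {I : Set ℝ} (hI : Convex ℝ I) (hu : UniqueDiffOn ℝ I) {a b : ℝ}
    (hab : a < b) {f : ℝ × ℝ → E} (hf : ContDiffOn ℝ ∞ f (I ×ˢ Icc a b)) (q : ℕ) {x : ℝ}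
    (hx : x ∈ I) :
    iteratedDerivWithin q (fun y => ∫ t in a..b, f (y, t)) I x =
      ∫ t in a..b, iteratedDerivWithin q (fun y => f (y, t)) I x := by
  induction q generalizing f with
  | zero => simp
  | succ q ih =>
    obtain ⟨h1, h2⟩ := hasDerivWithinAt_integral hI hu hab hf
    simp only [iteratedDerivWithin_succ']
    rw [← ih h1]
    exact iteratedDerivWithin_congr (fun y hy => (h2 y hy).derivWithin (hu y hy)) hx

end ParametricIntegral

section

/-! ### Calculus on the strip of pairs `(τ, ρ)` -/

/-- The set of pairs `(τ, ρ)` over which the fields are defined; it contains the part `ρ = 0` of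
its boundary. -/
def strip (ρ₀ : ℝ) : Set (ℝ × ℝ) := Ioo (-1) 1 ×ˢ Ico 0 ρ₀

/-- The partial derivative in `τ` on the strip. -/
def dTau (ρ₀ : ℝ) (c : ℝ × ℝ → ℂ) (x : ℝ × ℝ) : ℂ := fderivWithin ℝ c (strip ρ₀) x (1, 0)

/-- The partial derivative in `ρ` on the strip, one-sided at `ρ = 0`. -/
def dRho (ρ₀ : ℝ) (c : ℝ × ℝ → ℂ) (x : ℝ × ℝ) : ℂ := fderivWithin ℝ c (strip ρ₀) x (0, 1)

variable {ρ₀ : ℝ}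

theorem convex_strip : Convex ℝ (strip ρ₀) := (convex_Ioo _ _).prod (convex_Ico _ _)

theorem uniqueDiffOn_strip : UniqueDiffOn ℝ (strip ρ₀) :=
  (uniqueDiffOn_Ioo _ _).prod (uniqueDiffOn_Ico _ _)

theorem contDiffOn_dTau {c : ℝ × ℝ → ℂ} (hc : ContDiffOn ℝ ∞ c (strip ρ₀)) :
    ContDiffOn ℝ ∞ (dTau ρ₀ c) (strip ρ₀) :=
  (hc.fderivWithin uniqueDiffOn_strip (by simp)).clm_apply contDiffOn_const

theorem contDiffOn_dRho {c : ℝ × ℝ → ℂ} (hc : ContDiffOn ℝ ∞ c (strip ρ₀)) :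
    ContDiffOn ℝ ∞ (dRho ρ₀ c) (strip ρ₀) :=
  (hc.fderivWithin uniqueDiffOn_strip (by simp)).clm_apply contDiffOn_const

theorem hasDerivAt_tau {c : ℝ × ℝ → ℂ} (hc : ContDiffOn ℝ ∞ c (strip ρ₀)) {τ ρ : ℝ}
    (hτ : τ ∈ Ioo (-1 : ℝ) 1) (hρ : ρ ∈ Ico 0 ρ₀) :
    HasDerivAt (fun t => c (t, ρ)) (dTau ρ₀ c (τ, ρ)) τ := by
  have h1 := (hc.differentiableOn (by simp) (τ, ρ) ⟨hτ, hρ⟩).hasFDerivWithinAt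
  have h2 : HasDerivWithinAt (fun t : ℝ => (t, ρ)) (1, 0) (Ioo (-1) 1) τ :=
    (hasDerivWithinAt_id τ _).prodMk (hasDerivWithinAt_const τ _ ρ)
  have h3 : MapsTo (fun t : ℝ => (t, ρ)) (Ioo (-1) 1) (strip ρ₀) := fun t ht => ⟨ht, hρ⟩
  exact (h1.comp_hasDerivWithinAt τ h2 h3).hasDerivAt (isOpen_Ioo.mem_nhds hτ)

theorem hasDerivWithinAt_rho {c : ℝ × ℝ → ℂ} (hc : ContDiffOn ℝ ∞ c (strip ρ₀)) {τ ρ : ℝ}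
    (hτ : τ ∈ Ioo (-1 : ℝ) 1) (hρ : ρ ∈ Ico 0 ρ₀) :
    HasDerivWithinAt (fun r => c (τ, r)) (dRho ρ₀ c (τ, ρ)) (Ico 0 ρ₀) ρ := by
  have h1 := (hc.differentiableOn (by simp) (τ, ρ) ⟨hτ, hρ⟩).hasFDerivWithinAt
  have h2 : HasDerivWithinAt (fun r : ℝ => (τ, r)) (0, 1) (Ico 0 ρ₀) ρ :=
    (hasDerivWithinAt_const ρ _ τ).prodMk (hasDerivWithinAt_id ρ _)
  have h3 : MapsTo (fun r : ℝ => (τ, r)) (Ico 0 ρ₀) (strip ρ₀) := fun t ht => ⟨hτ, ht⟩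
  exact h1.comp_hasDerivWithinAt ρ h2 h3

theorem hasDerivAt_rho {c : ℝ × ℝ → ℂ} (hc : ContDiffOn ℝ ∞ c (strip ρ₀)) {τ ρ : ℝ}
    (hτ : τ ∈ Ioo (-1 : ℝ) 1) (hρ : ρ ∈ Ioo 0 ρ₀) :
    HasDerivAt (fun r => c (τ, r)) (dRho ρ₀ c (τ, ρ)) ρ :=
  (hasDerivWithinAt_rho hc hτ (Ioo_subset_Ico_self hρ)).hasDerivAt (Ico_mem_nhds hρ.1 hρ.2)

theorem contDiffOn_rho_slice {c : ℝ × ℝ → ℂ} (hc : ContDiffOn ℝ ∞ c (strip ρ₀)) {τ : ℝ}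
    (hτ : τ ∈ Ioo (-1 : ℝ) 1) : ContDiffOn ℝ ∞ (fun r => c (τ, r)) (Ico 0 ρ₀) :=
  hc.comp (by fun_prop) fun _ hr => ⟨hτ, hr⟩

theorem tendsto_rho_zero {c : ℝ × ℝ → ℂ} (hc : ContDiffOn ℝ ∞ c (strip ρ₀)) (hρ₀ : 0 < ρ₀)
    {τ : ℝ} (hτ : τ ∈ Ioo (-1 : ℝ) 1) :
    Tendsto (fun r => c (τ, r)) (𝓝[>] 0) (𝓝 (c (τ, 0))) := by
  have h := ((contDiffOn_rho_slice hc hτ).continuousOn 0 ⟨le_rfl, hρ₀⟩)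
  exact h.tendsto.mono_left (nhdsWithin_le_of_mem (mem_of_superset
    (Ioo_mem_nhdsGT hρ₀) Ioo_subset_Ico_self))

/-- A function continuous on the strip that vanishes for `ρ > 0` vanishes. -/
theorem eq_zero_of_eq_zero_of_pos {c : ℝ × ℝ → ℂ} (hc : ContDiffOn ℝ ∞ c (strip ρ₀))
    (h : ∀ τ ∈ Ioo (-1 : ℝ) 1, ∀ ρ ∈ Ioo 0 ρ₀, c (τ, ρ) = 0) {x : ℝ × ℝ} (hx : x ∈ strip ρ₀) :
    c x = 0 := by
  obtain ⟨τ, ρ⟩ := x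
  obtain ⟨hτ, hρ⟩ := hx
  dsimp only at hτ hρ
  have hρ₀ : 0 < ρ₀ := hρ.1.trans_lt hρ.2
  rcases hρ.1.eq_or_lt with h0 | h0
  · subst h0
    refine tendsto_nhds_unique (tendsto_rho_zero hc hρ₀ hτ) (tendsto_const_nhds.congr' ?_)
    filter_upwards [Ioo_mem_nhdsGT hρ₀] with r hr using (h τ hτ r hr).symm
  · exact h τ hτ ρ ⟨h0, hρ.2⟩

/-- Hadamard's lemma: a smooth function that vanishes at `ρ = 0` is `ρ` times a smooth function. -/
theorem exists_eq_rho_mul {c : ℝ × ℝ → ℂ} (hc : ContDiffOn ℝ ∞ c (strip ρ₀))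
    (h : ∀ τ ∈ Ioo (-1 : ℝ) 1, c (τ, 0) = 0) :
    ∃ R : ℝ × ℝ → ℂ, ContDiffOn ℝ ∞ R (strip ρ₀) ∧ ∀ x ∈ strip ρ₀, c x = x.2 * R x := by
  refine ⟨fun x => ∫ t in (0 : ℝ)..1, dRho ρ₀ c (x.1, t * x.2), ?_, ?_⟩
  · refine contDiffOn_integral (f := fun z : (ℝ × ℝ) × ℝ => dRho ρ₀ c (z.1.1, z.2 * z.1.2))
      convex_strip uniqueDiffOn_strip zero_lt_one ?_
    refine (contDiffOn_dRho hc).comp (by fun_prop) ?_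
    rintro ⟨⟨τ, ρ⟩, t⟩ ⟨⟨hτ, hρ⟩, ht⟩
    exact ⟨hτ, mul_nonneg ht.1 hρ.1, (mul_le_of_le_one_left hρ.1 ht.2).trans_lt hρ.2⟩
  · rintro ⟨τ, ρ⟩ ⟨hτ, hρ⟩
    dsimp only at hτ hρ ⊢
    have hsub : Icc 0 ρ ⊆ Ico 0 ρ₀ := fun r hr => ⟨hr.1, hr.2.trans_lt hρ.2⟩
    have hcont : ContinuousOn (fun r => dRho ρ₀ c (τ, r)) (Icc 0 ρ) :=
      (contDiffOn_rho_slice (contDiffOn_dRho hc) hτ).continuousOn.mono hsub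
    have hftc : ∫ r in (0 : ℝ)..ρ, dRho ρ₀ c (τ, r) = c (τ, ρ) - c (τ, 0) := by
      refine intervalIntegral.integral_eq_sub_of_hasDerivAt_of_le hρ.1
        ((contDiffOn_rho_slice hc hτ).continuousOn.mono hsub)
        (fun r hr => hasDerivAt_rho hc hτ ⟨hr.1, hr.2.trans hρ.2⟩) ?_
      apply ContinuousOn.intervalIntegrable
      rwa [uIcc_of_le hρ.1]
    rw [h τ hτ, sub_zero] at hftc
    have := intervalIntegral.smul_integral_comp_mul_right (a := 0) (b := 1)
      (fun r => dRho ρ₀ c (τ, r)) ρ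
    rw [zero_mul, one_mul, hftc, Complex.real_smul] at this
    exact this.symm

theorem iteratedDerivWithin_pow_mul (hρ₀ : 0 < ρ₀) (q : ℕ) {R : ℝ → ℂ}
    (hR : ContDiffOn ℝ ∞ R (Ico 0 ρ₀)) :
    iteratedDerivWithin q (fun r : ℝ => (r : ℂ) ^ q * R r) (Ico 0 ρ₀) 0 = q.factorial * R 0 := by
  have h0 : (0 : ℝ) ∈ Ico 0 ρ₀ := ⟨le_rfl, hρ₀⟩
  induction q generalizing R with
  | zero => simp
  | succ q ih =>
    have hd : ContDiffOn ℝ ∞ (derivWithin R (Ico 0 ρ₀)) (Ico 0 ρ₀) :=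
      hR.derivWithin (uniqueDiffOn_Ico _ _) (by simp)
    have hofReal : ContDiffOn ℝ ∞ (fun r : ℝ => (r : ℂ)) (Ico 0 ρ₀) :=
      Complex.ofRealCLM.contDiff.contDiffOn
    rw [iteratedDerivWithin_succ',
      iteratedDerivWithin_congr (g := fun r : ℝ => (r : ℂ) ^ q *
        ((q + 1 : ℂ) * R r + r * derivWithin R (Ico 0 ρ₀) r)) _ h0, ih]
    · push_cast [Nat.factorial_succ]
      simp
      ring
    · exact (contDiffOn_const.mul hR).add (hofReal.mul hd)
    · intro r hr
      have h1 : HasDerivWithinAt (fun r : ℝ => (r : ℂ) ^ (q + 1)) ((q + 1 : ℂ) * (r : ℂ) ^ q)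
          (Ico 0 ρ₀) r := by
        have := (Complex.ofRealCLM.hasDerivAt (x := r)).pow (q + 1)
        simpa using! this.hasDerivWithinAt
      have h2 := (hR.differentiableOn (by simp) r hr).hasDerivWithinAt
      refine ((h1.mul h2).derivWithin (uniqueDiffOn_Ico _ _ r hr)).trans ?_
      ring

/-! ### The mode equations -/

/-- The Maxwell equations for one harmonic mode: `b 0`, `b 1`, `b 2` are functions of `(τ, ρ)`,
`L` is the eigenvalue of the mode, and `ρ ^ q` times the triple solves the original equations. -/
structure ModeSystem (ρ₀ : ℝ) (L : ℂ) (q : ℕ) (b : Fin 3 → ℝ × ℝ → ℂ) : Prop where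
  smooth : ∀ k, ContDiffOn ℝ ∞ (b k) (strip ρ₀)
  evolution0 : ∀ x ∈ strip ρ₀, (1 + x.1) * dTau ρ₀ (b 0) x - x.2 * dRho ρ₀ (b 0) x - q * b 0 x
    + L * b 1 x + b 0 x = 0
  evolution1 : ∀ x ∈ strip ρ₀, dTau ρ₀ (b 1) x + (1 / 2) * (b 2 x - b 0 x) = 0
  evolution2 : ∀ x ∈ strip ρ₀, (1 - x.1) * dTau ρ₀ (b 2) x + x.2 * dRho ρ₀ (b 2) x + q * b 2 x
    - L * b 1 x - b 2 x = 0
  constraint : ∀ x ∈ strip ρ₀, x.1 * dTau ρ₀ (b 1) x - x.2 * dRho ρ₀ (b 1) x - q * b 1 x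
    + (1 / 2) * (b 2 x + b 0 x) = 0

/-- The mode equations need only be checked for `ρ > 0`. -/
theorem ModeSystem.of_pos {L : ℂ} {q : ℕ} {b : Fin 3 → ℝ × ℝ → ℂ}
    (hb : ∀ k, ContDiffOn ℝ ∞ (b k) (strip ρ₀))
    (h : ∀ τ ∈ Ioo (-1 : ℝ) 1, ∀ ρ ∈ Ioo 0 ρ₀,
      (1 + τ) * dTau ρ₀ (b 0) (τ, ρ) - ρ * dRho ρ₀ (b 0) (τ, ρ) - q * b 0 (τ, ρ)
        + L * b 1 (τ, ρ) + b 0 (τ, ρ) = 0 ∧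
      dTau ρ₀ (b 1) (τ, ρ) + (1 / 2) * (b 2 (τ, ρ) - b 0 (τ, ρ)) = 0 ∧
      (1 - τ) * dTau ρ₀ (b 2) (τ, ρ) + ρ * dRho ρ₀ (b 2) (τ, ρ) + q * b 2 (τ, ρ)
        - L * b 1 (τ, ρ) - b 2 (τ, ρ) = 0 ∧
      τ * dTau ρ₀ (b 1) (τ, ρ) - ρ * dRho ρ₀ (b 1) (τ, ρ) - q * b 1 (τ, ρ)
        + (1 / 2) * (b 2 (τ, ρ) + b 0 (τ, ρ)) = 0) :
    ModeSystem ρ₀ L q b := by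
  have h1 : ContDiffOn ℝ ∞ (fun x : ℝ × ℝ => (x.1 : ℂ)) (strip ρ₀) :=
    (Complex.ofRealCLM.contDiff.comp contDiff_fst).contDiffOn
  have h2 : ContDiffOn ℝ ∞ (fun x : ℝ × ℝ => (x.2 : ℂ)) (strip ρ₀) :=
    (Complex.ofRealCLM.contDiff.comp contDiff_snd).contDiffOn
  have hT := fun k => contDiffOn_dTau (hb k)
  have hR := fun k => contDiffOn_dRho (hb k)
  refine ⟨hb,
    fun x => eq_zero_of_eq_zero_of_pos (c := fun x => (1 + x.1) * dTau ρ₀ (b 0) x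
      - x.2 * dRho ρ₀ (b 0) x - q * b 0 x + L * b 1 x + b 0 x) ?_
      fun τ hτ ρ hρ => (h τ hτ ρ hρ).1,
    fun x => eq_zero_of_eq_zero_of_pos (c := fun x => dTau ρ₀ (b 1) x
      + (1 / 2) * (b 2 x - b 0 x)) ?_ fun τ hτ ρ hρ => (h τ hτ ρ hρ).2.1,
    fun x => eq_zero_of_eq_zero_of_pos (c := fun x => (1 - x.1) * dTau ρ₀ (b 2) x
      + x.2 * dRho ρ₀ (b 2) x + q * b 2 x - L * b 1 x - b 2 x) ?_
      fun τ hτ ρ hρ => (h τ hτ ρ hρ).2.2.1,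
    fun x => eq_zero_of_eq_zero_of_pos (c := fun x => x.1 * dTau ρ₀ (b 1) x
      - x.2 * dRho ρ₀ (b 1) x - q * b 1 x + (1 / 2) * (b 2 x + b 0 x)) ?_
      fun τ hτ ρ hρ => (h τ hτ ρ hρ).2.2.2⟩
  · exact (((((contDiffOn_const.add h1).mul (hT 0)).sub (h2.mul (hR 0))).sub
      (contDiffOn_const.mul (hb 0))).add (contDiffOn_const.mul (hb 1))).add (hb 0)
  · exact (hT 1).add (contDiffOn_const.mul ((hb 2).sub (hb 0)))
  · exact (((((contDiffOn_const.sub h1).mul (hT 2)).add (h2.mul (hR 2))).add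
      (contDiffOn_const.mul (hb 2))).sub (contDiffOn_const.mul (hb 1))).sub (hb 2)
  · exact (((h1.mul (hT 1)).sub (h2.mul (hR 1))).sub
      (contDiffOn_const.mul (hb 1))).add (contDiffOn_const.mul ((hb 2).add (hb 0)))

theorem dTau_rho_mul {c R : ℝ × ℝ → ℂ} (hc : ContDiffOn ℝ ∞ c (strip ρ₀))
    (hR : ContDiffOn ℝ ∞ R (strip ρ₀)) (h : ∀ x ∈ strip ρ₀, c x = x.2 * R x) {τ ρ : ℝ}
    (hτ : τ ∈ Ioo (-1 : ℝ) 1) (hρ : ρ ∈ Ioo 0 ρ₀) :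
    dTau ρ₀ c (τ, ρ) = ρ * dTau ρ₀ R (τ, ρ) := by
  have hρ' := Ioo_subset_Ico_self hρ
  refine (hasDerivAt_tau hc hτ hρ').unique
    (((hasDerivAt_tau hR hτ hρ').const_mul (ρ : ℂ)).congr_of_eventuallyEq ?_)
  filter_upwards [isOpen_Ioo.mem_nhds hτ] with t ht using h (t, ρ) ⟨ht, hρ'⟩

theorem dRho_rho_mul {c R : ℝ × ℝ → ℂ} (hc : ContDiffOn ℝ ∞ c (strip ρ₀))
    (hR : ContDiffOn ℝ ∞ R (strip ρ₀)) (h : ∀ x ∈ strip ρ₀, c x = x.2 * R x) {τ ρ : ℝ}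
    (hτ : τ ∈ Ioo (-1 : ℝ) 1) (hρ : ρ ∈ Ioo 0 ρ₀) :
    dRho ρ₀ c (τ, ρ) = R (τ, ρ) + ρ * dRho ρ₀ R (τ, ρ) := by
  have h1 : HasDerivAt (fun r : ℝ => (r : ℂ)) 1 ρ := by
    simpa using! Complex.ofRealCLM.hasDerivAt (x := ρ)
  have h2 := h1.mul (hasDerivAt_rho hR hτ hρ)
  rw [one_mul] at h2
  refine (hasDerivAt_rho hc hτ hρ).unique (h2.congr_of_eventuallyEq ?_)
  filter_upwards [isOpen_Ioo.mem_nhds hρ] with r hr using h (τ, r) ⟨hτ, Ioo_subset_Ico_self hr⟩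

/-- If the component `b 2` of a solution vanishes at `ρ = 0`, so do the others, and `ρ` can be
divided out of the whole solution. -/
theorem ModeSystem.exists_div {L : ℂ} (hL : L ≠ 0) {q : ℕ} {b : Fin 3 → ℝ × ℝ → ℂ}
    (hρ₀ : 0 < ρ₀) (hb : ModeSystem ρ₀ L q b) (h2 : ∀ τ ∈ Ioo (-1 : ℝ) 1, b 2 (τ, 0) = 0) :
    ∃ R, ModeSystem ρ₀ L (q + 1) R ∧ ∀ k, ∀ x ∈ strip ρ₀, b k x = x.2 * R k x := by
  have h0mem : (0 : ℝ) ∈ Ico 0 ρ₀ := ⟨le_rfl, hρ₀⟩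
  have hd : ∀ k, (∀ τ ∈ Ioo (-1 : ℝ) 1, b k (τ, 0) = 0) →
      ∀ τ ∈ Ioo (-1 : ℝ) 1, dTau ρ₀ (b k) (τ, 0) = 0 := by
    intro k hk τ hτ
    refine (hasDerivAt_tau (hb.smooth k) hτ h0mem).unique
      ((hasDerivAt_const τ (0 : ℂ)).congr_of_eventuallyEq ?_)
    filter_upwards [isOpen_Ioo.mem_nhds hτ] with t ht using hk t ht
  have h1 : ∀ τ ∈ Ioo (-1 : ℝ) 1, b 1 (τ, 0) = 0 := by
    intro τ hτ
    have := hb.evolution2 (τ, 0) ⟨hτ, h0mem⟩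
    simp only [hd 2 h2 τ hτ, h2 τ hτ] at this
    simpa [hL] using this
  have h0 : ∀ τ ∈ Ioo (-1 : ℝ) 1, b 0 (τ, 0) = 0 := by
    intro τ hτ
    have := hb.evolution1 (τ, 0) ⟨hτ, h0mem⟩
    simp only [hd 1 h1 τ hτ, h2 τ hτ] at this
    simpa using this
  have hall : ∀ k, ∀ τ ∈ Ioo (-1 : ℝ) 1, b k (τ, 0) = 0 := by
    intro k
    fin_cases k
    exacts [h0, h1, h2]
  choose R hR hbR using fun k => exists_eq_rho_mul (hb.smooth k) (hall k)
  refine ⟨R, ModeSystem.of_pos hR fun τ hτ ρ hρ => ?_, hbR⟩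
  have hx : (τ, ρ) ∈ strip ρ₀ := ⟨hτ, Ioo_subset_Ico_self hρ⟩
  have hne : (ρ : ℂ) ≠ 0 := by exact_mod_cast hρ.1.ne'
  have eT := fun k => dTau_rho_mul (hb.smooth k) (hR k) (hbR k) hτ hρ
  have eR := fun k => dRho_rho_mul (hb.smooth k) (hR k) (hbR k) hτ hρ
  have e0 := hb.evolution0 _ hx
  have e1 := hb.evolution1 _ hx
  have e2 := hb.evolution2 _ hx
  have e3 := hb.constraint _ hx
  simp only [eT, eR, hbR _ _ hx] at e0 e1 e2 e3
  push_cast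
  refine ⟨?_, ?_, ?_, ?_⟩ <;> apply mul_left_cancel₀ hne <;> rw [mul_zero]
  · rw [← e0]; ring
  · rw [← e1]; ring
  · rw [← e2]; ring
  · rw [← e3]; ring

/-- A solution whose component `b 2` vanishes to order `p` at `ρ = 0` is `ρ ^ p` times a solution of
the equations with exponent `p`. -/
theorem ModeSystem.exists_pow_div {L : ℂ} (hL : L ≠ 0) {b : Fin 3 → ℝ × ℝ → ℂ} (hρ₀ : 0 < ρ₀)
    (hb : ModeSystem ρ₀ L 0 b) (p : ℕ)
    (h2 : ∀ q < p, ∀ τ ∈ Ioo (-1 : ℝ) 1,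
      iteratedDerivWithin q (fun r => b 2 (τ, r)) (Ico 0 ρ₀) 0 = 0) :
    ∃ R, ModeSystem ρ₀ L p R ∧ (∀ k, ∀ x ∈ strip ρ₀, b k x = (x.2 : ℂ) ^ p * R k x) ∧
      ∀ τ ∈ Ioo (-1 : ℝ) 1, iteratedDerivWithin p (fun r => b 2 (τ, r)) (Ico 0 ρ₀) 0 =
        p.factorial * R 2 (τ, 0) := by
  suffices H : ∃ R, ModeSystem ρ₀ L p R ∧ (∀ k, ∀ x ∈ strip ρ₀, b k x = (x.2 : ℂ) ^ p * R k x) by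
    obtain ⟨R, hR, hbR⟩ := H
    refine ⟨R, hR, hbR, fun τ hτ => ?_⟩
    rw [← iteratedDerivWithin_pow_mul hρ₀ p (contDiffOn_rho_slice (hR.smooth 2) hτ)]
    exact iteratedDerivWithin_congr (fun r hr => hbR 2 (τ, r) ⟨hτ, hr⟩) ⟨le_rfl, hρ₀⟩
  induction p with
  | zero => exact ⟨b, hb, by simp⟩
  | succ p ih =>
    obtain ⟨R, hR, hbR⟩ := ih fun q hq => h2 q (by omega)
    have hR2 : ∀ τ ∈ Ioo (-1 : ℝ) 1, R 2 (τ, 0) = 0 := by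
      intro τ hτ
      have h := iteratedDerivWithin_pow_mul hρ₀ p (contDiffOn_rho_slice (hR.smooth 2) hτ)
      rw [← iteratedDerivWithin_congr (fun r hr => hbR 2 (τ, r) ⟨hτ, hr⟩) ⟨le_rfl, hρ₀⟩,
        h2 p (by omega) τ hτ] at h
      simpa [Nat.factorial_ne_zero] using h.symm
    obtain ⟨R', hR', hRR'⟩ := hR.exists_div hL hρ₀ hR2
    refine ⟨R', hR', fun k x hx => ?_⟩
    rw [hbR k x hx, hRR' k x hx, pow_succ]
    ring

end

section

/-! ### The transport equations on the cylinder -/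

/-- The mode equations at `ρ = 0`, a system of ordinary differential equations in `τ`. -/
structure TransportSystem (L : ℂ) (p : ℕ) (B : Fin 3 → ℝ → ℂ) : Prop where
  smooth : ∀ k, ContDiffOn ℝ ∞ (B k) (Ioo (-1) 1)
  evolution0 : ∀ τ ∈ Ioo (-1 : ℝ) 1, (1 + τ) * deriv (B 0) τ = (p - 1) * B 0 τ - L * B 1 τ
  evolution1 : ∀ τ ∈ Ioo (-1 : ℝ) 1, deriv (B 1) τ = (1 / 2) * (B 0 τ - B 2 τ)
  evolution2 : ∀ τ ∈ Ioo (-1 : ℝ) 1, (1 - τ) * deriv (B 2) τ = (1 - p) * B 2 τ + L * B 1 τ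
  constraint : ∀ τ ∈ Ioo (-1 : ℝ) 1, p * B 1 τ = τ * deriv (B 1) τ + (1 / 2) * (B 2 τ + B 0 τ)

theorem ModeSystem.transportSystem {ρ₀ : ℝ} (hρ₀ : 0 < ρ₀) {L : ℂ} {p : ℕ}
    {b : Fin 3 → ℝ × ℝ → ℂ} (hb : ModeSystem ρ₀ L p b) :
    TransportSystem L p (fun k τ => b k (τ, 0)) := by
  have h0 : (0 : ℝ) ∈ Ico 0 ρ₀ := ⟨le_rfl, hρ₀⟩
  have hd : ∀ k, ∀ τ ∈ Ioo (-1 : ℝ) 1, deriv (fun t => b k (t, 0)) τ = dTau ρ₀ (b k) (τ, 0) :=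
    fun k τ hτ => (hasDerivAt_tau (hb.smooth k) hτ h0).deriv
  refine ⟨fun k => (hb.smooth k).comp (by fun_prop) fun τ hτ => ⟨hτ, h0⟩, fun τ hτ => ?_,
    fun τ hτ => ?_, fun τ hτ => ?_, fun τ hτ => ?_⟩
  · have := hb.evolution0 (τ, 0) ⟨hτ, h0⟩
    rw [hd 0 τ hτ]
    push_cast at this
    linear_combination this
  · have := hb.evolution1 (τ, 0) ⟨hτ, h0⟩
    rw [hd 1 τ hτ]
    linear_combination this
  · have := hb.evolution2 (τ, 0) ⟨hτ, h0⟩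
    rw [hd 2 τ hτ]
    push_cast at this
    linear_combination this
  · have := hb.constraint (τ, 0) ⟨hτ, h0⟩
    rw [hd 1 τ hτ]
    push_cast at this
    linear_combination -this

theorem hasDerivAt_of_contDiffOn_Ioo {f : ℝ → ℂ} (hf : ContDiffOn ℝ ∞ f (Ioo (-1) 1)) {τ : ℝ}
    (hτ : τ ∈ Ioo (-1 : ℝ) 1) : HasDerivAt f (deriv f τ) τ :=
  ((hf.differentiableOn (by simp)).differentiableAt (isOpen_Ioo.mem_nhds hτ)).hasDerivAt

theorem contDiffOn_iteratedDeriv {f : ℝ → ℂ} (hf : ContDiffOn ℝ ∞ f (Ioo (-1) 1)) (i : ℕ) :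
    ContDiffOn ℝ ∞ (iteratedDeriv i f) (Ioo (-1) 1) := by
  induction i with
  | zero => simpa using hf
  | succ i ih =>
    rw [iteratedDeriv_succ]
    exact ih.deriv_of_isOpen isOpen_Ioo (by simp)

theorem hasDerivAt_iteratedDeriv {f : ℝ → ℂ} (hf : ContDiffOn ℝ ∞ f (Ioo (-1) 1)) (i : ℕ) {τ : ℝ}
    (hτ : τ ∈ Ioo (-1 : ℝ) 1) : HasDerivAt (iteratedDeriv i f) (iteratedDeriv (i + 1) f τ) τ := by
  rw [iteratedDeriv_succ]
  exact hasDerivAt_of_contDiffOn_Ioo (contDiffOn_iteratedDeriv hf i) hτ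

theorem eq_of_hasDerivAt_zero {f : ℝ → ℂ} (hf : ∀ τ ∈ Ioo (-1 : ℝ) 1, HasDerivAt f 0 τ)
    {τ τ' : ℝ} (hτ : τ ∈ Ioo (-1 : ℝ) 1) (hτ' : τ' ∈ Ioo (-1 : ℝ) 1) : f τ = f τ' :=
  isOpen_Ioo.is_const_of_deriv_eq_zero isPreconnected_Ioo
    (fun x hx => (hf x hx).differentiableAt.differentiableWithinAt)
    (fun x hx => (hf x hx).deriv) hτ hτ'

theorem Ioo_mem_nhdsGT_neg_one : Ioo (-1 : ℝ) 1 ∈ 𝓝[>] (-1 : ℝ) := Ioo_mem_nhdsGT (by norm_num)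

/-- A function with bounded derivative near `τ = -1` is bounded there. -/
theorem isBigO_one_of_deriv {f f' : ℝ → ℂ} (hf : ∀ τ ∈ Ioo (-1 : ℝ) 1, HasDerivAt f (f' τ) τ)
    (h : f' =O[𝓝[>] (-1)] (fun _ => (1 : ℝ))) : f =O[𝓝[>] (-1)] (fun _ => (1 : ℝ)) := by
  obtain ⟨C, hC⟩ := h.bound
  obtain ⟨u, hu, hsub⟩ := mem_nhdsGT_iff_exists_Ioo_subset.1
    (inter_mem hC Ioo_mem_nhdsGT_neg_one)
  simp only [norm_one, mul_one] at hsub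
  obtain ⟨x₀, hx₀⟩ := nonempty_Ioo.2 (show (-1 : ℝ) < u from hu)
  refine Asymptotics.IsBigO.of_bound (‖f x₀‖ + C * (u + 1)) ?_
  filter_upwards [Ioo_mem_nhdsGT (show (-1 : ℝ) < u from hu)] with x hx
  have hmv := (convex_Ioo (-1) u).norm_image_sub_le_of_norm_hasDerivWithin_le (f := f) (f' := f')
    (C := C) (fun y hy => (hf y (hsub hy).2).hasDerivWithinAt) (fun y hy => (hsub hy).1) hx₀ hx
  have hC0 : 0 ≤ C := (norm_nonneg _).trans (hsub hx).1
  have hxx : ‖x - x₀‖ ≤ u + 1 := by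
    rw [Real.norm_eq_abs, abs_le]
    constructor <;> linarith [hx.1, hx.2, hx₀.1, hx₀.2]
  rw [norm_one, mul_one]
  calc ‖f x‖ = ‖f x₀ + (f x - f x₀)‖ := by rw [add_sub_cancel]
    _ ≤ ‖f x₀‖ + ‖f x - f x₀‖ := norm_add_le _ _
    _ ≤ _ := by gcongr; exact hmv.trans (by gcongr)

theorem isBigO_one_of_iteratedDeriv {f : ℝ → ℂ} (hf : ContDiffOn ℝ ∞ f (Ioo (-1) 1)) (i : ℕ)
    (h : iteratedDeriv i f =O[𝓝[>] (-1)] (fun _ => (1 : ℝ))) :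
    f =O[𝓝[>] (-1)] (fun _ => (1 : ℝ)) := by
  induction i with
  | zero => simpa using h
  | succ i ih => exact ih (isBigO_one_of_deriv (fun τ hτ => hasDerivAt_iteratedDeriv hf i hτ) h)

theorem tendsto_one_add_pow (k : ℕ) (hk : k ≠ 0) :
    Tendsto (fun τ : ℝ => (1 + τ : ℂ) ^ k) (𝓝[>] (-1)) (𝓝 0) := by
  have : Continuous fun τ : ℝ => (1 + τ : ℂ) ^ k := by fun_prop
  have h := this.tendsto (-1)
  simp only [Complex.ofReal_neg, Complex.ofReal_one, add_neg_cancel, ne_eq, hk,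
    not_false_eq_true, zero_pow] at h
  exact h.mono_left nhdsWithin_le_nhds

theorem tendsto_one_add_pow_mul {f : ℝ → ℂ} (h : f =O[𝓝[>] (-1)] (fun _ => (1 : ℝ))) (k : ℕ)
    (hk : k ≠ 0) : Tendsto (fun τ : ℝ => (1 + τ : ℂ) ^ k * f τ) (𝓝[>] (-1)) (𝓝 0) := by
  have := ((Asymptotics.isLittleO_one_iff ℝ).2 (tendsto_one_add_pow k hk)).mul_isBigO h
  simp only [mul_one] at this
  exact (Asymptotics.isLittleO_one_iff ℝ).1 this

theorem one_add_ne_zero {τ : ℝ} (hτ : τ ∈ Ioo (-1 : ℝ) 1) : (1 + τ : ℂ) ≠ 0 := by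
  have : (1 + τ : ℝ) ≠ 0 := by linarith [hτ.1]
  exact_mod_cast this

theorem one_sub_ne_zero {τ : ℝ} (hτ : τ ∈ Ioo (-1 : ℝ) 1) : (1 - τ : ℂ) ≠ 0 := by
  have : (1 - τ : ℝ) ≠ 0 := by linarith [hτ.2]
  exact_mod_cast this

theorem hasDerivAt_one_add_pow (k : ℕ) (τ : ℝ) :
    HasDerivAt (fun t : ℝ => (1 + t : ℂ) ^ k) (k * (1 + τ : ℂ) ^ (k - 1)) τ := by
  simpa using! ((Complex.ofRealCLM.hasDerivAt (x := τ)).const_add 1).pow k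

theorem hasDerivAt_one_sub_pow (k : ℕ) (τ : ℝ) :
    HasDerivAt (fun t : ℝ => (1 - t : ℂ) ^ k) (-(k * (1 - τ : ℂ) ^ (k - 1))) τ := by
  simpa using! ((Complex.ofRealCLM.hasDerivAt (x := τ)).const_sub 1).pow k

theorem hasDerivAt_one_add_pow_inv (k : ℕ) {τ : ℝ} (hτ : τ ∈ Ioo (-1 : ℝ) 1) :
    HasDerivAt (fun t : ℝ => ((1 + t : ℂ) ^ k)⁻¹) (-k * ((1 + τ : ℂ) ^ (k + 1))⁻¹) τ := by
  have hs := one_add_ne_zero hτ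
  refine ((hasDerivAt_one_add_pow k τ).inv (pow_ne_zero _ hs)).congr_deriv ?_
  rcases k with _ | k
  · simp
  · simp only [Nat.add_sub_cancel]
    field_simp
    ring

theorem hasDerivAt_one_sub_pow_inv (k : ℕ) {τ : ℝ} (hτ : τ ∈ Ioo (-1 : ℝ) 1) :
    HasDerivAt (fun t : ℝ => ((1 - t : ℂ) ^ k)⁻¹) (k * ((1 - τ : ℂ) ^ (k + 1))⁻¹) τ := by
  have hs := one_sub_ne_zero hτ
  refine ((hasDerivAt_one_sub_pow k τ).inv (pow_ne_zero _ hs)).congr_deriv ?_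
  rcases k with _ | k
  · simp
  · simp only [Nat.add_sub_cancel]
    field_simp
    ring

theorem iteratedDeriv_const_mul_one_sub_pow (c : ℂ) (k i : ℕ) :
    iteratedDeriv i (fun t : ℝ => c * (1 - t : ℂ) ^ k) =
      fun t : ℝ => (c * (-1) ^ i * k.descFactorial i) * (1 - t : ℂ) ^ (k - i) := by
  induction i with
  | zero => simp
  | succ i ih =>
    rw [iteratedDeriv_succ, ih]
    funext t
    rw [((hasDerivAt_one_sub_pow (k - i) t).const_mul _).deriv, Nat.descFactorial_succ,
      Nat.sub_sub]
    push_cast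
    ring

/-- The function `(1 + τ) ^ (-(p + 1)) B`.  For `B` the mode of `φ₂` of order `p` at `ρ = 0`, its
derivative of order `p - 1` is, up to a constant, the limit of the Newman-Penrose integrals. -/
def npPotential (p : ℕ) (B : ℝ → ℂ) (τ : ℝ) : ℂ := ((1 + τ : ℂ) ^ (p + 1))⁻¹ * B τ

theorem contDiffOn_one_add_pow_inv (k : ℕ) :
    ContDiffOn ℝ ∞ (fun t : ℝ => ((1 + t : ℂ) ^ k)⁻¹) (Ioo (-1) 1) := by
  refine ContDiffOn.inv ?_ fun t ht => pow_ne_zero _ (one_add_ne_zero ht)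
  exact ((contDiff_const.add Complex.ofRealCLM.contDiff).pow k).contDiffOn

theorem contDiffOn_npPotential (p : ℕ) {B : ℝ → ℂ} (hB : ContDiffOn ℝ ∞ B (Ioo (-1) 1)) :
    ContDiffOn ℝ ∞ (npPotential p B) (Ioo (-1) 1) :=
  (contDiffOn_one_add_pow_inv _).mul hB

variable {L : ℂ} {p : ℕ} {B : Fin 3 → ℝ → ℂ}

theorem TransportSystem.hasDerivAt (h : TransportSystem L p B) (k : Fin 3) {τ : ℝ}
    (hτ : τ ∈ Ioo (-1 : ℝ) 1) : HasDerivAt (B k) (deriv (B k) τ) τ :=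
  hasDerivAt_of_contDiffOn_Ioo (h.smooth k) hτ

theorem TransportSystem.eq_B2 (h : TransportSystem L p B) {τ : ℝ} (hτ : τ ∈ Ioo (-1 : ℝ) 1) :
    B 2 τ = p * B 1 τ - (1 + τ) * deriv (B 1) τ := by
  linear_combination (-1 : ℂ) * h.constraint τ hτ + h.evolution1 τ hτ

/-- For a mode of degree `p` the solutions form a plane, and one of them is logarithmic at
`τ = -1`.  The vanishing of the first integral `p (1 + τ) B₁ - (1 - τ) B₂` singles out the regular
ones, for which `npPotential` is a multiple of `(1 - τ) ^ (p - 1)`. -/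
theorem TransportSystem.limit_eq_of_degree_eq {n : ℕ}
    (h : TransportSystem ((n + 2) * (n + 3)) (n + 2) B) {F : ℂ}
    (hF : Tendsto (iteratedDeriv (n + 1) (npPotential (n + 2) (B 2))) (𝓝[>] (-1)) (𝓝 F)) :
    F = (-1) ^ (n + 1) * (n + 1).factorial * B 2 0 := by
  set H := npPotential (n + 2) (B 2) with hHdef
  have hHs : ContDiffOn ℝ ∞ H (Ioo (-1) 1) := contDiffOn_npPotential _ (h.smooth 2)
  have hHO : H =O[𝓝[>] (-1)] (fun _ => (1 : ℝ)) :=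
    isBigO_one_of_iteratedDeriv hHs _ (hF.isBigO_one ℝ)
  have hHB : ∀ τ ∈ Ioo (-1 : ℝ) 1, B 2 τ = (1 + τ : ℂ) ^ (n + 3) * H τ := by
    intro τ hτ
    have := one_add_ne_zero hτ
    simp only [hHdef, npPotential]
    field_simp
  set v : ℝ → ℂ := fun τ => ((1 + τ : ℂ) ^ (n + 2))⁻¹ * B 1 τ with hvdef
  have hv : ∀ τ ∈ Ioo (-1 : ℝ) 1, HasDerivAt v (-H τ) τ := by
    intro τ hτ
    have hs := one_add_ne_zero hτ
    refine ((hasDerivAt_one_add_pow_inv (n + 2) hτ).mul (h.hasDerivAt 1 hτ)).congr_deriv ?_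
    have e := h.eq_B2 hτ
    simp only [hHdef, npPotential, e]
    push_cast
    field_simp
    ring
  have hvB : ∀ τ ∈ Ioo (-1 : ℝ) 1, B 1 τ = (1 + τ : ℂ) ^ (n + 2) * v τ := by
    intro τ hτ
    have := one_add_ne_zero hτ
    simp only [hvdef]
    field_simp
  have hvO : v =O[𝓝[>] (-1)] (fun _ => (1 : ℝ)) := isBigO_one_of_deriv hv hHO.neg_left
  -- the first integral
  set w : ℝ → ℂ := fun τ => (n + 2) * ((1 + τ) * B 1 τ) - (1 - τ) * B 2 τ with hw
  have hwd : ∀ τ ∈ Ioo (-1 : ℝ) 1, HasDerivAt w 0 τ := by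
    intro τ hτ
    have h1 : HasDerivAt (fun t : ℝ => (t : ℂ)) 1 τ := by
      simpa using! Complex.ofRealCLM.hasDerivAt (x := τ)
    refine ((((h1.const_add 1).mul (h.hasDerivAt 1 hτ)).const_mul (n + 2 : ℂ)).sub
      ((h1.const_sub 1).mul (h.hasDerivAt 2 hτ))).congr_deriv ?_
    have e2 := h.evolution2 τ hτ
    have e := h.eq_B2 hτ
    push_cast at e2 e
    linear_combination (-1 : ℂ) * e2 + (n + 2 : ℂ) * e
  have hwlim : Tendsto w (𝓝[>] (-1)) (𝓝 0) := by
    have t1 := (tendsto_one_add_pow_mul hvO (n + 3) (by omega)).const_mul (n + 2 : ℂ)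
    have t2 := tendsto_one_add_pow_mul hHO (n + 3) (by omega)
    have t3 : Tendsto (fun τ : ℝ => (1 - τ : ℂ)) (𝓝[>] (-1)) (𝓝 (1 - ((-1 : ℝ) : ℂ))) :=
      ((continuous_const.sub Complex.continuous_ofReal).tendsto (-1)).mono_left nhdsWithin_le_nhds
    have := t1.sub (t3.mul t2)
    simp only [mul_zero, sub_zero] at this
    refine this.congr' ?_
    filter_upwards [Ioo_mem_nhdsGT_neg_one] with τ hτ
    simp only [hw]
    rw [hHB τ hτ, hvB τ hτ]
    ring
  have hw0 : ∀ τ ∈ Ioo (-1 : ℝ) 1, w τ = 0 := by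
    intro τ hτ
    refine tendsto_nhds_unique (tendsto_const_nhds.congr' ?_) hwlim
    filter_upwards [Ioo_mem_nhdsGT_neg_one] with t ht using eq_of_hasDerivAt_zero hwd hτ ht
  have hvH : ∀ τ ∈ Ioo (-1 : ℝ) 1, (n + 2) * v τ = (1 - τ) * H τ := by
    intro τ hτ
    have hs := one_add_ne_zero hτ
    have := hw0 τ hτ
    simp only [hw] at this
    rw [hHB τ hτ, hvB τ hτ] at this
    refine mul_left_cancel₀ (pow_ne_zero (n + 3) hs) ?_
    linear_combination this
  have hH' : ∀ τ ∈ Ioo (-1 : ℝ) 1, (1 - τ) * deriv H τ = -(n + 1) * H τ := by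
    intro τ hτ
    have h1 : HasDerivAt (fun t : ℝ => (t : ℂ)) 1 τ := by
      simpa using! Complex.ofRealCLM.hasDerivAt (x := τ)
    have e1 := (hv τ hτ).const_mul (n + 2 : ℂ)
    have e2 := (h1.const_sub 1).mul (hasDerivAt_of_contDiffOn_Ioo hHs hτ)
    have := e1.unique (e2.congr_of_eventuallyEq (by
      filter_upwards [isOpen_Ioo.mem_nhds hτ] with t ht using hvH t ht))
    linear_combination -this
  have hHeq : ∀ τ ∈ Ioo (-1 : ℝ) 1, H τ = B 2 0 * (1 - τ : ℂ) ^ (n + 1) := by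
    intro τ hτ
    have hz : ∀ t ∈ Ioo (-1 : ℝ) 1,
        HasDerivAt (fun t : ℝ => ((1 - t : ℂ) ^ (n + 1))⁻¹ * H t) 0 t := by
      intro t ht
      have hs := one_sub_ne_zero ht
      refine ((hasDerivAt_one_sub_pow_inv (n + 1) ht).mul
        (hasDerivAt_of_contDiffOn_Ioo hHs ht)).congr_deriv ?_
      have e : deriv H t = (1 - t : ℂ)⁻¹ * (-(n + 1) * H t) :=
        (eq_inv_mul_iff_mul_eq₀ hs).2 (hH' t ht)
      rw [pow_succ _ (n + 1), mul_inv, e]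
      push_cast
      ring
    have h0 : (0 : ℝ) ∈ Ioo (-1 : ℝ) 1 := by constructor <;> norm_num
    have := eq_of_hasDerivAt_zero hz hτ h0
    have hH0 : H 0 = B 2 0 := by simp [hHdef, npPotential]
    simp only [hH0, Complex.ofReal_zero, sub_zero, one_pow, inv_one, one_mul] at this
    rw [← this]
    have hs := one_sub_ne_zero hτ
    field_simp
  refine tendsto_nhds_unique hF (tendsto_const_nhds.congr' ?_)
  filter_upwards [Ioo_mem_nhdsGT_neg_one] with τ hτ
  have hev : H =ᶠ[𝓝 τ] fun t : ℝ => B 2 0 * (1 - t : ℂ) ^ (n + 1) := by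
    filter_upwards [isOpen_Ioo.mem_nhds hτ] with t ht using hHeq t ht
  rw [hev.iteratedDeriv_eq, iteratedDeriv_const_mul_one_sub_pow, Nat.descFactorial_self]
  simp
  ring

/-- For a mode of degree `p - 1` the derivative `G` of order `p - 1` of `npPotential` solves
`(1 + τ) G' + 2 p G = 0`, so it is a multiple of `(1 + τ) ^ (-2 p)` and can only converge to `0`. -/
theorem TransportSystem.limit_eq_zero_of_degree_eq_pred {n : ℕ}
    (h : TransportSystem ((n + 1) * (n + 2)) (n + 2) B) {F : ℂ}
    (hF : Tendsto (iteratedDeriv (n + 1) (npPotential (n + 2) (B 2))) (𝓝[>] (-1)) (𝓝 F)) :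
    F = 0 := by
  set H := npPotential (n + 2) (B 2) with hHdef
  have hHs : ContDiffOn ℝ ∞ H (Ioo (-1) 1) := contDiffOn_npPotential _ (h.smooth 2)
  -- the derivative of `B 1` solves a closed equation of first order
  set u : ℝ → ℂ := fun τ => B 0 τ - B 2 τ with hu
  obtain ⟨C, hC⟩ : ∃ C : ℂ, ∀ τ ∈ Ioo (-1 : ℝ) 1,
      u τ = C * ((1 - τ) ^ (n + 1) * (1 + τ) ^ (n + 1)) := by
    have hz : ∀ t ∈ Ioo (-1 : ℝ) 1, HasDerivAt
        (fun t : ℝ => ((1 - t : ℂ) ^ (n + 1))⁻¹ * ((1 + t : ℂ) ^ (n + 1))⁻¹ * u t) 0 t := by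
      intro t ht
      have hs := one_sub_ne_zero ht
      have hs' := one_add_ne_zero ht
      have hud : HasDerivAt u (deriv (B 0) t - deriv (B 2) t) t :=
        (h.hasDerivAt 0 ht).sub (h.hasDerivAt 2 ht)
      refine (((hasDerivAt_one_sub_pow_inv (n + 1) ht).mul (hasDerivAt_one_add_pow_inv (n + 1)
        ht)).mul hud).congr_deriv ?_
      have e0 := h.evolution0 t ht
      have e2 := h.evolution2 t ht
      have e1 := h.evolution1 t ht
      have e3 := h.constraint t ht
      rw [e1] at e3
      have e : deriv (B 0) t - deriv (B 2) t =
          ((1 - t : ℂ) * (1 + t))⁻¹ * (-(2 * (n + 1)) * t * u t) := by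
        rw [eq_inv_mul_iff_mul_eq₀ (mul_ne_zero hs hs')]
        push_cast at e0 e2 e3
        linear_combination (1 - t : ℂ) * e0 - (1 + t) * e2 - 2 * (n + 1 : ℂ) * e3
      simp only [Pi.mul_apply]
      rw [e, pow_succ (1 - t : ℂ) (n + 1), pow_succ (1 + t : ℂ) (n + 1), mul_inv, mul_inv]
      generalize ((1 - t : ℂ) ^ (n + 1))⁻¹ = y
      generalize ((1 + t : ℂ) ^ (n + 1))⁻¹ = z
      push_cast
      field_simp
      ring
    have h0 : (0 : ℝ) ∈ Ioo (-1 : ℝ) 1 := by constructor <;> norm_num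
    refine ⟨u 0, fun τ hτ => ?_⟩
    have := eq_of_hasDerivAt_zero hz hτ h0
    simp only [Complex.ofReal_zero, sub_zero, add_zero, one_pow, inv_one, one_mul] at this
    have hs := one_sub_ne_zero hτ
    have hs' := one_add_ne_zero hτ
    rw [← this]
    field_simp
  have hJ : ∀ τ ∈ Ioo (-1 : ℝ) 1, (1 + τ) * deriv H τ + (n + 3) * H τ =
      (1 / 2) * (n + 1) * C * (1 - τ) ^ n := by
    intro τ hτ
    have hs := one_sub_ne_zero hτ
    have hs' := one_add_ne_zero hτ
    have e : deriv H τ = _ := ((hasDerivAt_one_add_pow_inv (n + 3) hτ).mul (h.hasDerivAt 2 hτ)).deriv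
    have e2 := h.evolution2 τ hτ
    have e1 := h.evolution1 τ hτ
    have e3 := h.eq_B2 hτ
    have e4 := hC τ hτ
    simp only [hu] at e4
    rw [e1, e4] at e3
    rw [e]
    simp only [hHdef, npPotential]
    push_cast at e2 e3 ⊢
    refine mul_left_cancel₀ hs ?_
    have i1 : (1 + τ : ℂ) * (1 + τ : ℂ)⁻¹ = 1 := mul_inv_cancel₀ hs'
    have i2 : ((1 + τ : ℂ) ^ (n + 3))⁻¹ * (1 + τ : ℂ) ^ (n + 3) = 1 :=
      inv_mul_cancel₀ (pow_ne_zero _ hs')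
    rw [pow_succ (1 + τ : ℂ) (n + 3), mul_inv]
    set y := ((1 + τ : ℂ) ^ (n + 3))⁻¹
    linear_combination (1 + τ : ℂ) * y * e2 - (1 + τ) * y * (n + 1) * e3
      - (1 - τ) * (n + 3) * y * B 2 τ * i1
      + (1 / 2) * (n + 1) * C * (1 - τ : ℂ) ^ (n + 1) * i2
  have hrec : ∀ i : ℕ, ∀ τ ∈ Ioo (-1 : ℝ) 1,
      (1 + τ) * iteratedDeriv (i + 1) H τ + (n + 3 + i) * iteratedDeriv i H τ =
      iteratedDeriv i (fun t : ℝ => (1 / 2) * (n + 1) * C * (1 - t : ℂ) ^ n) τ := by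
    intro i
    induction i with
    | zero =>
      intro τ hτ
      simpa using hJ τ hτ
    | succ i ih =>
      intro τ hτ
      have h1 : HasDerivAt (fun t : ℝ => (t : ℂ)) 1 τ := by
        simpa using! Complex.ofRealCLM.hasDerivAt (x := τ)
      have d := ((h1.const_add 1).mul (hasDerivAt_iteratedDeriv hHs (i + 1) hτ)).add
        ((hasDerivAt_iteratedDeriv hHs i hτ).const_mul (n + 3 + i : ℂ))
      have d' := d.congr_of_eventuallyEq (f₁ := iteratedDeriv i
        (fun t : ℝ => (1 / 2) * (n + 1) * C * (1 - t : ℂ) ^ n)) (by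
        filter_upwards [isOpen_Ioo.mem_nhds hτ] with t ht using (ih t ht).symm)
      rw [iteratedDeriv_succ (f := fun t : ℝ => (1 / 2) * (n + 1) * C * (1 - t : ℂ) ^ n), d'.deriv]
      push_cast
      ring
  set G := iteratedDeriv (n + 1) H with hG
  have hGd : ∀ τ ∈ Ioo (-1 : ℝ) 1,
      HasDerivAt (fun t : ℝ => (1 + t : ℂ) ^ (2 * n + 4) * G t) 0 τ := by
    intro τ hτ
    refine ((hasDerivAt_one_add_pow (2 * n + 4) τ).mul
      (hasDerivAt_iteratedDeriv hHs (n + 1) hτ)).congr_deriv ?_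
    have := hrec (n + 1) τ hτ
    rw [iteratedDeriv_const_mul_one_sub_pow, Nat.descFactorial_eq_zero_iff_lt.2 (by omega)] at this
    rw [show 2 * n + 4 - 1 = 2 * n + 3 by omega, pow_succ _ (2 * n + 3)]
    push_cast at this ⊢
    linear_combination (1 + τ : ℂ) ^ (2 * n + 3) * this
  have hlim : Tendsto (fun t : ℝ => (1 + t : ℂ) ^ (2 * n + 4) * G t) (𝓝[>] (-1)) (𝓝 0) :=
    tendsto_one_add_pow_mul (hF.isBigO_one ℝ) _ (by omega)
  refine tendsto_nhds_unique hF (tendsto_const_nhds.congr' ?_)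
  filter_upwards [Ioo_mem_nhdsGT_neg_one] with τ hτ
  have : (1 + τ : ℂ) ^ (2 * n + 4) * G τ = 0 := by
    refine tendsto_nhds_unique (tendsto_const_nhds.congr' ?_) hlim
    filter_upwards [Ioo_mem_nhdsGT_neg_one] with t ht using eq_of_hasDerivAt_zero hGd hτ ht
  exact ((mul_eq_zero.1 this).resolve_left (pow_ne_zero _ (one_add_ne_zero hτ))).symm

end

section

/-! ### Associated Legendre functions -/

open Polynomial in
theorem iterate_derivative_X_sq_sub_one_pow (j i : ℕ) :
    (X ^ 2 - 1 : ℝ[X]) * derivative (derivative (derivative^[i] ((X ^ 2 - 1 : ℝ[X]) ^ j)))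
      + 2 * ((i : ℝ[X]) + 1 - (j : ℝ[X])) * X * derivative (derivative^[i] ((X ^ 2 - 1 : ℝ[X]) ^ j))
      + ((i : ℝ[X]) + 1) * ((i : ℝ[X]) - 2 * (j : ℝ[X])) * derivative^[i] ((X ^ 2 - 1 : ℝ[X]) ^ j) = 0 := by
  induction i with
  | zero =>
    have h : (X ^ 2 - 1 : ℝ[X]) * derivative ((X ^ 2 - 1 : ℝ[X]) ^ j)
        = 2 * (j : ℝ[X]) * X * (X ^ 2 - 1 : ℝ[X]) ^ j := by
      rcases j with _ | j
      · simp
      · rw [derivative_pow]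
        simp
        ring
    have h' := congrArg derivative h
    simp only [derivative_mul, derivative_sub, derivative_X_pow, derivative_one, derivative_X,
      derivative_ofNat, derivative_natCast] at h'
    simp only [Function.iterate_zero, id_eq]
    push_cast at h' ⊢
    simp only [map_ofNat] at h'
    linear_combination h'
  | succ i ih =>
    have h' := congrArg derivative ih
    rw [Function.iterate_succ_apply']
    simp only [derivative_add, derivative_mul, derivative_sub, derivative_X_pow, derivative_one,
      derivative_X, derivative_ofNat, derivative_natCast, derivative_zero] at h'
    push_cast at h' ⊢
    simp only [map_ofNat] at h'
    linear_combination h'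

/-- The polynomial factor of the associated Legendre function, without its normalisation. -/
def legendrePoly (j k : ℕ) : Polynomial ℝ :=
  Polynomial.derivative^[j + k] ((Polynomial.X ^ 2 - 1 : Polynomial ℝ) ^ j)

theorem legendrePoly_ode (j k : ℕ) (x : ℝ) :
    (1 - x ^ 2) * (legendrePoly j k).derivative.derivative.eval x =
      2 * (k + 1) * x * (legendrePoly j k).derivative.eval x
      + (k * (k + 1) - j * (j + 1)) * (legendrePoly j k).eval x := by
  have h := congrArg (Polynomial.eval x) (iterate_derivative_X_sq_sub_one_pow j (j + k))
  rw [← legendrePoly] at h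
  simp only [Polynomial.eval_add, Polynomial.eval_mul, Polynomial.eval_sub, Polynomial.eval_pow,
    Polynomial.eval_X, Polynomial.eval_one, Polynomial.eval_natCast, Polynomial.eval_ofNat,
    Polynomial.eval_zero] at h
  push_cast at h
  linear_combination -h

theorem legendreFactor_eq (j k : ℕ) : legendreFactor j k = fun θ =>
    Real.sin θ ^ k * (legendrePoly j k).eval (Real.cos θ) / (2 ^ j * (j.factorial : ℝ)) := rfl

theorem contDiff_legendreFactor (j k : ℕ) : ContDiff ℝ ∞ (legendreFactor j k) := by
  rw [legendreFactor_eq]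
  have hP : ContDiff ℝ ∞ fun x : ℝ => (legendrePoly j k).eval x := by
    simpa using Polynomial.contDiff_aeval (𝕜 := ℝ) (legendrePoly j k) ∞
  exact ((Real.contDiff_sin.pow k).mul (hP.comp Real.contDiff_cos)).div_const _

theorem hasDerivAt_legendreFactor (j k : ℕ) (θ : ℝ) :
    HasDerivAt (legendreFactor j k) (deriv (legendreFactor j k) θ) θ :=
  ((contDiff_legendreFactor j k).differentiable (by simp)).differentiableAt.hasDerivAt

theorem contDiff_deriv_legendreFactor (j k : ℕ) :
    ContDiff ℝ ∞ (deriv (legendreFactor j k)) :=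
  ((contDiff_infty_iff_deriv (𝕜 := ℝ)).1 (contDiff_legendreFactor j k)).2

theorem hasDerivAt_poly_cos (P : Polynomial ℝ) (θ : ℝ) :
    HasDerivAt (fun t => P.eval (Real.cos t)) (-(P.derivative.eval (Real.cos θ) * Real.sin θ)) θ :=
  ((P.hasDerivAt (Real.cos θ)).comp θ (Real.hasDerivAt_cos θ)).congr_deriv (by ring)

theorem hasDerivAt_sin_pow (k : ℕ) (θ : ℝ) :
    HasDerivAt (fun t => Real.sin t ^ k) (k * Real.sin θ ^ (k - 1) * Real.cos θ) θ :=
  (Real.hasDerivAt_sin θ).pow k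

theorem sin_mul_deriv_legendreFactor (j k : ℕ) (θ : ℝ) :
    Real.sin θ * deriv (legendreFactor j k) θ =
      (k * (Real.cos θ * (Real.sin θ ^ k * (legendrePoly j k).eval (Real.cos θ)))
        - Real.sin θ ^ (k + 2) * (legendrePoly j k).derivative.eval (Real.cos θ))
        / (2 ^ j * (j.factorial : ℝ)) := by
  have h := (((hasDerivAt_sin_pow k θ).mul (hasDerivAt_poly_cos (legendrePoly j k) θ)).div_const
    (2 ^ j * (j.factorial : ℝ))).deriv
  have h' : deriv (legendreFactor j k) θ = _ := h
  rw [h', ← mul_div_assoc]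
  congr 1
  rcases k with _ | k
  · simp
    ring
  · simp only [Nat.add_sub_cancel]
    ring

/-- The associated Legendre equation. -/
theorem hasDerivAt_sin_mul_deriv_legendreFactor (j k : ℕ) {θ : ℝ} (hθ : Real.sin θ ≠ 0) :
    HasDerivAt (fun t => Real.sin t * deriv (legendreFactor j k) t)
      ((k ^ 2 / Real.sin θ - j * (j + 1) * Real.sin θ) * legendreFactor j k θ) θ := by
  rw [show (fun t => Real.sin t * deriv (legendreFactor j k) t) = _ from
    funext (sin_mul_deriv_legendreFactor j k)]
  have h0 := hasDerivAt_poly_cos (legendrePoly j k) θ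
  have h1 := hasDerivAt_poly_cos (legendrePoly j k).derivative θ
  refine (((((Real.hasDerivAt_cos θ).mul ((hasDerivAt_sin_pow k θ).mul h0)).const_mul
    (k : ℝ)).sub ((hasDerivAt_sin_pow (k + 2) θ).mul h1)).div_const
    (2 ^ j * (j.factorial : ℝ))).congr_deriv ?_
  rw [legendreFactor_eq, ← mul_div_assoc]
  congr 1
  have e := legendrePoly_ode j k (Real.cos θ)
  have hsc := Real.sin_sq_add_cos_sq θ
  rw [show 1 - Real.cos θ ^ 2 = Real.sin θ ^ 2 by linarith] at e
  have hk : (k : ℝ) * Real.sin θ ^ (k - 1) * Real.sin θ = k * Real.sin θ ^ k := by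
    rcases k with _ | k
    · simp
    · simp only [Nat.add_sub_cancel]
      ring
  refine mul_right_cancel₀ hθ ?_
  simp only [Pi.mul_apply]
  rw [show k + 2 - 1 = k + 1 by omega]
  have hdiv : (k : ℝ) ^ 2 / Real.sin θ * Real.sin θ = k ^ 2 := div_mul_cancel₀ _ hθ
  push_cast
  generalize (legendrePoly j k).derivative.derivative.eval (Real.cos θ) = y2 at *
  generalize (legendrePoly j k).derivative.eval (Real.cos θ) = y1 at *
  generalize (legendrePoly j k).eval (Real.cos θ) = y at *
  generalize Real.cos θ = c at *
  generalize Real.sin θ = s at *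
  generalize s ^ (k - 1) = z at *
  linear_combination (s ^ (k + 2)) * e + (k * c ^ 2 * y) * hk - s ^ k * y * hdiv
    + k ^ 2 * s ^ k * y * hsc

theorem legendreFactor_eq_zero {j k : ℕ} (hk : k ≠ 0) {θ : ℝ} (hθ : Real.sin θ = 0) :
    legendreFactor j k θ = 0 := by
  simp [legendreFactor_eq, hθ, hk]

/-! ### Integration over the polar angle -/

theorem integral_congr_Ioo {a b : ℝ} (hab : a ≤ b) {f g : ℝ → ℂ} (h : ∀ x ∈ Ioo a b, f x = g x) :
    ∫ x in a..b, f x = ∫ x in a..b, g x := by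
  rw [intervalIntegral.integral_of_le hab, intervalIntegral.integral_of_le hab,
    MeasureTheory.integral_Ioc_eq_integral_Ioo, MeasureTheory.integral_Ioc_eq_integral_Ioo]
  exact MeasureTheory.setIntegral_congr_fun measurableSet_Ioo h

theorem intervalIntegrable_congr_Ioo {a b : ℝ} (hab : a ≤ b) {f g : ℝ → ℂ}
    (h : ∀ x ∈ Ioo a b, f x = g x) (hg : IntervalIntegrable g MeasureTheory.volume a b) :
    IntervalIntegrable f MeasureTheory.volume a b := by
  rw [intervalIntegrable_iff_integrableOn_Ioo_of_le hab] at hg ⊢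
  exact hg.congr_fun (fun x hx => (h x hx).symm) measurableSet_Ioo

/-- `sin θ` times the spin-raised or spin-lowered Legendre function, `sin θ f' + μ f`. -/
def spinFactor (j k : ℕ) (μ : ℤ) (θ : ℝ) : ℂ :=
  ((Real.sin θ * deriv (legendreFactor j k) θ + μ * legendreFactor j k θ : ℝ) : ℂ)

theorem contDiff_ofReal_comp {f : ℝ → ℝ} (hf : ContDiff ℝ ∞ f) :
    ContDiff ℝ ∞ (fun t => (f t : ℂ)) := Complex.ofRealCLM.contDiff.comp hf

theorem contDiff_spinFactor (j k : ℕ) (μ : ℤ) : ContDiff ℝ ∞ (spinFactor j k μ) :=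
  contDiff_ofReal_comp ((Real.contDiff_sin.mul (contDiff_deriv_legendreFactor j k)).add
    (contDiff_const.mul (contDiff_legendreFactor j k)))

theorem spinFactor_eq_zero {j : ℕ} {μ : ℤ} {θ : ℝ} (hθ : Real.sin θ = 0) :
    spinFactor j μ.natAbs μ θ = 0 := by
  by_cases hμ : μ = 0
  · simp [spinFactor, hθ, hμ]
  · simp [spinFactor, hθ, legendreFactor_eq_zero (Int.natAbs_ne_zero.2 hμ) hθ]

theorem hasDerivAt_spinFactor (j : ℕ) (μ : ℤ) {θ : ℝ} (hθ : Real.sin θ ≠ 0) :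
    HasDerivAt (spinFactor j μ.natAbs μ)
      ((((μ : ℝ) ^ 2 / Real.sin θ - j * (j + 1) * Real.sin θ) * legendreFactor j μ.natAbs θ
        + μ * deriv (legendreFactor j μ.natAbs) θ : ℝ) : ℂ) θ := by
  have h := (hasDerivAt_sin_mul_deriv_legendreFactor j μ.natAbs hθ).add
    ((hasDerivAt_legendreFactor j μ.natAbs θ).const_mul (μ : ℝ))
  have e : ((μ.natAbs : ℝ)) ^ 2 = (μ : ℝ) ^ 2 := by
    rw [Nat.cast_natAbs, Int.cast_abs, sq_abs]
  rw [e] at h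
  exact h.ofReal_comp

theorem integral_deriv_eq_zero {G : ℝ → ℂ} (hG : ContDiff ℝ ∞ G) (h0 : G 0 = 0)
    (hπ : G Real.pi = 0) : ∫ θ in (0 : ℝ)..Real.pi, deriv G θ = 0 := by
  rw [intervalIntegral.integral_deriv_eq_sub (fun x _ => (hG.differentiable (by simp)) x)
    ((hG.continuous_deriv (by simp)).intervalIntegrable _ _), h0, hπ, sub_zero]

theorem sin_ne_zero_of_mem {θ : ℝ} (hθ : θ ∈ Ioo 0 Real.pi) : Real.sin θ ≠ 0 :=
  (Real.sin_pos_of_pos_of_lt_pi hθ.1 hθ.2).ne'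

theorem complex_sin_ne_zero {θ : ℝ} (hθ : θ ∈ Ioo 0 Real.pi) : Complex.sin θ ≠ 0 := by
  rw [← Complex.ofReal_sin]
  exact_mod_cast sin_ne_zero_of_mem hθ

theorem spinFactor_mul_eq (j : ℕ) (μ : ℤ) {h : ℝ → ℂ} (hh : ContDiff ℝ ∞ h) {θ : ℝ}
    (hθ : θ ∈ Ioo 0 Real.pi) :
    spinFactor j μ.natAbs μ θ * (deriv h θ + μ * h θ / Real.sin θ) =
      deriv (fun t => spinFactor j μ.natAbs μ t * h t) θ
        + (j * (j + 1) : ℂ) * ((Real.sin θ * legendreFactor j μ.natAbs θ : ℝ) * h θ) := by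
  have hs := sin_ne_zero_of_mem hθ
  have hsc := complex_sin_ne_zero hθ
  have e : deriv (fun t => spinFactor j μ.natAbs μ t * h t) θ = _ :=
    ((hasDerivAt_spinFactor j μ hs).mul ((hh.differentiable (by simp)) θ).hasDerivAt).deriv
  rw [e]
  simp only [spinFactor]
  push_cast
  field_simp
  ring

/-- Integration by parts against the spin `±1` Legendre functions. -/
theorem integral_spinFactor_mul (j : ℕ) (μ : ℤ) {h : ℝ → ℂ} (hh : ContDiff ℝ ∞ h) :
    IntervalIntegrable (fun θ => spinFactor j μ.natAbs μ θ * (deriv h θ + μ * h θ / Real.sin θ))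
      MeasureTheory.volume 0 Real.pi ∧
    ∫ θ in (0 : ℝ)..Real.pi,
      spinFactor j μ.natAbs μ θ * (deriv h θ + μ * h θ / Real.sin θ) =
      (j * (j + 1) : ℂ) * ∫ θ in (0 : ℝ)..Real.pi,
        ((Real.sin θ * legendreFactor j μ.natAbs θ : ℝ) : ℂ) * h θ := by
  have hG : ContDiff ℝ ∞ (fun t => spinFactor j μ.natAbs μ t * h t) :=
    (contDiff_spinFactor j _ μ).mul hh
  have hc : Continuous (fun θ => ((Real.sin θ * legendreFactor j μ.natAbs θ : ℝ) : ℂ) * h θ) :=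
    ((contDiff_ofReal_comp (Real.contDiff_sin.mul (contDiff_legendreFactor _ _))).mul hh).continuous
  have i1 := (hG.continuous_deriv (by simp)).intervalIntegrable
    (μ := MeasureTheory.volume) 0 Real.pi
  have i2 := (hc.intervalIntegrable (μ := MeasureTheory.volume) 0 Real.pi).const_mul
    (j * (j + 1) : ℂ)
  refine ⟨intervalIntegrable_congr_Ioo Real.pi_pos.le
    (fun θ hθ => spinFactor_mul_eq j μ hh hθ) (i1.add i2), ?_⟩
  rw [integral_congr_Ioo Real.pi_pos.le fun θ hθ => spinFactor_mul_eq j μ hh hθ,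
    intervalIntegral.integral_add i1 i2, integral_deriv_eq_zero hG
      (by rw [spinFactor_eq_zero Real.sin_zero, zero_mul])
      (by rw [spinFactor_eq_zero Real.sin_pi, zero_mul]), zero_add,
    intervalIntegral.integral_const_mul]

/-- Integration by parts against the spin `0` Legendre functions. -/
theorem integral_sin_legendreFactor_mul (j k : ℕ) (μ : ℤ) {h : ℝ → ℂ} (hh : ContDiff ℝ ∞ h) :
    IntervalIntegrable (fun θ => ((Real.sin θ * legendreFactor j k θ : ℝ) : ℂ) *
        (deriv h θ - μ * h θ / Real.sin θ + varpi θ * h θ)) MeasureTheory.volume 0 Real.pi ∧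
    ∫ θ in (0 : ℝ)..Real.pi, ((Real.sin θ * legendreFactor j k θ : ℝ) : ℂ) *
        (deriv h θ - μ * h θ / Real.sin θ + varpi θ * h θ) =
      -∫ θ in (0 : ℝ)..Real.pi, spinFactor j k μ θ * h θ := by
  have hG : ContDiff ℝ ∞ (fun t => ((Real.sin t * legendreFactor j k t : ℝ) : ℂ) * h t) :=
    (contDiff_ofReal_comp (Real.contDiff_sin.mul (contDiff_legendreFactor _ _))).mul hh
  have i1 := (hG.continuous_deriv (by simp)).intervalIntegrable
    (μ := MeasureTheory.volume) 0 Real.pi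
  have i2 := (((contDiff_spinFactor j k μ).mul hh).continuous).intervalIntegrable
    (μ := MeasureTheory.volume) 0 Real.pi
  have key : ∀ θ ∈ Ioo 0 Real.pi, ((Real.sin θ * legendreFactor j k θ : ℝ) : ℂ) *
        (deriv h θ - μ * h θ / Real.sin θ + varpi θ * h θ) =
      deriv (fun t => ((Real.sin t * legendreFactor j k t : ℝ) : ℂ) * h t) θ
        - spinFactor j k μ θ * h θ := by
    intro θ hθ
    have hs := sin_ne_zero_of_mem hθ
    have hsc := complex_sin_ne_zero hθ
    have e : deriv (fun t => ((Real.sin t * legendreFactor j k t : ℝ) : ℂ) * h t) θ = _ :=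
      (((Real.hasDerivAt_sin θ).mul (hasDerivAt_legendreFactor j k θ)).ofReal_comp.mul
        ((hh.differentiable (by simp)) θ).hasDerivAt).deriv
    rw [e]
    simp only [spinFactor, varpi, Pi.mul_apply]
    push_cast
    field_simp
    ring
  refine ⟨intervalIntegrable_congr_Ioo Real.pi_pos.le key (i1.sub i2), ?_⟩
  rw [integral_congr_Ioo Real.pi_pos.le key, intervalIntegral.integral_sub i1 i2,
    integral_deriv_eq_zero hG (by simp) (by simp), zero_sub]

/-- The polar part of the spin-weighted harmonics, up to normalisation. -/
def spinLegendre (j : ℕ) (m : ℤ) (θ : ℝ) : ℂ :=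
  deriv (fun t => (legendreFactor j m.natAbs t : ℂ)) θ
    + m * (legendreFactor j m.natAbs θ : ℂ) / Real.sin θ

theorem spinFactor_eq_sin_mul (j : ℕ) (m : ℤ) {θ : ℝ} (hθ : θ ∈ Ioo 0 Real.pi) :
    spinFactor j m.natAbs m θ = Real.sin θ * spinLegendre j m θ := by
  have hsc := complex_sin_ne_zero hθ
  have e : deriv (fun t => (legendreFactor j m.natAbs t : ℂ)) θ =
      ((deriv (legendreFactor j m.natAbs) θ : ℝ) : ℂ) :=
    (hasDerivAt_legendreFactor j m.natAbs θ).ofReal_comp.deriv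
  simp only [spinFactor, spinLegendre, e]
  push_cast
  field_simp

theorem intervalIntegrable_spinFactor_mul_spinLegendre (j j' : ℕ) (m : ℤ) :
    IntervalIntegrable (fun θ => spinFactor j m.natAbs m θ * spinLegendre j' m θ)
      MeasureTheory.volume 0 Real.pi :=
  (integral_spinFactor_mul j m (contDiff_ofReal_comp (contDiff_legendreFactor j' m.natAbs))).1

/-- Spin-weighted Legendre functions of the same order and different degrees are orthogonal:
integration by parts turns their product into a product of ordinary Legendre functions with either
of the two eigenvalues as a factor. -/
theorem integral_spinFactor_mul_spinLegendre_eq_zero {j j' : ℕ} (hj : j ≠ j') (m : ℤ) :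
    ∫ θ in (0 : ℝ)..Real.pi, spinFactor j m.natAbs m θ * spinLegendre j' m θ = 0 := by
  have h1 := (integral_spinFactor_mul j m
    (contDiff_ofReal_comp (contDiff_legendreFactor j' m.natAbs))).2
  have h2 := (integral_spinFactor_mul j' m
    (contDiff_ofReal_comp (contDiff_legendreFactor j m.natAbs))).2
  change (∫ θ in (0 : ℝ)..Real.pi, spinFactor j m.natAbs m θ * spinLegendre j' m θ) = _ at h1
  change (∫ θ in (0 : ℝ)..Real.pi, spinFactor j' m.natAbs m θ * spinLegendre j m θ) = _ at h2
  have e : ∫ θ in (0 : ℝ)..Real.pi, spinFactor j' m.natAbs m θ * spinLegendre j m θ =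
      ∫ θ in (0 : ℝ)..Real.pi, spinFactor j m.natAbs m θ * spinLegendre j' m θ := by
    refine integral_congr_Ioo Real.pi_pos.le fun θ hθ => ?_
    rw [spinFactor_eq_sin_mul j m hθ, spinFactor_eq_sin_mul j' m hθ]
    ring
  have e' : ∫ θ in (0 : ℝ)..Real.pi, ((Real.sin θ * legendreFactor j' m.natAbs θ : ℝ) : ℂ) *
        (legendreFactor j m.natAbs θ : ℂ) = ∫ θ in (0 : ℝ)..Real.pi,
        ((Real.sin θ * legendreFactor j m.natAbs θ : ℝ) : ℂ) *
          (legendreFactor j' m.natAbs θ : ℂ) := by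
    congr 1
    funext θ
    push_cast
    ring
  rw [e, e'] at h2
  have hne : (j * (j + 1) : ℂ) - j' * (j' + 1) ≠ 0 := by
    have : (j * (j + 1) : ℂ) - j' * (j' + 1) = ((j : ℂ) - j') * ((j + j' + 1 : ℕ) : ℂ) := by
      push_cast
      ring
    rw [this]
    exact mul_ne_zero (sub_ne_zero.2 (by exact_mod_cast hj)) (Nat.cast_ne_zero.2 (Nat.succ_ne_zero _))
  have h3 := h1.symm.trans h2
  rw [← sub_eq_zero, ← sub_mul] at h3
  rw [h1, (mul_eq_zero.1 h3).resolve_left hne, mul_zero]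

/-! ### The harmonics of spin weight `-1` -/

/-- The real normalisation constant of `sphHarm`, with the Condon-Shortley sign. -/
def harmNorm (j : ℕ) (m : ℤ) : ℝ :=
  (if 0 ≤ m then (-1 : ℝ) ^ m.natAbs else 1) * Real.sqrt ((2 * (j : ℝ) + 1) / (4 * Real.pi) *
    (((j - m.natAbs).factorial : ℝ) / ((j + m.natAbs).factorial : ℝ)))

theorem sphHarm_eq (j : ℕ) (m : ℤ) (θ ϕ : ℝ) :
    sphHarm j m θ ϕ = harmNorm j m * (legendreFactor j m.natAbs θ : ℂ) *
      Complex.exp (Complex.I * (m : ℂ) * (ϕ : ℂ)) := by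
  unfold sphHarm harmNorm
  split_ifs <;> push_cast <;> ring

theorem hasDerivAt_exp_mul (c : ℂ) (ϕ : ℝ) :
    HasDerivAt (fun t : ℝ => Complex.exp (c * (t : ℂ))) (c * Complex.exp (c * ϕ)) ϕ := by
  exact ((Complex.ofRealCLM.hasDerivAt (x := ϕ)).const_mul c).cexp.congr_deriv
    (by simp [mul_comm])

theorem swsh_neg_one_eq (j : ℕ) (hj : j ≠ 0) (m : ℤ) (θ ϕ : ℝ) :
    swsh (-1) j m θ ϕ = ((harmNorm j m / Real.sqrt ((j : ℝ) * ((j : ℝ) + 1)) : ℝ) : ℂ) *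
      spinLegendre j m θ * Complex.exp (Complex.I * (m : ℂ) * (ϕ : ℂ)) := by
  have h1 : ¬ ((j : ℤ) < |(-1 : ℤ)|) := by
    simp only [abs_neg, abs_one, not_lt]
    omega
  have d1 : deriv (fun x => sphHarm j m x ϕ) θ = harmNorm j m *
      deriv (fun t => (legendreFactor j m.natAbs t : ℂ)) θ *
      Complex.exp (Complex.I * (m : ℂ) * (ϕ : ℂ)) := by
    have h := (hasDerivAt_legendreFactor j m.natAbs θ).ofReal_comp
    simp only [sphHarm_eq]
    rw [((h.const_mul (harmNorm j m : ℂ)).mul_const _).deriv, h.deriv]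
  have d2 : deriv (fun y => sphHarm j m θ y) ϕ = harmNorm j m *
      (legendreFactor j m.natAbs θ : ℂ) * (Complex.I * m *
      Complex.exp (Complex.I * (m : ℂ) * (ϕ : ℂ))) := by
    simp only [sphHarm_eq]
    exact ((hasDerivAt_exp_mul (Complex.I * m) ϕ).const_mul _).deriv
  simp only [swsh, if_neg h1, Int.toNat_natCast]
  simp only [show ¬ ((-1 : ℤ) = 0) by decide, show ¬ ((-1 : ℤ) = 1) by decide, if_false, if_true]
  simp only [ethBar, dMinus, d1, d2, spinLegendre]
  simp only [sphHarm_eq, Complex.ofReal_sin]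
  push_cast
  linear_combination (-(harmNorm j m : ℂ) * (legendreFactor j m.natAbs θ : ℂ) * m *
    Complex.exp (Complex.I * (m : ℂ) * (ϕ : ℂ)) / Complex.sin θ
    / (Real.sqrt ((j : ℝ) * ((j : ℝ) + 1)) : ℂ)) * Complex.I_sq

theorem swsh_eq_zero_of_lt {s j m : ℤ} (h : j < |s|) (θ ϕ : ℝ) : swsh s j m θ ϕ = 0 := by
  simp [swsh, h]

/-- The Fourier factor `exp (-i m ϕ)`. -/
def fourierFactor (m : ℤ) (ϕ : ℝ) : ℂ := Complex.exp (-(Complex.I * m) * ϕ)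

theorem integral_fourierFactor_mul_exp (m m' : ℤ) :
    ∫ ϕ in (0 : ℝ)..(2 * Real.pi),
      fourierFactor m ϕ * Complex.exp (Complex.I * (m' : ℂ) * (ϕ : ℂ)) =
      if m' = m then (2 * Real.pi : ℂ) else 0 := by
  simp only [fourierFactor, ← Complex.exp_add]
  split_ifs with h
  · subst h
    simp
  · have hc : Complex.I * ((m' : ℂ) - m) ≠ 0 :=
      mul_ne_zero Complex.I_ne_zero (sub_ne_zero.2 (by exact_mod_cast h))
    have e : ∀ ϕ : ℝ, Complex.exp (-(Complex.I * m) * ϕ + Complex.I * m' * ϕ) =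
        Complex.exp (Complex.I * ((m' : ℂ) - m) * ϕ) := fun ϕ => by
      congr 1
      ring
    simp only [e]
    rw [integral_exp_mul_complex hc]
    have : Complex.exp (Complex.I * ((m' : ℂ) - m) * ((2 * Real.pi : ℝ) : ℂ)) = 1 := by
      rw [Complex.exp_eq_one_iff]
      refine ⟨m' - m, ?_⟩
      push_cast
      ring
    rw [this]
    simp

/-- The projection of a function of spin weight `-1` on the harmonic of degree `j` and order `m`,
up to normalisation. -/
def modeProj (j : ℕ) (m : ℤ) (g : ℝ → ℝ → ℂ) : ℂ :=
  ∫ θ in (0 : ℝ)..Real.pi, spinFactor j m.natAbs m θ *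
    ∫ ϕ in (0 : ℝ)..(2 * Real.pi), fourierFactor m ϕ * g θ ϕ

theorem continuous_fourierFactor (m : ℤ) : Continuous (fourierFactor m) := by
  unfold fourierFactor
  fun_prop

theorem continuous_swsh_neg_one (j m : ℤ) (θ : ℝ) : Continuous (swsh (-1) j m θ) := by
  by_cases hj : j < 1
  · have : swsh (-1) j m θ = fun _ => 0 := by
      funext ϕ
      exact swsh_eq_zero_of_lt (by simpa using hj) θ ϕ
    rw [this]
    exact continuous_const
  · lift j to ℕ using by omega
    have : swsh (-1) j m θ = _ := funext (swsh_neg_one_eq j (by omega) m θ)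
    rw [this]
    fun_prop

theorem integral_fourierFactor_mul_swsh (j' : ℤ) (m m' : ℤ) (θ : ℝ) :
    ∫ ϕ in (0 : ℝ)..(2 * Real.pi), fourierFactor m ϕ * swsh (-1) j' m' θ ϕ =
      if 1 ≤ j' ∧ m' = m then
        (2 * Real.pi * (harmNorm j'.toNat m / Real.sqrt ((j' : ℝ) * ((j' : ℝ) + 1)) : ℝ) : ℂ) *
          spinLegendre j'.toNat m θ else 0 := by
  by_cases hj : 1 ≤ j'
  · lift j' to ℕ using by omega
    simp only [swsh_neg_one_eq j' (by omega) m' θ, hj, true_and, Int.toNat_natCast]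
    have e : ∀ ϕ : ℝ, fourierFactor m ϕ *
        (((harmNorm j' m' / Real.sqrt ((j' : ℝ) * ((j' : ℝ) + 1)) : ℝ) : ℂ) *
        spinLegendre j' m' θ * Complex.exp (Complex.I * (m' : ℂ) * (ϕ : ℂ))) =
        (((harmNorm j' m' / Real.sqrt ((j' : ℝ) * ((j' : ℝ) + 1)) : ℝ) : ℂ) *
        spinLegendre j' m' θ) * (fourierFactor m ϕ *
          Complex.exp (Complex.I * (m' : ℂ) * (ϕ : ℂ))) := fun ϕ => by ring
    simp only [e, intervalIntegral.integral_const_mul, integral_fourierFactor_mul_exp]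
    split_ifs with h
    · subst h
      push_cast
      ring
    · simp
  · have : ∀ ϕ, swsh (-1) j' m' θ ϕ = 0 := fun ϕ =>
      swsh_eq_zero_of_lt (by simp; omega) θ ϕ
    simp [this, hj]

theorem intervalIntegrable_modeProj_swsh (j : ℕ) (j' m m' : ℤ) :
    IntervalIntegrable (fun θ => spinFactor j m.natAbs m θ *
      ∫ ϕ in (0 : ℝ)..(2 * Real.pi), fourierFactor m ϕ * swsh (-1) j' m' θ ϕ)
      MeasureTheory.volume 0 Real.pi := by
  simp only [integral_fourierFactor_mul_swsh]
  split_ifs with h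
  · have := (intervalIntegrable_spinFactor_mul_spinLegendre j j'.toNat m).const_mul
      (2 * Real.pi * (harmNorm j'.toNat m / Real.sqrt ((j' : ℝ) * ((j' : ℝ) + 1)) : ℝ) : ℂ)
    exact intervalIntegrable_congr_Ioo Real.pi_pos.le (fun θ _ => by ring) this
  · simp

theorem modeProj_swsh_eq_zero {j : ℕ} {j' m m' : ℤ} (h : j' ≠ j ∨ m' ≠ m) :
    modeProj j m (swsh (-1) j' m') = 0 := by
  unfold modeProj
  simp only [integral_fourierFactor_mul_swsh]
  split_ifs with hc
  · have hj : j ≠ j'.toNat := by omega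
    have e : ∀ θ : ℝ, spinFactor j m.natAbs m θ *
        ((2 * Real.pi * (harmNorm j'.toNat m / Real.sqrt ((j' : ℝ) * ((j' : ℝ) + 1)) : ℝ) : ℂ) *
          spinLegendre j'.toNat m θ) =
        (2 * Real.pi * (harmNorm j'.toNat m / Real.sqrt ((j' : ℝ) * ((j' : ℝ) + 1)) : ℝ) : ℂ) *
        (spinFactor j m.natAbs m θ * spinLegendre j'.toNat m θ) := fun θ => by ring
    simp only [e, intervalIntegral.integral_const_mul,
      integral_spinFactor_mul_spinLegendre_eq_zero hj, mul_zero]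
  · simp

theorem modeProj_sum {ι : Type*} (s : Finset ι) (c : ι → ℂ) (d e : ι → ℤ) (j : ℕ) (m : ℤ) :
    modeProj j m (fun θ ϕ => ∑ i ∈ s, c i * swsh (-1) (d i) (e i) θ ϕ) =
      ∑ i ∈ s, c i * modeProj j m (swsh (-1) (d i) (e i)) := by
  unfold modeProj
  have h1 : ∀ θ : ℝ, (∫ ϕ in (0 : ℝ)..(2 * Real.pi), fourierFactor m ϕ *
      ∑ i ∈ s, c i * swsh (-1) (d i) (e i) θ ϕ) = ∑ i ∈ s, c i *
      ∫ ϕ in (0 : ℝ)..(2 * Real.pi), fourierFactor m ϕ * swsh (-1) (d i) (e i) θ ϕ := by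
    intro θ
    have hc : ∀ i, Continuous fun ϕ => fourierFactor m ϕ * swsh (-1) (d i) (e i) θ ϕ :=
      fun i => (continuous_fourierFactor m).mul (continuous_swsh_neg_one _ _ θ)
    simp only [Finset.mul_sum, ← intervalIntegral.integral_const_mul]
    rw [← intervalIntegral.integral_finsetSum fun i _ =>
      ((hc i).const_mul (c i)).intervalIntegrable _ _]
    congr 1
    funext ϕ
    exact Finset.sum_congr rfl fun i _ => by ring
  simp only [h1]
  simp only [← intervalIntegral.integral_const_mul (r := c _)]
  rw [← intervalIntegral.integral_finsetSum fun i _ =>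
    (intervalIntegrable_modeProj_swsh j (d i) m (e i)).const_mul (c i)]
  congr 1
  funext θ
  rw [Finset.mul_sum]
  refine Finset.sum_congr rfl fun i _ => ?_
  rw [intervalIntegral.integral_const_mul]
  ring

end

section

/-! ### Projection of the field on a harmonic mode -/

theorem contDiff_fourierFactor (m : ℤ) : ContDiff ℝ ∞ (fourierFactor m) :=
  (contDiff_const.mul Complex.ofRealCLM.contDiff).cexp

section WeightedIntegral

variable {X : Type} [NormedAddCommGroup X] [NormedSpace ℝ X] {S : Set X} {w : ℝ → ℂ} {g : X × ℝ → ℂ}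

theorem contDiffOn_weightedIntegral (hS : Convex ℝ S) (hu : UniqueDiffOn ℝ S)
    (hw : ContDiff ℝ ∞ w) (hg : ContDiffOn ℝ ∞ g (S ×ˢ univ)) {c d : ℝ} (hcd : c < d) :
    ContDiffOn ℝ ∞ (fun x => ∫ t in c..d, w t * g (x, t)) S := by
  refine contDiffOn_integral (f := fun z : X × ℝ => w z.2 * g z) hS hu hcd ?_
  exact ((hw.comp contDiff_snd).contDiffOn).mul (hg.mono (prod_mono_right (subset_univ _)))

theorem contDiffOn_weighted_curve (hw : ContDiff ℝ ∞ w) (hg : ContDiffOn ℝ ∞ g (S ×ˢ univ))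
    {I T : Set ℝ} {γ : ℝ → X} (hγ : ContDiff ℝ ∞ γ) (hI : MapsTo γ I S) :
    ContDiffOn ℝ ∞ (fun z : ℝ × ℝ => w z.2 * g (γ z.1, z.2)) (I ×ˢ T) := by
  refine ((hw.comp contDiff_snd).contDiffOn).mul (hg.comp (s := I ×ˢ T)
    (f := fun z : ℝ × ℝ => (γ z.1, z.2)) ?_ ?_)
  · exact ((hγ.comp contDiff_fst).prodMk contDiff_snd).contDiffOn
  · exact fun z hz => ⟨hI hz.1, mem_univ _⟩

/-- The derivative of a weighted parametric integral along a curve in the parameter set. -/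
theorem hasDerivAt_weightedIntegral (hw : ContDiff ℝ ∞ w) (hg : ContDiffOn ℝ ∞ g (S ×ˢ univ))
    {c d : ℝ} (hcd : c < d) {a b : ℝ} {γ : ℝ → X} (hγ : ContDiff ℝ ∞ γ)
    (hI : MapsTo γ (Ioo a b) S) {s : ℝ} (hs : s ∈ Ioo a b) :
    HasDerivAt (fun r => ∫ t in c..d, w t * g (γ r, t))
      (∫ t in c..d, w t * deriv (fun r => g (γ r, t)) s) s ∧
    IntervalIntegrable (fun t => w t * deriv (fun r => g (γ r, t)) s) MeasureTheory.volume c d := by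
  have hf := contDiffOn_weighted_curve hw hg (T := Icc c d) hγ hI
  obtain ⟨h1, h2⟩ := hasDerivWithinAt_integral (convex_Ioo a b) (uniqueDiffOn_Ioo a b) hcd hf
  have e : ∀ t, derivWithin (fun r => w t * g (γ r, t)) (Ioo a b) s =
      w t * deriv (fun r => g (γ r, t)) s := fun t => by
    rw [derivWithin_of_isOpen isOpen_Ioo hs, deriv_const_mul_field]
  have h2s := h2 s hs
  have h1s := intervalIntegrable_slice hcd.le h1.continuousOn hs
  simp only [e] at h1s h2s
  exact ⟨h2s.hasDerivAt (isOpen_Ioo.mem_nhds hs), h1s⟩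

theorem iteratedDerivWithin_weightedIntegral (hw : ContDiff ℝ ∞ w)
    (hg : ContDiffOn ℝ ∞ g (S ×ˢ univ)) {c d : ℝ} (hcd : c < d) {I : Set ℝ} (hIc : Convex ℝ I)
    (hIu : UniqueDiffOn ℝ I) {γ : ℝ → X} (hγ : ContDiff ℝ ∞ γ) (hI : MapsTo γ I S) (q : ℕ) {s : ℝ}
    (hs : s ∈ I) :
    iteratedDerivWithin q (fun r => ∫ t in c..d, w t * g (γ r, t)) I s =
      ∫ t in c..d, w t * iteratedDerivWithin q (fun r => g (γ r, t)) I s := by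
  have hf := contDiffOn_weighted_curve hw hg (T := Icc c d) hγ hI
  rw [iteratedDerivWithin_integral hIc hIu hcd hf q hs]
  congr 1
  funext t
  exact iteratedDerivWithin_const_mul_field (w t) (fun r => g (γ r, t))

end WeightedIntegral

theorem sum_integral_eq_zero {n : ℕ} {a b : ℝ} (hab : a ≤ b) (w : ℝ → ℂ) (c : Fin n → ℂ)
    (g : Fin n → ℝ → ℂ)
    (hg : ∀ i, IntervalIntegrable (fun t => w t * g i t) MeasureTheory.volume a b)
    (h : ∀ t ∈ Ioo a b, ∑ i, c i * g i t = 0) :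
    ∑ i, c i * ∫ t in a..b, w t * g i t = 0 := by
  simp only [← intervalIntegral.integral_const_mul (r := c _)]
  rw [← intervalIntegral.integral_finsetSum fun i _ => (hg i).const_mul (c i)]
  rw [← intervalIntegral.integral_zero (a := a) (b := b) (μ := MeasureTheory.volume) (E := ℂ)]
  refine integral_congr_Ioo hab fun t ht => ?_
  have e : ∀ i, c i * (w t * g i t) = w t * (c i * g i t) := fun i => by ring
  simp only [e, ← Finset.mul_sum, h t ht, mul_zero]

/-- The domain of the fields in all four coordinates `(((τ, ρ), θ), ϕ)`; the angles range over all
real numbers. -/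
def fieldDomain (ρ₀ : ℝ) : Set (((ℝ × ℝ) × ℝ) × ℝ) := (strip ρ₀ ×ˢ univ) ×ˢ univ

theorem contDiff_spinVector (s : ℤ) (i : Fin 3) :
    ContDiff ℝ ∞ (fun z : ℝ × ℝ => spinVector s z.1 z.2 i) := by
  have hr : ∀ f : ℝ × ℝ → ℝ, ContDiff ℝ ∞ f → ContDiff ℝ ∞ (fun z => (f z : ℂ)) :=
    fun f hf => Complex.ofRealCLM.contDiff.comp hf
  have s1 : ContDiff ℝ ∞ fun z : ℝ × ℝ => Real.sin z.1 := Real.contDiff_sin.comp contDiff_fst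
  have s2 : ContDiff ℝ ∞ fun z : ℝ × ℝ => Real.sin z.2 := Real.contDiff_sin.comp contDiff_snd
  have c1 : ContDiff ℝ ∞ fun z : ℝ × ℝ => Real.cos z.1 := Real.contDiff_cos.comp contDiff_fst
  have c2 : ContDiff ℝ ∞ fun z : ℝ × ℝ => Real.cos z.2 := Real.contDiff_cos.comp contDiff_snd
  unfold spinVector
  split_ifs with h
  · fin_cases i
    · exact hr _ (s1.mul c2)
    · exact hr _ (s1.mul s2)
    · exact hr _ c1
  · fin_cases i
    · exact (hr _ (c1.mul c2)).sub (contDiff_const.mul (hr _ s2))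
    · exact (hr _ (c1.mul s2)).add (contDiff_const.mul (hr _ c2))
    · exact (hr _ s1).neg

theorem contDiff_spherePoint : ContDiff ℝ ∞ (fun z : ℝ × ℝ => spherePoint z.1 z.2) := by
  have s1 : ContDiff ℝ ∞ fun z : ℝ × ℝ => Real.sin z.1 := Real.contDiff_sin.comp contDiff_fst
  have s2 : ContDiff ℝ ∞ fun z : ℝ × ℝ => Real.sin z.2 := Real.contDiff_sin.comp contDiff_snd
  have c1 : ContDiff ℝ ∞ fun z : ℝ × ℝ => Real.cos z.1 := Real.contDiff_cos.comp contDiff_fst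
  have c2 : ContDiff ℝ ∞ fun z : ℝ × ℝ => Real.cos z.2 := Real.contDiff_cos.comp contDiff_snd
  rw [contDiff_pi]
  intro i
  fin_cases i
  · exact s1.mul c2
  · exact s1.mul s2
  · exact c1

/-- A smooth quantity of spin weight `s` extends from `0 < θ < π` to a smooth function of all real
angles, periodic in `ϕ`. -/
theorem IsSmoothSpinWeighted.exists_extension {s : ℤ} {ρ₀ : ℝ} {f : ℝ → ℝ → ℝ → ℝ → ℂ}
    (hf : IsSmoothSpinWeighted s ρ₀ f) :
    ∃ ψ : ((ℝ × ℝ) × ℝ) × ℝ → ℂ, ContDiffOn ℝ ∞ ψ (fieldDomain ρ₀) ∧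
      (∀ y, ψ (y, 2 * Real.pi) = ψ (y, 0)) ∧
      ∀ τ ∈ Ioo (-1 : ℝ) 1, ∀ ρ ∈ Ico 0 ρ₀, ∀ θ ∈ Ioo 0 Real.pi, ∀ ϕ : ℝ,
        f τ ρ θ ϕ = ψ (((τ, ρ), θ), ϕ) := by
  obtain ⟨α, hα, hfα⟩ := hf
  refine ⟨fun z => ∑ i, α (z.1.1.1, z.1.1.2, spherePoint z.1.2 z.2) i *
    spinVector s z.1.2 z.2 i, ?_, ?_, hfα⟩
  · have hang : ContDiff ℝ ∞ (fun z : ((ℝ × ℝ) × ℝ) × ℝ => (z.1.2, z.2)) := by fun_prop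
    have hpt : ContDiff ℝ ∞ (fun z : ((ℝ × ℝ) × ℝ) × ℝ => spherePoint z.1.2 z.2) :=
      ContDiff.comp (g := fun z : ℝ × ℝ => spherePoint z.1 z.2)
        (f := fun z : ((ℝ × ℝ) × ℝ) × ℝ => (z.1.2, z.2)) contDiff_spherePoint hang
    have h1 : ContDiffOn ℝ ∞ (fun z : ((ℝ × ℝ) × ℝ) × ℝ =>
        α (z.1.1.1, z.1.1.2, spherePoint z.1.2 z.2)) (fieldDomain ρ₀) := by
      have hg : ContDiff ℝ ∞ (fun z : ((ℝ × ℝ) × ℝ) × ℝ =>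
          (z.1.1.1, z.1.1.2, spherePoint z.1.2 z.2)) :=
        (contDiff_fst.fst.fst).prodMk ((contDiff_fst.fst.snd).prodMk hpt)
      have hm : MapsTo (fun z : ((ℝ × ℝ) × ℝ) × ℝ =>
          (z.1.1.1, z.1.1.2, spherePoint z.1.2 z.2)) (fieldDomain ρ₀)
          (Ioo (-1) 1 ×ˢ (Ico 0 ρ₀ ×ˢ univ)) :=
        fun z hz => ⟨hz.1.1.1, hz.1.1.2, mem_univ _⟩
      exact hα.comp hg.contDiffOn hm
    refine ContDiffOn.sum fun i _ => ?_
    have h2 : ContDiff ℝ ∞ (fun z : ((ℝ × ℝ) × ℝ) × ℝ => spinVector s z.1.2 z.2 i) :=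
      ContDiff.comp (g := fun z : ℝ × ℝ => spinVector s z.1 z.2 i)
        (f := fun z : ((ℝ × ℝ) × ℝ) × ℝ => (z.1.2, z.2)) (contDiff_spinVector s i) hang
    exact (contDiffOn_pi.1 h1 i).mul h2.contDiffOn
  · intro y
    simp [spherePoint, spinVector]

/-- The Fourier coefficient of order `m` in `ϕ`. -/
def fourierMode (m : ℤ) (ψ : ((ℝ × ℝ) × ℝ) × ℝ → ℂ) (y : (ℝ × ℝ) × ℝ) : ℂ :=
  ∫ ϕ in (0 : ℝ)..(2 * Real.pi), fourierFactor m ϕ * ψ (y, ϕ)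

variable {ρ₀ : ℝ} {ψ : ((ℝ × ℝ) × ℝ) × ℝ → ℂ}

theorem contDiffOn_fourierMode (m : ℤ) (hψ : ContDiffOn ℝ ∞ ψ (fieldDomain ρ₀)) :
    ContDiffOn ℝ ∞ (fourierMode m ψ) (strip ρ₀ ×ˢ univ) :=
  contDiffOn_weightedIntegral (convex_strip.prod convex_univ)
    (uniqueDiffOn_strip.prod uniqueDiffOn_univ) (contDiff_fourierFactor m) hψ Real.two_pi_pos

theorem contDiff_azimuth (hψ : ContDiffOn ℝ ∞ ψ (fieldDomain ρ₀)) {y : (ℝ × ℝ) × ℝ}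
    (hy : y.1 ∈ strip ρ₀) : ContDiff ℝ ∞ (fun ϕ => ψ (y, ϕ)) := by
  rw [← contDiffOn_univ]
  exact hψ.comp (by fun_prop) fun ϕ _ => ⟨⟨hy, mem_univ _⟩, mem_univ _⟩

/-- The Fourier coefficient of `∂_ϕ ψ`. -/
theorem integral_fourierFactor_mul_deriv (m : ℤ) {u : ℝ → ℂ} (hu : ContDiff ℝ ∞ u)
    (hper : u (2 * Real.pi) = u 0) :
    ∫ ϕ in (0 : ℝ)..(2 * Real.pi), fourierFactor m ϕ * deriv u ϕ =
      Complex.I * m * ∫ ϕ in (0 : ℝ)..(2 * Real.pi), fourierFactor m ϕ * u ϕ := by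
  have h := intervalIntegral.integral_mul_deriv_eq_deriv_mul (a := 0) (b := 2 * Real.pi)
    (u := fourierFactor m) (u' := fun ϕ => -(Complex.I * m) * fourierFactor m ϕ) (v := u)
    (v' := deriv u) (fun x _ => hasDerivAt_exp_mul _ x)
    (fun x _ => (hu.differentiable (by simp) x).hasDerivAt)
    ((continuous_const.mul (continuous_fourierFactor m)).intervalIntegrable _ _)
    ((hu.continuous_deriv (by simp)).intervalIntegrable _ _)
  have hE : fourierFactor m (2 * Real.pi) = fourierFactor m 0 := by
    have : Complex.exp (-(Complex.I * m) * ((2 * Real.pi : ℝ) : ℂ)) = 1 := by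
      rw [Complex.exp_eq_one_iff]
      refine ⟨-m, ?_⟩
      push_cast
      ring
    simp only [fourierFactor]
    rw [this]
    simp
  rw [hE, hper, sub_self, zero_sub] at h
  rw [h, ← intervalIntegral.integral_neg, ← intervalIntegral.integral_const_mul]
  congr 1
  funext ϕ
  ring

/-- The four kinds of Fourier integrals that occur in the field equations at a fixed point. -/
theorem fourierMode_derivs (m : ℤ) (hψ : ContDiffOn ℝ ∞ ψ (fieldDomain ρ₀))
    (hper : ∀ y, ψ (y, 2 * Real.pi) = ψ (y, 0)) {τ ρ : ℝ} (hτ : τ ∈ Ioo (-1 : ℝ) 1)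
    (hρ : ρ ∈ Ioo 0 ρ₀) (θ : ℝ) :
    (deriv (fun t => fourierMode m ψ ((t, ρ), θ)) τ =
      (∫ ϕ in (0 : ℝ)..(2 * Real.pi),
        fourierFactor m ϕ * deriv (fun t => ψ (((t, ρ), θ), ϕ)) τ) ∧
    IntervalIntegrable (fun ϕ => fourierFactor m ϕ * deriv (fun t => ψ (((t, ρ), θ), ϕ)) τ)
      MeasureTheory.volume 0 (2 * Real.pi)) ∧
    (deriv (fun r => fourierMode m ψ ((τ, r), θ)) ρ =
      (∫ ϕ in (0 : ℝ)..(2 * Real.pi),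
        fourierFactor m ϕ * deriv (fun r => ψ (((τ, r), θ), ϕ)) ρ) ∧
    IntervalIntegrable (fun ϕ => fourierFactor m ϕ * deriv (fun r => ψ (((τ, r), θ), ϕ)) ρ)
      MeasureTheory.volume 0 (2 * Real.pi)) ∧
    (deriv (fun x => fourierMode m ψ ((τ, ρ), x)) θ =
      (∫ ϕ in (0 : ℝ)..(2 * Real.pi),
        fourierFactor m ϕ * deriv (fun x => ψ (((τ, ρ), x), ϕ)) θ) ∧
    IntervalIntegrable (fun ϕ => fourierFactor m ϕ * deriv (fun x => ψ (((τ, ρ), x), ϕ)) θ)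
      MeasureTheory.volume 0 (2 * Real.pi)) ∧
    (Complex.I * m * fourierMode m ψ ((τ, ρ), θ) =
      (∫ ϕ in (0 : ℝ)..(2 * Real.pi),
        fourierFactor m ϕ * deriv (fun y => ψ (((τ, ρ), θ), y)) ϕ) ∧
    IntervalIntegrable (fun ϕ => fourierFactor m ϕ * deriv (fun y => ψ (((τ, ρ), θ), y)) ϕ)
      MeasureTheory.volume 0 (2 * Real.pi)) ∧
    IntervalIntegrable (fun ϕ => fourierFactor m ϕ * ψ (((τ, ρ), θ), ϕ))
      MeasureTheory.volume 0 (2 * Real.pi) := by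
  have hρ' := Ioo_subset_Ico_self hρ
  have hE := contDiff_fourierFactor m
  have hu := contDiff_azimuth (y := ((τ, ρ), θ)) hψ ⟨hτ, hρ'⟩
  have h1 := hasDerivAt_weightedIntegral hE hψ Real.two_pi_pos (a := -1) (b := 1)
    (γ := fun t => ((t, ρ), θ)) (by fun_prop) (fun t ht => ⟨⟨ht, hρ'⟩, mem_univ _⟩) hτ
  have h2 := hasDerivAt_weightedIntegral hE hψ Real.two_pi_pos (a := 0) (b := ρ₀)
    (γ := fun r => ((τ, r), θ)) (by fun_prop)
    (fun r hr => ⟨⟨hτ, Ioo_subset_Ico_self hr⟩, mem_univ _⟩) hρ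
  have h3 := hasDerivAt_weightedIntegral hE hψ Real.two_pi_pos (a := θ - 1) (b := θ + 1)
    (γ := fun x => ((τ, ρ), x)) (by fun_prop) (fun x _ => ⟨⟨hτ, hρ'⟩, mem_univ _⟩)
    (s := θ) ⟨by linarith, by linarith⟩
  exact ⟨⟨h1.1.deriv, h1.2⟩, ⟨h2.1.deriv, h2.2⟩, ⟨h3.1.deriv, h3.2⟩,
    ⟨(integral_fourierFactor_mul_deriv m hu (hper _)).symm,
      (hE.continuous.mul (hu.continuous_deriv (by simp))).intervalIntegrable _ _⟩,
    (hE.continuous.mul hu.continuous).intervalIntegrable _ _⟩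

/-- A Maxwell field together with smooth extensions of its components to all real angles. -/
structure ExtendedField (ρ₀ : ℝ) (φ : Fin 3 → ℝ → ℝ → ℝ → ℝ → ℂ)
    (ψ : Fin 3 → ((ℝ × ℝ) × ℝ) × ℝ → ℂ) : Prop where
  maxwell : IsMaxwellField ρ₀ φ
  smooth : ∀ k, ContDiffOn ℝ ∞ (ψ k) (fieldDomain ρ₀)
  periodic : ∀ k y, ψ k (y, 2 * Real.pi) = ψ k (y, 0)
  eq : ∀ k, ∀ τ ∈ Ioo (-1 : ℝ) 1, ∀ ρ ∈ Ico 0 ρ₀, ∀ θ ∈ Ioo 0 Real.pi, ∀ ϕ : ℝ,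
    φ k τ ρ θ ϕ = ψ k (((τ, ρ), θ), ϕ)

theorem IsMaxwellField.exists_extendedField {φ : Fin 3 → ℝ → ℝ → ℝ → ℝ → ℂ}
    (h : IsMaxwellField ρ₀ φ) : ∃ ψ, ExtendedField ρ₀ φ ψ := by
  choose ψ h1 h2 h3 using fun k => (h.smooth k).exists_extension
  exact ⟨ψ, h, h1, h2, h3⟩

variable {φ : Fin 3 → ℝ → ℝ → ℝ → ℝ → ℂ} {Ψ : Fin 3 → ((ℝ × ℝ) × ℝ) × ℝ → ℂ}

/-- The derivatives of a component of the field agree with those of its extension. -/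
theorem ExtendedField.deriv_eq (h : ExtendedField ρ₀ φ Ψ) (k : Fin 3) {τ ρ θ : ℝ}
    (hτ : τ ∈ Ioo (-1 : ℝ) 1) (hρ : ρ ∈ Ioo 0 ρ₀) (hθ : θ ∈ Ioo 0 Real.pi) (ϕ : ℝ) :
    deriv (fun t => φ k t ρ θ ϕ) τ = deriv (fun t => Ψ k (((t, ρ), θ), ϕ)) τ ∧
    deriv (fun r => φ k τ r θ ϕ) ρ = deriv (fun r => Ψ k (((τ, r), θ), ϕ)) ρ ∧
    deriv (fun x => φ k τ ρ x ϕ) θ = deriv (fun x => Ψ k (((τ, ρ), x), ϕ)) θ ∧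
    deriv (fun y => φ k τ ρ θ y) ϕ = deriv (fun y => Ψ k (((τ, ρ), θ), y)) ϕ ∧
    φ k τ ρ θ ϕ = Ψ k (((τ, ρ), θ), ϕ) := by
  have hρ' := Ioo_subset_Ico_self hρ
  refine ⟨EventuallyEq.deriv_eq ?_, EventuallyEq.deriv_eq ?_, EventuallyEq.deriv_eq ?_, ?_,
    h.eq k τ hτ ρ hρ' θ hθ ϕ⟩
  · filter_upwards [isOpen_Ioo.mem_nhds hτ] with t ht using h.eq k t ht ρ hρ' θ hθ ϕ
  · filter_upwards [isOpen_Ioo.mem_nhds hρ] with r hr using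
      h.eq k τ hτ r (Ioo_subset_Ico_self hr) θ hθ ϕ
  · filter_upwards [isOpen_Ioo.mem_nhds hθ] with x hx using h.eq k τ hτ ρ hρ' x hx ϕ
  · congr 1
    funext y
    exact h.eq k τ hτ ρ hρ' θ hθ y

/-- The Maxwell equations for the Fourier coefficients of order `m` in `ϕ`. -/
theorem ExtendedField.fourier_equations (h : ExtendedField ρ₀ φ Ψ) (m : ℤ) {τ ρ θ : ℝ}
    (hτ : τ ∈ Ioo (-1 : ℝ) 1) (hρ : ρ ∈ Ioo 0 ρ₀) (hθ : θ ∈ Ioo 0 Real.pi)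
    {H : Fin 3 → (ℝ × ℝ) × ℝ → ℂ} (hH : ∀ k, H k = fourierMode m (Ψ k)) :
    (1 + τ) * deriv (fun t => H 0 ((t, ρ), θ)) τ - ρ * deriv (fun r => H 0 ((τ, r), θ)) ρ
      - (deriv (fun x => H 1 ((τ, ρ), x)) θ - m * H 1 ((τ, ρ), θ) / Real.sin θ)
      + H 0 ((τ, ρ), θ) = 0 ∧
    deriv (fun t => H 1 ((t, ρ), θ)) τ
      - (1 / 2) * (deriv (fun x => H 2 ((τ, ρ), x)) θ - m * H 2 ((τ, ρ), θ) / Real.sin θ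
        + varpi θ * H 2 ((τ, ρ), θ))
      - (1 / 2) * (deriv (fun x => H 0 ((τ, ρ), x)) θ + m * H 0 ((τ, ρ), θ) / Real.sin θ
        + varpi θ * H 0 ((τ, ρ), θ)) = 0 ∧
    (1 - τ) * deriv (fun t => H 2 ((t, ρ), θ)) τ + ρ * deriv (fun r => H 2 ((τ, r), θ)) ρ
      - (deriv (fun x => H 1 ((τ, ρ), x)) θ + m * H 1 ((τ, ρ), θ) / Real.sin θ)
      - H 2 ((τ, ρ), θ) = 0 ∧
    τ * deriv (fun t => H 1 ((t, ρ), θ)) τ - ρ * deriv (fun r => H 1 ((τ, r), θ)) ρ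
      - (1 / 2) * (deriv (fun x => H 2 ((τ, ρ), x)) θ - m * H 2 ((τ, ρ), θ) / Real.sin θ
        + varpi θ * H 2 ((τ, ρ), θ))
      + (1 / 2) * (deriv (fun x => H 0 ((τ, ρ), x)) θ + m * H 0 ((τ, ρ), θ) / Real.sin θ
        + varpi θ * H 0 ((τ, ρ), θ)) = 0 := by
  have hd := fun k => fourierMode_derivs m (h.smooth k) (h.periodic k) hτ hρ θ
  have he := fun k ϕ => h.deriv_eq k hτ hρ hθ ϕ
  have hI := Complex.I_sq
  have hπ := Real.two_pi_pos.le
  refine ⟨?_, ?_, ?_, ?_⟩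
  · have key := sum_integral_eq_zero hπ (fourierFactor m)
      ![1 + τ, -ρ, -1, -(Complex.I / Real.sin θ), 1]
      ![fun ϕ => deriv (fun t => Ψ 0 (((t, ρ), θ), ϕ)) τ,
        fun ϕ => deriv (fun r => Ψ 0 (((τ, r), θ), ϕ)) ρ,
        fun ϕ => deriv (fun x => Ψ 1 (((τ, ρ), x), ϕ)) θ,
        fun ϕ => deriv (fun y => Ψ 1 (((τ, ρ), θ), y)) ϕ,
        fun ϕ => Ψ 0 (((τ, ρ), θ), ϕ)] ?_ ?_
    · simp only [Fin.sum_univ_succ, Fin.sum_univ_zero, Matrix.cons_val_zero, Matrix.cons_val_succ,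
        ← (hd 0).1.1, ← (hd 0).2.1.1, ← (hd 1).2.2.1.1, ← (hd 1).2.2.2.1.1] at key
      simp only [← fourierMode.eq_1, ← hH] at key
      linear_combination key + m * H 1 ((τ, ρ), θ) / Real.sin θ * hI
    · intro i
      fin_cases i
      exacts [(hd 0).1.2, (hd 0).2.1.2, (hd 1).2.2.1.2, (hd 1).2.2.2.1.2, (hd 0).2.2.2.2]
    · intro ϕ _
      have e := h.maxwell.evolution0 τ hτ ρ hρ θ hθ ϕ
      simp only [eth, dPlus, (he _ ϕ).1, (he _ ϕ).2.1, (he _ ϕ).2.2.1, (he _ ϕ).2.2.2.1,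
        (he _ ϕ).2.2.2.2] at e
      simp only [Fin.sum_univ_succ, Fin.sum_univ_zero, Matrix.cons_val_zero, Matrix.cons_val_succ,
        Complex.ofReal_sin]
      push_cast at e
      linear_combination e
  · have key := sum_integral_eq_zero hπ (fourierFactor m)
      ![1, -(1 / 2), -(1 / 2) * (Complex.I / Real.sin θ), -(1 / 2) * varpi θ,
        -(1 / 2), (1 / 2) * (Complex.I / Real.sin θ), -(1 / 2) * varpi θ]
      ![fun ϕ => deriv (fun t => Ψ 1 (((t, ρ), θ), ϕ)) τ,
        fun ϕ => deriv (fun x => Ψ 2 (((τ, ρ), x), ϕ)) θ,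
        fun ϕ => deriv (fun y => Ψ 2 (((τ, ρ), θ), y)) ϕ,
        fun ϕ => Ψ 2 (((τ, ρ), θ), ϕ),
        fun ϕ => deriv (fun x => Ψ 0 (((τ, ρ), x), ϕ)) θ,
        fun ϕ => deriv (fun y => Ψ 0 (((τ, ρ), θ), y)) ϕ,
        fun ϕ => Ψ 0 (((τ, ρ), θ), ϕ)] ?_ ?_
    · simp only [Fin.sum_univ_succ, Fin.sum_univ_zero, Matrix.cons_val_zero, Matrix.cons_val_succ,
        ← (hd 1).1.1, ← (hd 2).2.2.1.1, ← (hd 2).2.2.2.1.1, ← (hd 0).2.2.1.1,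
        ← (hd 0).2.2.2.1.1] at key
      simp only [← fourierMode.eq_1, ← hH] at key
      linear_combination key + (1 / 2) * m * H 2 ((τ, ρ), θ) / Real.sin θ * hI
        - (1 / 2) * m * H 0 ((τ, ρ), θ) / Real.sin θ * hI
    · intro i
      fin_cases i
      exacts [(hd 1).1.2, (hd 2).2.2.1.2, (hd 2).2.2.2.1.2, (hd 2).2.2.2.2, (hd 0).2.2.1.2,
        (hd 0).2.2.2.1.2, (hd 0).2.2.2.2]
    · intro ϕ _
      have e := h.maxwell.evolution1 τ hτ ρ hρ θ hθ ϕ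
      simp only [eth, ethBar, dPlus, dMinus, (he _ ϕ).1, (he _ ϕ).2.2.1,
        (he _ ϕ).2.2.2.1, (he _ ϕ).2.2.2.2] at e
      simp only [Fin.sum_univ_succ, Fin.sum_univ_zero, Matrix.cons_val_zero, Matrix.cons_val_succ,
        Complex.ofReal_sin]
      push_cast at e
      linear_combination e
  · have key := sum_integral_eq_zero hπ (fourierFactor m)
      ![1 - τ, ρ, -1, Complex.I / Real.sin θ, -1]
      ![fun ϕ => deriv (fun t => Ψ 2 (((t, ρ), θ), ϕ)) τ,
        fun ϕ => deriv (fun r => Ψ 2 (((τ, r), θ), ϕ)) ρ,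
        fun ϕ => deriv (fun x => Ψ 1 (((τ, ρ), x), ϕ)) θ,
        fun ϕ => deriv (fun y => Ψ 1 (((τ, ρ), θ), y)) ϕ,
        fun ϕ => Ψ 2 (((τ, ρ), θ), ϕ)] ?_ ?_
    · simp only [Fin.sum_univ_succ, Fin.sum_univ_zero, Matrix.cons_val_zero, Matrix.cons_val_succ,
        ← (hd 2).1.1, ← (hd 2).2.1.1, ← (hd 1).2.2.1.1, ← (hd 1).2.2.2.1.1] at key
      simp only [← fourierMode.eq_1, ← hH] at key
      linear_combination key - m * H 1 ((τ, ρ), θ) / Real.sin θ * hI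
    · intro i
      fin_cases i
      exacts [(hd 2).1.2, (hd 2).2.1.2, (hd 1).2.2.1.2, (hd 1).2.2.2.1.2, (hd 2).2.2.2.2]
    · intro ϕ _
      have e := h.maxwell.evolution2 τ hτ ρ hρ θ hθ ϕ
      simp only [ethBar, dMinus, (he _ ϕ).1, (he _ ϕ).2.1, (he _ ϕ).2.2.1, (he _ ϕ).2.2.2.1,
        (he _ ϕ).2.2.2.2] at e
      simp only [Fin.sum_univ_succ, Fin.sum_univ_zero, Matrix.cons_val_zero, Matrix.cons_val_succ,
        Complex.ofReal_sin]
      push_cast at e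
      linear_combination e
  · have key := sum_integral_eq_zero hπ (fourierFactor m)
      ![τ, -ρ, -(1 / 2), -(1 / 2) * (Complex.I / Real.sin θ), -(1 / 2) * varpi θ,
        1 / 2, -(1 / 2) * (Complex.I / Real.sin θ), (1 / 2) * varpi θ]
      ![fun ϕ => deriv (fun t => Ψ 1 (((t, ρ), θ), ϕ)) τ,
        fun ϕ => deriv (fun r => Ψ 1 (((τ, r), θ), ϕ)) ρ,
        fun ϕ => deriv (fun x => Ψ 2 (((τ, ρ), x), ϕ)) θ,
        fun ϕ => deriv (fun y => Ψ 2 (((τ, ρ), θ), y)) ϕ,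
        fun ϕ => Ψ 2 (((τ, ρ), θ), ϕ),
        fun ϕ => deriv (fun x => Ψ 0 (((τ, ρ), x), ϕ)) θ,
        fun ϕ => deriv (fun y => Ψ 0 (((τ, ρ), θ), y)) ϕ,
        fun ϕ => Ψ 0 (((τ, ρ), θ), ϕ)] ?_ ?_
    · simp only [Fin.sum_univ_succ, Fin.sum_univ_zero, Matrix.cons_val_zero, Matrix.cons_val_succ,
        ← (hd 1).1.1, ← (hd 1).2.1.1, ← (hd 2).2.2.1.1, ← (hd 2).2.2.2.1.1, ← (hd 0).2.2.1.1,
        ← (hd 0).2.2.2.1.1] at key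
      simp only [← fourierMode.eq_1, ← hH] at key
      linear_combination key + (1 / 2) * m * H 2 ((τ, ρ), θ) / Real.sin θ * hI
        + (1 / 2) * m * H 0 ((τ, ρ), θ) / Real.sin θ * hI
    · intro i
      fin_cases i
      exacts [(hd 1).1.2, (hd 1).2.1.2, (hd 2).2.2.1.2, (hd 2).2.2.2.1.2, (hd 2).2.2.2.2,
        (hd 0).2.2.1.2, (hd 0).2.2.2.1.2, (hd 0).2.2.2.2]
    · intro ϕ _
      have e := h.maxwell.constraint τ hτ ρ hρ θ hθ ϕ
      simp only [eth, ethBar, dPlus, dMinus, (he _ ϕ).1, (he _ ϕ).2.1, (he _ ϕ).2.2.1,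
        (he _ ϕ).2.2.2.1, (he _ ϕ).2.2.2.2] at e
      simp only [Fin.sum_univ_succ, Fin.sum_univ_zero, Matrix.cons_val_zero, Matrix.cons_val_succ,
        Complex.ofReal_sin]
      push_cast at e
      linear_combination e

end

section

/-- The polar weights, including the factor `sin θ` of the area element, whose integrals against the
Fourier coefficients of the field project on the harmonics of degree `j` and order `m`. -/
def modeWeight (j : ℕ) (m : ℤ) : Fin 3 → ℝ → ℂ :=
  ![fun θ => -spinFactor j m.natAbs (-m) θ,
    fun θ => ((Real.sin θ * legendreFactor j m.natAbs θ : ℝ) : ℂ),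
    spinFactor j m.natAbs m]

theorem contDiff_modeWeight (j : ℕ) (m : ℤ) (k : Fin 3) : ContDiff ℝ ∞ (modeWeight j m k) := by
  fin_cases k
  · exact (contDiff_spinFactor _ _ _).neg
  · exact contDiff_ofReal_comp (Real.contDiff_sin.mul (contDiff_legendreFactor _ _))
  · exact contDiff_spinFactor _ _ _

/-- The mode of degree `j` and order `m` of the field, as a function of `(τ, ρ)`. -/
def fieldMode (j : ℕ) (m : ℤ) (Ψ : Fin 3 → ((ℝ × ℝ) × ℝ) × ℝ → ℂ) (k : Fin 3) (x : ℝ × ℝ) : ℂ :=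
  ∫ θ in (0 : ℝ)..Real.pi, modeWeight j m k θ * fourierMode m (Ψ k) (x, θ)

variable {ρ₀ : ℝ} {φ : Fin 3 → ℝ → ℝ → ℝ → ℝ → ℂ} {Ψ : Fin 3 → ((ℝ × ℝ) × ℝ) × ℝ → ℂ}

theorem ExtendedField.contDiffOn_fieldMode (h : ExtendedField ρ₀ φ Ψ) (j : ℕ) (m : ℤ) (k : Fin 3) :
    ContDiffOn ℝ ∞ (fieldMode j m Ψ k) (strip ρ₀) :=
  contDiffOn_weightedIntegral convex_strip uniqueDiffOn_strip (contDiff_modeWeight j m k)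
    (contDiffOn_fourierMode m (h.smooth k)) Real.pi_pos

theorem ExtendedField.fieldMode_derivs (h : ExtendedField ρ₀ φ Ψ) (j : ℕ) (m : ℤ) (k : Fin 3)
    {τ ρ : ℝ} (hτ : τ ∈ Ioo (-1 : ℝ) 1) (hρ : ρ ∈ Ioo 0 ρ₀) :
    (dTau ρ₀ (fieldMode j m Ψ k) (τ, ρ) = (∫ θ in (0 : ℝ)..Real.pi, modeWeight j m k θ *
      deriv (fun t => fourierMode m (Ψ k) ((t, ρ), θ)) τ) ∧
    IntervalIntegrable (fun θ => modeWeight j m k θ *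
      deriv (fun t => fourierMode m (Ψ k) ((t, ρ), θ)) τ) MeasureTheory.volume 0 Real.pi) ∧
    (dRho ρ₀ (fieldMode j m Ψ k) (τ, ρ) = (∫ θ in (0 : ℝ)..Real.pi, modeWeight j m k θ *
      deriv (fun r => fourierMode m (Ψ k) ((τ, r), θ)) ρ) ∧
    IntervalIntegrable (fun θ => modeWeight j m k θ *
      deriv (fun r => fourierMode m (Ψ k) ((τ, r), θ)) ρ) MeasureTheory.volume 0 Real.pi) := by
  have hρ' := Ioo_subset_Ico_self hρ
  have hc := h.contDiffOn_fieldMode j m k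
  have h1 := hasDerivAt_weightedIntegral (contDiff_modeWeight j m k)
    (contDiffOn_fourierMode m (h.smooth k)) Real.pi_pos (a := -1) (b := 1)
    (γ := fun t => (t, ρ)) (by fun_prop) (fun t ht => ⟨ht, hρ'⟩) hτ
  have h2 := hasDerivAt_weightedIntegral (contDiff_modeWeight j m k)
    (contDiffOn_fourierMode m (h.smooth k)) Real.pi_pos (a := 0) (b := ρ₀)
    (γ := fun r => (τ, r)) (by fun_prop) (fun r hr => ⟨hτ, Ioo_subset_Ico_self hr⟩) hρ
  exact ⟨⟨(hasDerivAt_tau hc hτ hρ').unique h1.1, h1.2⟩, ⟨(hasDerivAt_rho hc hτ hρ).unique h2.1,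
    h2.2⟩⟩

/-- The projection of a Maxwell field on a harmonic of degree `j` solves the mode equations. -/
theorem ExtendedField.modeSystem (h : ExtendedField ρ₀ φ Ψ) (j : ℕ) (m : ℤ) :
    ModeSystem ρ₀ (j * (j + 1)) 0 (fieldMode j m Ψ) := by
  refine ModeSystem.of_pos (h.contDiffOn_fieldMode j m) fun τ hτ ρ hρ => ?_
  have hρ' := Ioo_subset_Ico_self hρ
  set H : Fin 3 → (ℝ × ℝ) × ℝ → ℂ := fun k => fourierMode m (Ψ k) with hHdef
  have heq := fun θ hθ => h.fourier_equations m hτ hρ (θ := θ) hθ (H := H) fun k => rfl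
  have hsm : ∀ k, ContDiff ℝ ∞ (fun θ => H k ((τ, ρ), θ)) := fun k => by
    rw [← contDiffOn_univ]
    exact (contDiffOn_fourierMode m (h.smooth k)).comp (by fun_prop)
      fun θ _ => ⟨⟨hτ, hρ'⟩, mem_univ _⟩
  have hd := fun k => h.fieldMode_derivs j m k hτ hρ
  have hi : ∀ k, IntervalIntegrable (fun θ => modeWeight j m k θ * H k ((τ, ρ), θ))
      MeasureTheory.volume 0 Real.pi := fun k =>
    ((contDiff_modeWeight j m k).mul (hsm k)).continuous.intervalIntegrable _ _
  have hb : ∀ k, fieldMode j m Ψ k (τ, ρ) =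
    ∫ θ in (0 : ℝ)..Real.pi, modeWeight j m k θ * H k ((τ, ρ), θ) := fun k => rfl
  -- the three integrations by parts
  have p0 : ∫ θ in (0 : ℝ)..Real.pi, modeWeight j m 0 θ *
      (deriv (fun x => H 1 ((τ, ρ), x)) θ - m * H 1 ((τ, ρ), θ) / Real.sin θ) =
      -((j * (j + 1)) * fieldMode j m Ψ 1 (τ, ρ)) := by
    have := (integral_spinFactor_mul j (-m) (hsm 1)).2
    rw [Int.natAbs_neg] at this
    rw [hb 1, ← neg_eq_iff_eq_neg, ← intervalIntegral.integral_neg]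
    refine Eq.trans ?_ this
    congr 1
    funext θ
    simp only [modeWeight, Matrix.cons_val_zero]
    push_cast
    ring
  have i0 : IntervalIntegrable (fun θ => modeWeight j m 0 θ *
      (deriv (fun x => H 1 ((τ, ρ), x)) θ - m * H 1 ((τ, ρ), θ) / Real.sin θ))
      MeasureTheory.volume 0 Real.pi := by
    have := (integral_spinFactor_mul j (-m) (hsm 1)).1
    rw [Int.natAbs_neg] at this
    refine intervalIntegrable_congr_Ioo Real.pi_pos.le (fun θ _ => ?_) this.neg
    simp only [modeWeight, Matrix.cons_val_zero, Pi.neg_apply]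
    push_cast
    ring
  have p2 : ∫ θ in (0 : ℝ)..Real.pi, modeWeight j m 2 θ *
      (deriv (fun x => H 1 ((τ, ρ), x)) θ + m * H 1 ((τ, ρ), θ) / Real.sin θ) =
      (j * (j + 1)) * fieldMode j m Ψ 1 (τ, ρ) := (integral_spinFactor_mul j m (hsm 1)).2
  have i2 : IntervalIntegrable (fun θ => modeWeight j m 2 θ *
      (deriv (fun x => H 1 ((τ, ρ), x)) θ + m * H 1 ((τ, ρ), θ) / Real.sin θ))
      MeasureTheory.volume 0 Real.pi := (integral_spinFactor_mul j m (hsm 1)).1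
  have p12 : ∫ θ in (0 : ℝ)..Real.pi, modeWeight j m 1 θ *
      (deriv (fun x => H 2 ((τ, ρ), x)) θ - m * H 2 ((τ, ρ), θ) / Real.sin θ
        + varpi θ * H 2 ((τ, ρ), θ)) = -fieldMode j m Ψ 2 (τ, ρ) :=
    (integral_sin_legendreFactor_mul j m.natAbs m (hsm 2)).2
  have i12 : IntervalIntegrable (fun θ => modeWeight j m 1 θ *
      (deriv (fun x => H 2 ((τ, ρ), x)) θ - m * H 2 ((τ, ρ), θ) / Real.sin θ
        + varpi θ * H 2 ((τ, ρ), θ))) MeasureTheory.volume 0 Real.pi :=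
    (integral_sin_legendreFactor_mul j m.natAbs m (hsm 2)).1
  have e10 : ∀ θ : ℝ, modeWeight j m 1 θ *
      (deriv (fun x => H 0 ((τ, ρ), x)) θ + m * H 0 ((τ, ρ), θ) / Real.sin θ
        + varpi θ * H 0 ((τ, ρ), θ)) = ((Real.sin θ * legendreFactor j m.natAbs θ : ℝ) : ℂ) *
      (deriv (fun x => H 0 ((τ, ρ), x)) θ - (-m : ℤ) * H 0 ((τ, ρ), θ) / Real.sin θ
        + varpi θ * H 0 ((τ, ρ), θ)) := fun θ => by
    simp only [modeWeight, Matrix.cons_val_one, Matrix.cons_val_zero]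
    push_cast
    ring
  have p10 : ∫ θ in (0 : ℝ)..Real.pi, modeWeight j m 1 θ *
      (deriv (fun x => H 0 ((τ, ρ), x)) θ + m * H 0 ((τ, ρ), θ) / Real.sin θ
        + varpi θ * H 0 ((τ, ρ), θ)) = fieldMode j m Ψ 0 (τ, ρ) := by
    simp only [e10]
    rw [(integral_sin_legendreFactor_mul j m.natAbs (-m) (hsm 0)).2, hb 0,
      ← intervalIntegral.integral_neg]
    congr 1
    funext θ
    simp only [modeWeight, Matrix.cons_val_zero]
    ring
  have i10 : IntervalIntegrable (fun θ => modeWeight j m 1 θ *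
      (deriv (fun x => H 0 ((τ, ρ), x)) θ + m * H 0 ((τ, ρ), θ) / Real.sin θ
        + varpi θ * H 0 ((τ, ρ), θ))) MeasureTheory.volume 0 Real.pi := by
    simp only [e10]
    exact (integral_sin_legendreFactor_mul j m.natAbs (-m) (hsm 0)).1
  have hπ := Real.pi_pos.le
  refine ⟨?_, ?_, ?_, ?_⟩
  · have key := sum_integral_eq_zero hπ (modeWeight j m 0) ![1 + τ, -ρ, -1, 1]
      ![fun θ => deriv (fun t => H 0 ((t, ρ), θ)) τ, fun θ => deriv (fun r => H 0 ((τ, r), θ)) ρ,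
        fun θ => deriv (fun x => H 1 ((τ, ρ), x)) θ - m * H 1 ((τ, ρ), θ) / Real.sin θ,
        fun θ => H 0 ((τ, ρ), θ)] ?_ ?_
    · simp only [Fin.sum_univ_succ, Fin.sum_univ_zero, Matrix.cons_val_zero, Matrix.cons_val_succ,
        p0] at key
      simp only [hHdef, ← (hd 0).1.1, ← (hd 0).2.1] at key
      rw [hb 0]
      push_cast
      linear_combination key
    · intro i
      fin_cases i
      exacts [(hd 0).1.2, (hd 0).2.2, i0, hi 0]
    · intro θ hθ
      simp only [Fin.sum_univ_succ, Fin.sum_univ_zero, Matrix.cons_val_zero, Matrix.cons_val_succ]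
      linear_combination (heq θ hθ).1
  · have key := sum_integral_eq_zero hπ (modeWeight j m 1) ![1, -(1 / 2), -(1 / 2)]
      ![fun θ => deriv (fun t => H 1 ((t, ρ), θ)) τ,
        fun θ => deriv (fun x => H 2 ((τ, ρ), x)) θ - m * H 2 ((τ, ρ), θ) / Real.sin θ
          + varpi θ * H 2 ((τ, ρ), θ),
        fun θ => deriv (fun x => H 0 ((τ, ρ), x)) θ + m * H 0 ((τ, ρ), θ) / Real.sin θ
          + varpi θ * H 0 ((τ, ρ), θ)] ?_ ?_
    · simp only [Fin.sum_univ_succ, Fin.sum_univ_zero, Matrix.cons_val_zero, Matrix.cons_val_succ,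
        p12, p10] at key
      simp only [hHdef, ← (hd 1).1.1] at key
      linear_combination key
    · intro i
      fin_cases i
      exacts [(hd 1).1.2, i12, i10]
    · intro θ hθ
      simp only [Fin.sum_univ_succ, Fin.sum_univ_zero, Matrix.cons_val_zero, Matrix.cons_val_succ]
      linear_combination (heq θ hθ).2.1
  · have key := sum_integral_eq_zero hπ (modeWeight j m 2) ![1 - τ, ρ, -1, -1]
      ![fun θ => deriv (fun t => H 2 ((t, ρ), θ)) τ, fun θ => deriv (fun r => H 2 ((τ, r), θ)) ρ,
        fun θ => deriv (fun x => H 1 ((τ, ρ), x)) θ + m * H 1 ((τ, ρ), θ) / Real.sin θ,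
        fun θ => H 2 ((τ, ρ), θ)] ?_ ?_
    · simp only [Fin.sum_univ_succ, Fin.sum_univ_zero, Matrix.cons_val_zero, Matrix.cons_val_succ,
        p2] at key
      simp only [hHdef, ← (hd 2).1.1, ← (hd 2).2.1] at key
      rw [hb 2]
      push_cast
      linear_combination key
    · intro i
      fin_cases i
      exacts [(hd 2).1.2, (hd 2).2.2, i2, hi 2]
    · intro θ hθ
      simp only [Fin.sum_univ_succ, Fin.sum_univ_zero, Matrix.cons_val_zero, Matrix.cons_val_succ]
      linear_combination (heq θ hθ).2.2.1
  · have key := sum_integral_eq_zero hπ (modeWeight j m 1) ![τ, -ρ, -(1 / 2), 1 / 2]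
      ![fun θ => deriv (fun t => H 1 ((t, ρ), θ)) τ, fun θ => deriv (fun r => H 1 ((τ, r), θ)) ρ,
        fun θ => deriv (fun x => H 2 ((τ, ρ), x)) θ - m * H 2 ((τ, ρ), θ) / Real.sin θ
          + varpi θ * H 2 ((τ, ρ), θ),
        fun θ => deriv (fun x => H 0 ((τ, ρ), x)) θ + m * H 0 ((τ, ρ), θ) / Real.sin θ
          + varpi θ * H 0 ((τ, ρ), θ)] ?_ ?_
    · simp only [Fin.sum_univ_succ, Fin.sum_univ_zero, Matrix.cons_val_zero, Matrix.cons_val_succ,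
        p12, p10] at key
      simp only [hHdef, ← (hd 1).1.1, ← (hd 1).2.1] at key
      push_cast
      linear_combination key
    · intro i
      fin_cases i
      exacts [(hd 1).1.2, (hd 1).2.2, i12, i10]
    · intro θ hθ
      simp only [Fin.sum_univ_succ, Fin.sum_univ_zero, Matrix.cons_val_zero, Matrix.cons_val_succ]
      linear_combination (heq θ hθ).2.2.2

/-- The Taylor coefficients of the modes in terms of the expansion coefficients. -/
theorem ExtendedField.iteratedDerivWithin_fieldMode (h : ExtendedField ρ₀ φ Ψ) (hρ₀ : 0 < ρ₀)
    {σ : ℕ} {a : Fin 3 → ℕ → ℕ → ℤ → ℝ → ℂ} (ha : HasExpansion σ ρ₀ φ a) (j : ℕ) (m : ℤ) (q : ℕ)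
    {τ : ℝ} (hτ : τ ∈ Ioo (-1 : ℝ) 1) :
    iteratedDerivWithin q (fun r => fieldMode j m Ψ 2 (τ, r)) (Ico 0 ρ₀) 0 =
      ∑ ℓ ∈ Finset.Icc 1 q, ∑ m' ∈ Finset.Icc (-(ℓ : ℤ)) ℓ,
        a 2 q ℓ m' τ * modeProj j m (swsh (-1) ((ℓ : ℤ) - σ) m') := by
  have h0 : (0 : ℝ) ∈ Ico 0 ρ₀ := ⟨le_rfl, hρ₀⟩
  have e1 := iteratedDerivWithin_weightedIntegral (contDiff_modeWeight j m 2)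
    (contDiffOn_fourierMode m (h.smooth 2)) Real.pi_pos (convex_Ico 0 ρ₀) (uniqueDiffOn_Ico 0 ρ₀)
    (γ := fun r => (τ, r)) (by fun_prop) (fun r hr => ⟨hτ, hr⟩) q h0
  have e2 := fun θ : ℝ => iteratedDerivWithin_weightedIntegral (contDiff_fourierFactor m)
    (h.smooth 2) Real.two_pi_pos (convex_Ico 0 ρ₀) (uniqueDiffOn_Ico 0 ρ₀)
    (γ := fun r => ((τ, r), θ)) (by fun_prop) (fun r hr => ⟨⟨hτ, hr⟩, mem_univ _⟩) q h0
  have e3 : ∀ θ ∈ Ioo 0 Real.pi, ∀ ϕ : ℝ,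
      iteratedDerivWithin q (fun r => Ψ 2 (((τ, r), θ), ϕ)) (Ico 0 ρ₀) 0 =
      ∑ i ∈ (Finset.Icc 1 q).sigma (fun ℓ => Finset.Icc (-(ℓ : ℤ)) ℓ),
        a 2 q i.1 i.2 τ * swsh (-1) ((i.1 : ℤ) - σ) i.2 θ ϕ := fun θ hθ ϕ => by
    rw [Finset.sum_sigma, ← iteratedDerivWithin_congr
      (fun r hr => h.eq 2 τ hτ r hr θ hθ ϕ) h0, ha 2 q τ hτ θ hθ ϕ]
    rfl
  refine e1.trans ?_
  rw [Finset.sum_sigma' (f := fun ℓ m' => a 2 q ℓ m' τ *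
    modeProj j m (swsh (-1) ((ℓ : ℤ) - σ) m')), ← modeProj_sum]
  refine integral_congr_Ioo Real.pi_pos.le fun θ hθ => ?_
  have e4 := e2 θ
  simp only [e3 θ hθ] at e4
  exact congrArg _ e4

/-- Below the order `ℓ` the mode of degree `ℓ - σ` vanishes at `ρ = 0`. -/
theorem ExtendedField.iteratedDerivWithin_fieldMode_eq_zero (h : ExtendedField ρ₀ φ Ψ)
    (hρ₀ : 0 < ρ₀) {σ : ℕ} {a : Fin 3 → ℕ → ℕ → ℤ → ℝ → ℂ} (ha : HasExpansion σ ρ₀ φ a) {p j : ℕ}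
    (hj : p = j + σ) (m : ℤ) {q : ℕ} (hq : q < p) {τ : ℝ} (hτ : τ ∈ Ioo (-1 : ℝ) 1) :
    iteratedDerivWithin q (fun r => fieldMode j m Ψ 2 (τ, r)) (Ico 0 ρ₀) 0 = 0 := by
  rw [h.iteratedDerivWithin_fieldMode hρ₀ ha j m q hτ]
  refine Finset.sum_eq_zero fun ℓ hℓ => Finset.sum_eq_zero fun m' _ => ?_
  rw [modeProj_swsh_eq_zero (Or.inl ?_), mul_zero]
  have := (Finset.mem_Icc.1 hℓ).2
  omega

theorem ExtendedField.iteratedDerivWithin_fieldMode_top (h : ExtendedField ρ₀ φ Ψ)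
    (hρ₀ : 0 < ρ₀) {σ : ℕ} {a : Fin 3 → ℕ → ℕ → ℤ → ℝ → ℂ} (ha : HasExpansion σ ρ₀ φ a) {p j : ℕ}
    (hj : p = j + σ) (hp : 1 ≤ p) {m : ℤ} (hm : |m| ≤ p) {τ : ℝ} (hτ : τ ∈ Ioo (-1 : ℝ) 1) :
    iteratedDerivWithin p (fun r => fieldMode j m Ψ 2 (τ, r)) (Ico 0 ρ₀) 0 =
      a 2 p p m τ * modeProj j m (swsh (-1) j m) := by
  rw [h.iteratedDerivWithin_fieldMode hρ₀ ha j m p hτ,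
    Finset.sum_eq_single_of_mem p (Finset.mem_Icc.2 ⟨hp, le_rfl⟩),
    Finset.sum_eq_single_of_mem m (Finset.mem_Icc.2 (abs_le.1 hm))]
  · rw [show (p : ℤ) - σ = j by omega]
  · intro m' _ hm'
    rw [modeProj_swsh_eq_zero (Or.inr hm'), mul_zero]
  · intro ℓ hℓ hne
    refine Finset.sum_eq_zero fun m' _ => ?_
    rw [modeProj_swsh_eq_zero (Or.inl (by omega)), mul_zero]

end

section

/-! ### The Newman-Penrose integrals -/

variable {ρ₀ : ℝ}

theorem npDeriv_congr {f g : ℝ → ℝ → ℂ}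
    (h : ∀ τ ∈ Ioo (-1 : ℝ) 1, ∀ ρ ∈ Ioo 0 ρ₀, f τ ρ = g τ ρ) :
    ∀ τ ∈ Ioo (-1 : ℝ) 1, ∀ ρ ∈ Ioo 0 ρ₀, npDeriv f τ ρ = npDeriv g τ ρ := by
  intro τ hτ ρ hρ
  have e1 : deriv (fun t => f t ρ) τ = deriv (fun t => g t ρ) τ := by
    refine EventuallyEq.deriv_eq ?_
    filter_upwards [isOpen_Ioo.mem_nhds hτ] with t ht using h t ht ρ hρ
  have e2 : deriv (fun r => f τ r) ρ = deriv (fun r => g τ r) ρ := by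
    refine EventuallyEq.deriv_eq ?_
    filter_upwards [isOpen_Ioo.mem_nhds hρ] with r hr using h τ hτ r hr
  simp only [npDeriv, e1, e2]

theorem npDeriv_iterate_congr (i : ℕ) {f g : ℝ → ℝ → ℂ}
    (h : ∀ τ ∈ Ioo (-1 : ℝ) 1, ∀ ρ ∈ Ioo 0 ρ₀, f τ ρ = g τ ρ) :
    ∀ τ ∈ Ioo (-1 : ℝ) 1, ∀ ρ ∈ Ioo 0 ρ₀, npDeriv^[i] f τ ρ = npDeriv^[i] g τ ρ := by
  induction i generalizing f g with
  | zero => exact h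
  | succ i ih => exact ih (npDeriv_congr h)

theorem npDeriv_const_mul (c : ℂ) (f : ℝ → ℝ → ℂ) :
    npDeriv (fun t r => c * f t r) = fun t r => c * npDeriv f t r := by
  funext τ ρ
  simp only [npDeriv, deriv_const_mul_field]
  ring

theorem npDeriv_iterate_const_mul (i : ℕ) (c : ℂ) (f : ℝ → ℝ → ℂ) :
    npDeriv^[i] (fun t r => c * f t r) = fun t r => c * npDeriv^[i] f t r := by
  induction i generalizing f with
  | zero => rfl
  | succ i ih => rw [Function.iterate_succ_apply, npDeriv_const_mul, ih, Function.iterate_succ_apply]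

/-- The part `ρ > 0` of the strip. -/
def openStrip (ρ₀ : ℝ) : Set (ℝ × ℝ) := Ioo (-1) 1 ×ˢ Ioo 0 ρ₀

theorem openStrip_subset : openStrip ρ₀ ⊆ strip ρ₀ := prod_mono_right Ioo_subset_Ico_self

theorem contDiffOn_npWeight : ContDiffOn ℝ ∞
    (fun x : ℝ × ℝ => ((x.2 * (1 + x.1) ^ 2 : ℝ) : ℂ)⁻¹) (openStrip ρ₀) := by
  refine ContDiffOn.inv ?_ ?_
  · exact (Complex.ofRealCLM.contDiff.comp
      (contDiff_snd.mul ((contDiff_const.add contDiff_fst).pow 2))).contDiffOn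
  · rintro ⟨τ, ρ⟩ ⟨hτ, hρ⟩
    have h1 : (0 : ℝ) < 1 + τ := by linarith [hτ.1]
    have h2 : (0 : ℝ) < ρ := hρ.1
    exact_mod_cast (mul_pos h2 (pow_pos h1 2)).ne'

theorem contDiffOn_npDeriv {g : (ℝ × ℝ) × ℝ → ℂ}
    (hg : ContDiffOn ℝ ∞ g (openStrip ρ₀ ×ˢ univ)) :
    ContDiffOn ℝ ∞ (fun z : (ℝ × ℝ) × ℝ => npDeriv (fun t r => g ((t, r), z.2)) z.1.1 z.1.2)
      (openStrip ρ₀ ×ˢ univ) := by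
  have ho : IsOpen (openStrip ρ₀ ×ˢ (univ : Set ℝ)) :=
    (isOpen_Ioo.prod isOpen_Ioo).prod isOpen_univ
  have hd := hg.fderiv_of_isOpen (m := ∞) ho (by simp)
  have hfst : ContDiffOn ℝ ∞ (fun z : (ℝ × ℝ) × ℝ => z.1) (openStrip ρ₀ ×ˢ univ) :=
    contDiff_fst.contDiffOn
  have h1 : ContDiffOn ℝ ∞ (fun z : (ℝ × ℝ) × ℝ => fderiv ℝ g z ((1, 0), 0))
    (openStrip ρ₀ ×ˢ univ) := hd.clm_apply contDiffOn_const
  have h2 : ContDiffOn ℝ ∞ (fun z : (ℝ × ℝ) × ℝ => fderiv ℝ g z ((0, 1), 0))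
    (openStrip ρ₀ ×ˢ univ) := hd.clm_apply contDiffOn_const
  have hw : ContDiffOn ℝ ∞ (fun z : (ℝ × ℝ) × ℝ => ((z.1.2 * (1 + z.1.1) ^ 2 : ℝ) : ℂ)⁻¹)
      (openStrip ρ₀ ×ˢ univ) := contDiffOn_npWeight.comp hfst fun z hz => hz.1
  have hτ : ContDiffOn ℝ ∞ (fun z : (ℝ × ℝ) × ℝ => (z.1.1 : ℂ)) (openStrip ρ₀ ×ˢ univ) :=
    (Complex.ofRealCLM.contDiff.comp (contDiff_fst.comp contDiff_fst)).contDiffOn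
  have hρ : ContDiffOn ℝ ∞ (fun z : (ℝ × ℝ) × ℝ => (z.1.2 : ℂ)) (openStrip ρ₀ ×ˢ univ) :=
    (Complex.ofRealCLM.contDiff.comp (contDiff_snd.comp contDiff_fst)).contDiffOn
  refine ((contDiffOn_const (c := ((Real.sqrt 2 / 2 : ℝ) : ℂ))).mul hw |>.mul
    ((((contDiffOn_const (c := (1 : ℂ))).add hτ).neg.mul h1).add (hρ.mul h2))).congr ?_
  rintro ⟨⟨τ, ρ⟩, t⟩ hz
  have hda := ((hg.differentiableOn (by simp)).differentiableAt (ho.mem_nhds hz)).hasFDerivAt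
  have d1 : HasDerivAt (fun s => g ((s, ρ), t)) (fderiv ℝ g ((τ, ρ), t) ((1, 0), 0)) τ :=
    hda.comp_hasDerivAt τ (((hasDerivAt_id τ).prodMk (hasDerivAt_const τ ρ)).prodMk
      (hasDerivAt_const τ t))
  have d2 : HasDerivAt (fun s => g ((τ, s), t)) (fderiv ℝ g ((τ, ρ), t) ((0, 1), 0)) ρ :=
    hda.comp_hasDerivAt ρ (((hasDerivAt_const ρ τ).prodMk (hasDerivAt_id ρ)).prodMk
      (hasDerivAt_const ρ t))
  simp only [npDeriv, d1.deriv, d2.deriv]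
  push_cast
  ring

theorem npDeriv_weightedIntegral {w : ℝ → ℂ} (hw : ContDiff ℝ ∞ w) {g : (ℝ × ℝ) × ℝ → ℂ}
    (hg : ContDiffOn ℝ ∞ g (openStrip ρ₀ ×ˢ univ)) {c d : ℝ} (hcd : c < d) :
    ∀ τ ∈ Ioo (-1 : ℝ) 1, ∀ ρ ∈ Ioo 0 ρ₀,
      npDeriv (fun t r => ∫ s in c..d, w s * g ((t, r), s)) τ ρ =
        ∫ s in c..d, w s * npDeriv (fun t r => g ((t, r), s)) τ ρ := by
  intro τ hτ ρ hρ
  have h1 := hasDerivAt_weightedIntegral hw hg hcd (a := -1) (b := 1) (γ := fun t => (t, ρ))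
    (by fun_prop) (fun t ht => ⟨ht, hρ⟩) hτ
  have h2 := hasDerivAt_weightedIntegral hw hg hcd (a := 0) (b := ρ₀) (γ := fun r => (τ, r))
    (by fun_prop) (fun r hr => ⟨hτ, hr⟩) hρ
  simp only [npDeriv, h1.1.deriv, h2.1.deriv]
  rw [← intervalIntegral.integral_const_mul, ← intervalIntegral.integral_const_mul,
    ← intervalIntegral.integral_add (h1.2.const_mul _) (h2.2.const_mul _),
    ← intervalIntegral.integral_const_mul]
  congr 1
  funext s
  ring

/-- The iterated frame derivative commutes with integration over the angles. -/
theorem npDeriv_iterate_weightedIntegral {w : ℝ → ℂ} (hw : ContDiff ℝ ∞ w) {c d : ℝ} (hcd : c < d)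
    (i : ℕ) {g : (ℝ × ℝ) × ℝ → ℂ} (hg : ContDiffOn ℝ ∞ g (openStrip ρ₀ ×ˢ univ)) :
    ∀ τ ∈ Ioo (-1 : ℝ) 1, ∀ ρ ∈ Ioo 0 ρ₀,
      npDeriv^[i] (fun t r => ∫ s in c..d, w s * g ((t, r), s)) τ ρ =
        ∫ s in c..d, w s * npDeriv^[i] (fun t r => g ((t, r), s)) τ ρ := by
  induction i generalizing g with
  | zero => exact fun τ _ ρ _ => rfl
  | succ i ih =>
    intro τ hτ ρ hρ
    simp only [Function.iterate_succ_apply]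
    rw [npDeriv_iterate_congr i (npDeriv_weightedIntegral hw hg hcd) τ hτ ρ hρ]
    exact ih (contDiffOn_npDeriv hg) τ hτ ρ hρ

variable {φ : Fin 3 → ℝ → ℝ → ℝ → ℝ → ℂ} {Ψ : Fin 3 → ((ℝ × ℝ) × ℝ) × ℝ → ℂ}

theorem sin_mul_conj_swsh {j : ℕ} (hj : j ≠ 0) (m : ℤ) {θ : ℝ} (hθ : θ ∈ Ioo 0 Real.pi) (ϕ : ℝ) :
    (starRingEnd ℂ) (swsh (-1) j m θ ϕ) * Real.sin θ =
      ((harmNorm j m / Real.sqrt ((j : ℝ) * ((j : ℝ) + 1)) : ℝ) : ℂ) *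
        spinFactor j m.natAbs m θ * fourierFactor m ϕ := by
  have e1 : (starRingEnd ℂ) (spinFactor j m.natAbs m θ) = spinFactor j m.natAbs m θ :=
    Complex.conj_ofReal _
  rw [spinFactor_eq_sin_mul j m hθ, map_mul, Complex.conj_ofReal] at e1
  rw [swsh_neg_one_eq j hj, spinFactor_eq_sin_mul j m hθ, ← e1, map_mul, map_mul,
    Complex.conj_ofReal, ← Complex.exp_conj, fourierFactor]
  simp only [map_mul, Complex.conj_I, Complex.conj_ofReal, map_intCast]
  rw [neg_mul Complex.I (m : ℂ)]
  ring

/-- The Newman-Penrose integral is an iterated frame derivative of the corresponding mode. -/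
theorem ExtendedField.npIntegral_eq (h : ExtendedField ρ₀ φ Ψ) (n : ℕ) {j : ℕ} (hj : j ≠ 0) (m : ℤ)
    {τ ρ : ℝ} (hτ : τ ∈ Ioo (-1 : ℝ) 1) (hρ : ρ ∈ Ioo 0 ρ₀) :
    npIntegral φ n j m τ ρ =
      (((-1) ^ (n + 1) / (((n + 1).factorial : ℝ) * Real.sqrt 2 ^ (n + 1)) : ℝ) : ℂ) *
      (((harmNorm j m / Real.sqrt ((j : ℝ) * ((j : ℝ) + 1)) : ℝ) : ℂ) *
      npDeriv^[n + 1] (fun t r => ((r * (1 + t) ^ 2 : ℝ) : ℂ)⁻¹ * fieldMode j m Ψ 2 (t, r)) τ ρ) := by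
  have hψ : ∀ θ, ContDiffOn ℝ ∞ (fun z : (ℝ × ℝ) × ℝ =>
      ((z.1.2 * (1 + z.1.1) ^ 2 : ℝ) : ℂ)⁻¹ * Ψ 2 ((z.1, θ), z.2)) (openStrip ρ₀ ×ˢ univ) := by
    intro θ
    refine (contDiffOn_npWeight.comp contDiff_fst.contDiffOn fun z hz => hz.1).mul ?_
    exact (h.smooth 2).comp (f := fun z : (ℝ × ℝ) × ℝ => ((z.1, θ), z.2))
      (by fun_prop) fun z hz => ⟨⟨openStrip_subset hz.1, mem_univ _⟩, mem_univ _⟩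
  have hH : ContDiffOn ℝ ∞ (fun z : (ℝ × ℝ) × ℝ =>
      ((z.1.2 * (1 + z.1.1) ^ 2 : ℝ) : ℂ)⁻¹ * fourierMode m (Ψ 2) z) (openStrip ρ₀ ×ˢ univ) := by
    refine (contDiffOn_npWeight.comp contDiff_fst.contDiffOn fun z hz => hz.1).mul ?_
    exact (contDiffOn_fourierMode m (h.smooth 2)).mono (prod_mono_left openStrip_subset)
  have e1 : ∀ θ : ℝ, npDeriv^[n + 1] (fun t r =>
        ((r * (1 + t) ^ 2 : ℝ) : ℂ)⁻¹ * fourierMode m (Ψ 2) ((t, r), θ)) τ ρ =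
      ∫ ϕ in (0 : ℝ)..(2 * Real.pi), fourierFactor m ϕ * npDeriv^[n + 1] (fun t r =>
        ((r * (1 + t) ^ 2 : ℝ) : ℂ)⁻¹ * Ψ 2 (((t, r), θ), ϕ)) τ ρ := by
    intro θ
    rw [← npDeriv_iterate_weightedIntegral (contDiff_fourierFactor m) Real.two_pi_pos (n + 1)
      (hψ θ) τ hτ ρ hρ]
    refine congrArg (fun f => npDeriv^[n + 1] f τ ρ) (funext fun t => funext fun r => ?_)
    rw [fourierMode, ← intervalIntegral.integral_const_mul]
    congr 1
    funext ϕ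
    ring
  have e2 : npDeriv^[n + 1] (fun t r =>
        ((r * (1 + t) ^ 2 : ℝ) : ℂ)⁻¹ * fieldMode j m Ψ 2 (t, r)) τ ρ =
      ∫ θ in (0 : ℝ)..Real.pi, spinFactor j m.natAbs m θ * npDeriv^[n + 1] (fun t r =>
        ((r * (1 + t) ^ 2 : ℝ) : ℂ)⁻¹ * fourierMode m (Ψ 2) ((t, r), θ)) τ ρ := by
    rw [← npDeriv_iterate_weightedIntegral (contDiff_spinFactor j m.natAbs m) Real.pi_pos (n + 1)
      hH τ hτ ρ hρ]
    refine congrArg (fun f => npDeriv^[n + 1] f τ ρ) (funext fun t => funext fun r => ?_)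
    rw [fieldMode, ← intervalIntegral.integral_const_mul]
    congr 1
    funext θ
    change _ * (spinFactor j m.natAbs m θ * _) = _
    ring
  rw [npIntegral, sphereIntegral, e2]
  congr 1
  rw [← intervalIntegral.integral_const_mul]
  refine integral_congr_Ioo Real.pi_pos.le fun θ hθ => ?_
  rw [e1 θ, ← intervalIntegral.integral_const_mul, ← intervalIntegral.integral_const_mul]
  congr 1
  funext ϕ
  have e3 : npDeriv^[n + 1] (fun t r => npPhi2 φ t r θ ϕ) τ ρ = npDeriv^[n + 1] (fun t r =>
        ((r * (1 + t) ^ 2 : ℝ) : ℂ)⁻¹ * Ψ 2 (((t, r), θ), ϕ)) τ ρ := by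
    refine npDeriv_iterate_congr (n + 1) (fun t ht r hr => ?_) τ hτ ρ hρ
    rw [npPhi2, h.eq 2 t ht r (Ioo_subset_Ico_self hr) θ hθ ϕ, div_eq_inv_mul]
  rw [e3]
  linear_combination (npDeriv^[n + 1] (fun t r =>
        ((r * (1 + t) ^ 2 : ℝ) : ℂ)⁻¹ * Ψ 2 (((t, r), θ), ϕ)) τ ρ) * sin_mul_conj_swsh hj m hθ ϕ

/-- The action of the frame derivative on the factor `M` of a product `(ρ (1 + τ)) ^ q * M`: the
function `ρ (1 + τ)` is constant along the frame vector. -/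
def npStep (ρ₀ : ℝ) (M : ℝ × ℝ → ℂ) (x : ℝ × ℝ) : ℂ :=
  -dTau ρ₀ M x + x.2 * (1 + x.1 : ℂ)⁻¹ * dRho ρ₀ M x

theorem contDiffOn_npStep {M : ℝ × ℝ → ℂ} (hM : ContDiffOn ℝ ∞ M (strip ρ₀)) :
    ContDiffOn ℝ ∞ (npStep ρ₀ M) (strip ρ₀) := by
  have hτ : ContDiffOn ℝ ∞ (fun x : ℝ × ℝ => (1 + x.1 : ℂ)) (strip ρ₀) :=
    (contDiff_const.add (Complex.ofRealCLM.contDiff.comp contDiff_fst)).contDiffOn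
  have hρ : ContDiffOn ℝ ∞ (fun x : ℝ × ℝ => (x.2 : ℂ)) (strip ρ₀) :=
    (Complex.ofRealCLM.contDiff.comp contDiff_snd).contDiffOn
  exact (contDiffOn_dTau hM).neg.add ((hρ.mul (hτ.inv fun x hx => one_add_ne_zero hx.1)).mul
    (contDiffOn_dRho hM))

theorem contDiffOn_npStep_iterate {M : ℝ × ℝ → ℂ} (hM : ContDiffOn ℝ ∞ M (strip ρ₀)) (i : ℕ) :
    ContDiffOn ℝ ∞ ((npStep ρ₀)^[i] M) (strip ρ₀) := by
  induction i with
  | zero => exact hM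
  | succ i ih =>
    rw [Function.iterate_succ_apply']
    exact contDiffOn_npStep ih

theorem npDeriv_pow_mul {M : ℝ × ℝ → ℂ} (hM : ContDiffOn ℝ ∞ M (strip ρ₀)) (q : ℕ) :
    ∀ τ ∈ Ioo (-1 : ℝ) 1, ∀ ρ ∈ Ioo 0 ρ₀,
      npDeriv (fun t r => (r * (1 + t) : ℂ) ^ (q + 1) * M (t, r)) τ ρ =
        ((Real.sqrt 2 / 2 : ℝ) : ℂ) * ((ρ * (1 + τ) : ℂ) ^ q * npStep ρ₀ M (τ, ρ)) := by
  intro τ hτ ρ hρ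
  have hs := one_add_ne_zero hτ
  have hr : (ρ : ℂ) ≠ 0 := by exact_mod_cast hρ.1.ne'
  have d1 : deriv (fun t : ℝ => (ρ * (1 + t) : ℂ) ^ (q + 1) * M (t, ρ)) τ = _ :=
    (((((Complex.ofRealCLM.hasDerivAt (x := τ)).const_add 1).const_mul (ρ : ℂ)).pow (q + 1)).mul
      (hasDerivAt_tau hM hτ (Ioo_subset_Ico_self hρ))).deriv
  have d2 : deriv (fun r : ℝ => (r * (1 + τ) : ℂ) ^ (q + 1) * M (τ, r)) ρ = _ :=
    ((((Complex.ofRealCLM.hasDerivAt (x := ρ)).mul_const (1 + τ : ℂ)).pow (q + 1)).mul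
      (hasDerivAt_rho hM hτ hρ)).deriv
  simp only [npDeriv, d1, d2, npStep, Complex.ofRealCLM_apply, Pi.pow_apply, Nat.add_sub_cancel]
  push_cast
  rw [mul_pow, mul_pow]
  field_simp
  ring

theorem npDeriv_iterate_pow_mul (i : ℕ) {M : ℝ × ℝ → ℂ} (hM : ContDiffOn ℝ ∞ M (strip ρ₀)) :
    ∀ τ ∈ Ioo (-1 : ℝ) 1, ∀ ρ ∈ Ioo 0 ρ₀,
      npDeriv^[i] (fun t r => (r * (1 + t) : ℂ) ^ i * M (t, r)) τ ρ =
        ((Real.sqrt 2 / 2 : ℝ) : ℂ) ^ i * (npStep ρ₀)^[i] M (τ, ρ) := by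
  induction i generalizing M with
  | zero => simp
  | succ i ih =>
    intro τ hτ ρ hρ
    rw [Function.iterate_succ_apply, npDeriv_iterate_congr i (npDeriv_pow_mul hM i) τ hτ ρ hρ,
      npDeriv_iterate_const_mul, Function.iterate_succ_apply]
    dsimp only
    rw [ih (contDiffOn_npStep hM) τ hτ ρ hρ, pow_succ]
    ring

theorem npStep_iterate_zero (hρ₀ : 0 < ρ₀) {M : ℝ × ℝ → ℂ} (hM : ContDiffOn ℝ ∞ M (strip ρ₀))
    (i : ℕ) : ∀ τ ∈ Ioo (-1 : ℝ) 1,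
      (npStep ρ₀)^[i] M (τ, 0) = (-1) ^ i * iteratedDeriv i (fun t => M (t, 0)) τ := by
  induction i with
  | zero => simp
  | succ i ih =>
    intro τ hτ
    have hd := (hasDerivAt_tau (contDiffOn_npStep_iterate hM i) hτ ⟨le_rfl, hρ₀⟩).deriv
    rw [EventuallyEq.deriv_eq (f := fun t => (-1 : ℂ) ^ i * iteratedDeriv i (fun t => M (t, 0)) t)
      (by filter_upwards [isOpen_Ioo.mem_nhds hτ] with t ht using ih t ht),
      deriv_const_mul_field] at hd
    rw [Function.iterate_succ_apply', npStep, ← hd, iteratedDeriv_succ, pow_succ]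
    push_cast
    ring

/-- The limit `ρ → 0` of the Newman-Penrose integrals. -/
theorem ExtendedField.tendsto_npIntegral (h : ExtendedField ρ₀ φ Ψ) (hρ₀ : 0 < ρ₀) (n : ℕ) {j : ℕ}
    (hj : j ≠ 0) (m : ℤ) {R : ℝ × ℝ → ℂ} (hR : ContDiffOn ℝ ∞ R (strip ρ₀))
    (hbR : ∀ x ∈ strip ρ₀, fieldMode j m Ψ 2 x = (x.2 : ℂ) ^ (n + 2) * R x) {τ : ℝ}
    (hτ : τ ∈ Ioo (-1 : ℝ) 1) :
    Tendsto (npIntegral φ n j m τ) (𝓝[>] 0) (𝓝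
      ((((-1) ^ (n + 1) / (((n + 1).factorial : ℝ) * Real.sqrt 2 ^ (n + 1)) : ℝ) : ℂ) *
      (((harmNorm j m / Real.sqrt ((j : ℝ) * ((j : ℝ) + 1)) : ℝ) : ℂ) *
      (((Real.sqrt 2 / 2 : ℝ) : ℂ) ^ (n + 1) * ((-1) ^ (n + 1) *
        iteratedDeriv (n + 1) (npPotential (n + 2) fun t => R (t, 0)) τ))))) := by
  set M : ℝ × ℝ → ℂ := fun x => ((1 + x.1 : ℂ) ^ (n + 3))⁻¹ * R x with hMdef
  have hM : ContDiffOn ℝ ∞ M (strip ρ₀) := by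
    have hτ : ContDiffOn ℝ ∞ (fun x : ℝ × ℝ => (1 + x.1 : ℂ) ^ (n + 3)) (strip ρ₀) :=
      ((contDiff_const.add (Complex.ofRealCLM.contDiff.comp contDiff_fst)).pow _).contDiffOn
    exact (hτ.inv fun x hx => pow_ne_zero _ (one_add_ne_zero hx.1)).mul hR
  have hlim := tendsto_rho_zero (contDiffOn_npStep_iterate hM (n + 1)) hρ₀ hτ
  rw [npStep_iterate_zero hρ₀ hM (n + 1) τ hτ] at hlim
  refine (((hlim.const_mul _).const_mul _).const_mul _).congr' ?_
  filter_upwards [Ioo_mem_nhdsGT hρ₀] with ρ hρ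
  rw [h.npIntegral_eq n hj m hτ hρ, ← npDeriv_iterate_pow_mul (n + 1) hM τ hτ ρ hρ]
  congr 2
  refine npDeriv_iterate_congr (n + 1) (fun t ht r hr => ?_) τ hτ ρ hρ
  have hs := one_add_ne_zero ht
  have hr' : (r : ℂ) ≠ 0 := by exact_mod_cast hr.1.ne'
  rw [hbR _ ⟨ht, Ioo_subset_Ico_self hr⟩]
  simp only [hMdef]
  push_cast
  rw [mul_pow]
  field_simp
  ring

end

section

/-! ### The constants at past null infinity -/

/-- The constant relating the Newman-Penrose integrals at `ρ = 0` to the derivatives of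
`npPotential`. -/
def npConst (n j : ℕ) (m : ℤ) : ℂ :=
  (((-1) ^ (n + 1) / (((n + 1).factorial : ℝ) * Real.sqrt 2 ^ (n + 1)) : ℝ) : ℂ) *
    (((harmNorm j m / Real.sqrt ((j : ℝ) * ((j : ℝ) + 1)) : ℝ) : ℂ) *
    (((Real.sqrt 2 / 2 : ℝ) : ℂ) ^ (n + 1) * (-1) ^ (n + 1)))

theorem harmNorm_ne_zero (j : ℕ) (m : ℤ) : harmNorm j m ≠ 0 := by
  have : 0 < Real.sqrt ((2 * (j : ℝ) + 1) / (4 * Real.pi) *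
      (((j - m.natAbs).factorial : ℝ) / ((j + m.natAbs).factorial : ℝ))) := by
    have := Real.pi_pos
    positivity
  unfold harmNorm
  refine mul_ne_zero ?_ this.ne'
  split_ifs <;> simp

theorem npConst_ne_zero (n : ℕ) {j : ℕ} (hj : j ≠ 0) (m : ℤ) : npConst n j m ≠ 0 := by
  have h2 : Real.sqrt 2 ≠ 0 := by positivity
  have hj' : (0 : ℝ) < j := by exact_mod_cast Nat.pos_of_ne_zero hj
  have h3 : Real.sqrt ((j : ℝ) * ((j : ℝ) + 1)) ≠ 0 := by positivity
  have h4 : ((n + 1).factorial : ℝ) ≠ 0 := by positivity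
  refine mul_ne_zero ?_ (mul_ne_zero ?_ (mul_ne_zero (pow_ne_zero _ ?_) (by simp)))
  · exact Complex.ofReal_ne_zero.2
      (div_ne_zero (pow_ne_zero _ (by norm_num)) (mul_ne_zero h4 (pow_ne_zero _ h2)))
  · exact Complex.ofReal_ne_zero.2 (div_ne_zero (harmNorm_ne_zero j m) h3)
  · exact Complex.ofReal_ne_zero.2 (div_ne_zero h2 two_ne_zero)

variable {ρ₀ : ℝ} {φ : Fin 3 → ℝ → ℝ → ℝ → ℝ → ℂ}

/-- A finite Newman-Penrose constant is a limit at `τ = -1` of derivatives of `npPotential` for a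
solution of the transport equations, whose value at `τ = 0` is given by the initial datum. -/
theorem exists_transportSystem_of_isPastNPConstant (hρ₀ : 0 < ρ₀) (hφ : IsMaxwellField ρ₀ φ)
    {σ : ℕ} {a : Fin 3 → ℕ → ℕ → ℤ → ℝ → ℂ} (ha : HasExpansion σ ρ₀ φ a) {n j : ℕ}
    (hj : n + 2 = j + σ) (hj0 : j ≠ 0) {m : ℤ} (hm : |m| ≤ j) {F : ℂ}
    (hF : IsPastNPConstant φ n j m F) :
    ∃ B, TransportSystem (j * (j + 1)) (n + 2) B ∧
      B 2 0 = a 2 (n + 2) (n + 2) m 0 * modeProj j m (swsh (-1) j m) / (n + 2).factorial ∧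
      Tendsto (iteratedDeriv (n + 1) (npPotential (n + 2) (B 2))) (𝓝[>] (-1))
        (𝓝 ((npConst n j m)⁻¹ * F)) := by
  obtain ⟨Ψ, h⟩ := hφ.exists_extendedField
  have hL : (j * (j + 1) : ℂ) ≠ 0 :=
    mul_ne_zero (Nat.cast_ne_zero.2 hj0) (by exact_mod_cast Nat.succ_ne_zero j)
  obtain ⟨R, hR, hbR, htop⟩ := (h.modeSystem j m).exists_pow_div hL hρ₀ (n + 2)
    fun q hq τ hτ => h.iteratedDerivWithin_fieldMode_eq_zero hρ₀ ha hj m hq hτ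
  refine ⟨fun k τ => R k (τ, 0), hR.transportSystem hρ₀, ?_, ?_⟩
  · have h0 : (0 : ℝ) ∈ Ioo (-1 : ℝ) 1 := by constructor <;> norm_num
    have hm' : |m| ≤ ((n + 2 : ℕ) : ℤ) := by omega
    have e := h.iteratedDerivWithin_fieldMode_top hρ₀ ha hj (by omega) hm' h0
    rw [htop 0 h0] at e
    rw [← e, mul_div_cancel_left₀ _ (Nat.cast_ne_zero.2 (Nat.factorial_ne_zero _))]
  · obtain ⟨g, hg, hgF⟩ := hF
    refine (hgF.const_mul _).congr' ?_
    filter_upwards [hg, Ioo_mem_nhdsGT_neg_one] with τ hgτ hτ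
    rw [tendsto_nhds_unique hgτ
      (h.tendsto_npIntegral hρ₀ n hj0 m (hR.smooth 2) (fun x hx => hbR 2 x hx) hτ),
      inv_mul_eq_iff_eq_mul₀ (npConst_ne_zero n hj0 m), npConst]
    ring

end

end NPFlat

end

theorem mainTheorem4 (σ : ℕ) (hσ : σ ≤ 1) :
    ∃ Q : ℤ → ℕ → ℂ, ∀ (ρ₀ : ℝ) (φ : Fin 3 → ℝ → ℝ → ℝ → ℝ → ℂ)
      (a : Fin 3 → ℕ → ℕ → ℤ → ℝ → ℂ), 0 < ρ₀ →
      NPFlat.IsMaxwellField ρ₀ φ → NPFlat.HasExpansion σ ρ₀ φ a →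
      ∀ (n : ℕ) (m : ℤ), |m| ≤ (n : ℤ) + 2 - σ →
      ∀ F : ℂ, NPFlat.IsPastNPConstant φ n ((n : ℤ) + 2 - σ) m F →
        F = Q m n * a 2 (n + 2) (n + 2) m 0 := by
  obtain rfl | rfl : σ = 0 ∨ σ = 1 := by omega
  · -- `modeProj` of the harmonic itself converts the coefficient `a` into the mode of the field
    refine ⟨fun m n => NPFlat.npConst n (n + 2) m * ((-1) ^ (n + 1) * (n + 1).factorial *
      (NPFlat.modeProj (n + 2) m (NPFlat.swsh (-1) (n + 2 : ℕ) m) / (n + 2).factorial)), ?_⟩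
    intro ρ₀ φ a hρ₀ hφ ha n m hm F hF
    have ej : (n : ℤ) + 2 - (0 : ℕ) = ((n + 2 : ℕ) : ℤ) := by push_cast; ring
    rw [ej] at hm hF
    obtain ⟨B, hB, hB0, hlim⟩ := NPFlat.exists_transportSystem_of_isPastNPConstant hρ₀ hφ ha
      (by omega) (by omega) hm hF
    rw [show (((n + 2 : ℕ) : ℂ) * (((n + 2 : ℕ) : ℂ) + 1)) = (n + 2) * (n + 3) by
      push_cast; ring] at hB
    have e := hB.limit_eq_of_degree_eq hlim
    rw [inv_mul_eq_iff_eq_mul₀ (NPFlat.npConst_ne_zero n (by omega) m), hB0] at e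
    rw [e]
    ring
  · -- here `F` itself vanishes as soon as it is finite
    refine ⟨fun _ _ => 0, ?_⟩
    intro ρ₀ φ a hρ₀ hφ ha n m hm F hF
    have ej : (n : ℤ) + 2 - (1 : ℕ) = ((n + 1 : ℕ) : ℤ) := by push_cast; ring
    rw [ej] at hm hF
    obtain ⟨B, hB, -, hlim⟩ := NPFlat.exists_transportSystem_of_isPastNPConstant hρ₀ hφ ha
      (by omega) (by omega) hm hF
    rw [show (((n + 1 : ℕ) : ℂ) * (((n + 1 : ℕ) : ℂ) + 1)) = (n + 1) * (n + 2) by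
      push_cast; ring] at hB
    have e := hB.limit_eq_zero_of_degree_eq_pred hlim
    rw [inv_mul_eq_iff_eq_mul₀ (NPFlat.npConst_ne_zero n (by omega) m), mul_zero] at e
    rw [e, zero_mul]
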